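/- **Setting.** Let $q\ge 1$, $\epsilon=(-1)^q$, let $\Lambda$ be a unital ring with involution $a\mapsto\bar a$ over which the rank of finitely generated free modules is well defined, and let $Z\subset \widetilde K_1(\Lambda)=\operatorname{coker}(K_1(\mathbb Z)\to K_1(\Lambda))$ be a subgroup closed under the operation $[A]\mapsto[A^*]$ (conjugate transpose). Modules are left modules. *Based modules.* An $s$-basis of a module $M$ is a basis of $M\oplus\Lambda^m$ with $n$ elements, for some $m,n\in\mathbb N$; the rank of $M$ is then $n-m$. An isomorphism $f:M\cong N$ of modules with $s$-bases is simple if the torsion in $\widetilde K_1(\Lambda)$ of $f\oplus\mathrm{id}$, computed in the $s$-bases stabilised by standard bases, lies in $Z$. Two $s$-bases of $M$ are equivalent if $\mathrm{id}_M$ is simple; a based module is a module with an equivalence class of $s$-bases. Direct sums, free modules $\Lambda^r$ and duals $M^*=\operatorname{Hom}_\Lambda(M,\Lambda)$ (a left module by $(af)(x)=f(x)\bar a$) are based in the evident way. A short exact sequence $0\to A\to B\to C\to 0$ of based modules is based if the isomorphism $A\oplus C\cong B$ given by some (equivalently any) splitting is simple. *Forms.* Let $T_\epsilon\varphi(x)(y)=\epsilon\,\overline{\varphi(y)(x)}$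 on $\operatorname{Hom}_\Lambda(M,M^*)$ and $Q_\epsilon(M)=\operatorname{coker}(1-T_\epsilon)$. An ($\epsilon$-quadratic) form is a pair $(M,\psi)$ of a based module $M$ and $\psi\in Q_\epsilon(M)$; put $\phi=(1+T_\epsilon)\psi:M\to M^*$. The form is simple if $\phi$ is a simple isomorphism. Isometries are simple isomorphisms $f$ with $f^*\psi'f=\psi$. The hyperbolic form $H_\epsilon(L)$ is $L\oplus L^*$ with the class of $((x,f),(y,g))\mapsto f(y)$. The annihilator of a submodule $j:V\hookrightarrow M$ is $V^\perp=\operatorname{Ker}(j^*\phi:M\to V^*)$. A Lagrangian of a simple form is a based direct summand $i:L\hookrightarrow M$ with $L=L^\perp$ as submodules and $i^*\psi i=0\in Q_\epsilon(L)$; it is simple if $0\to L\to M\xrightarrow{\,i^*\phi\,}L^*\to0$ is based. The abelian monoid $\mathcal F^{\rm zs}_{2q}(\Lambda)$ of $0$-stabilised forms consists of the classes $[v]$ of forms under the relation $v\sim v'$ iff $v\oplus(P,0)\cong v'\oplus(P',0)$ for some based modules $P,P'$, with direct sum as addition. *Quasi-formations.* A quasi-formation $x=(M,\psi;L,V)$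 is a simple form $(M,\psi)$ with a simple Lagrangian $L$ and a based direct summand $V$ with $\operatorname{rk}M=2\operatorname{rk}V$. It is a formation if $V$ is a (not necessarily simple) Lagrangian. An isomorphism of quasi-formations is an isometry $f$ with $f(L)=L'$, $f(V)=V'$ such that $L\cong L'$ and $V\cong V'$ are simple. The trivial formations are $(H_\epsilon(P);P,P^*)$, $P$ a based module. The boundary of a homomorphism $\rho:K\to K^*$, $K$ a based module, is $\delta(K,\rho)=(H_\epsilon(K);K,\{(x,\rho(x))\mid x\in K\})$, where the graph is based by $K$. The abelian monoid $l_{2q+1}(\Lambda)$ is the set of quasi-formations modulo the smallest equivalence relation that is compatible with direct sums, identifies isomorphic quasi-formations, satisfies $x\oplus t\sim x$ for trivial formations $t$, and satisfies $$(M,\psi;K,L)\oplus(M,\psi;L,V)\sim(M,\psi;K,V)$$ for all simple Lagrangians $K,L$; addition is direct sum. An element is elementary if it is the class of some boundary $\delta(K,\rho)$; the elementary elements form a submonoid $\mathcal El_{2q+1}(\Lambda)$. The subset $L_{2q+1}(\Lambda)\subset l_{2q+1}(\Lambda)$ consists of the classes of formations. **Statement.** For every quasi-formation $(M,\psi;L,V)$,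 with inclusion $j:V\hookrightarrow M$, the module $V^\perp$ has an $s$-basis for which $0\to V^\perp\to M\xrightarrow{\,j^*\phi\,}V^*\to0$ is based. With $V^\perp$ so based, and with $\theta$ and $\theta^\perp$ the restrictions of $\psi$ to $V$ and to $V^\perp$, there is a well-defined monoid homomorphism $$b: l_{2q+1}(\Lambda)\to\mathcal F^{\rm zs}_{2q}(\Lambda)\times\mathcal F^{\rm zs}_{2q}(\Lambda),\qquad [M,\psi;L,V]\mapsto([V,\theta],[V^\perp,-\theta^\perp]),$$ and it satisfies: (i) $\operatorname{Im}(b)=\{([w],[w'])\mid [w]+[H_\epsilon(\Lambda^r)]=[w']+[H_\epsilon(\Lambda^r)]\text{ for some } r\ge0\}$. (ii) The restriction of $b$ to $\mathcal El_{2q+1}(\Lambda)$ is an isomorphism of monoids onto the diagonal $\{([w],[w])\mid [w]\in\mathcal F^{\rm zs}_{2q}(\Lambda)\}$. In particular, for every $[w]$ there is a unique elementary element $e([w])\in l_{2q+1}(\Lambda)$ with $b(e([w]))=([w],[w])$. (iii) $b^{-1}((0,0))=L_{2q+1}(\Lambda)$. -/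

import Mathlib

namespace SurgeryMonoid

universe u v

noncomputable section

open Module

section Torsion

/-- The stabilisation `GL_n(R) → GL_{n+k}(R)`, `A ↦ A ⊕ 1`. -/
def stabGL (R : Type u) [Ring R] (n k : ℕ) :
    (Matrix (Fin n) (Fin n) R)ˣ →* (Matrix (Fin (n + k)) (Fin (n + k)) R)ˣ :=
  Units.map
    { toFun := fun A => (Matrix.fromBlocks A 0 0 1).submatrix finSumFinEquiv.symm
        finSumFinEquiv.symm
      map_one' := by simp
      map_mul' := fun A B => by
        rw [Matrix.submatrix_mul_equiv, Matrix.fromBlocks_multiply]; simp }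

/-- The relations presenting `K₁(R) = colim_n GL_n(R)^{ab}` on the generators `[A]`,
`A ∈ GL_n(R)`: `[AB] = [A] + [B]` and `[A ⊕ 1] = [A]`. -/
def K1Rel (R : Type u) [Ring R] :
    AddSubgroup (FreeAbelianGroup (Σ n : ℕ, (Matrix (Fin n) (Fin n) R)ˣ)) :=
  AddSubgroup.closure
    ({x | ∃ (n : ℕ) (A B : (Matrix (Fin n) (Fin n) R)ˣ),
        x = FreeAbelianGroup.of ⟨n, A * B⟩ -
          (FreeAbelianGroup.of ⟨n, A⟩ + FreeAbelianGroup.of ⟨n, B⟩)} ∪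
     {x | ∃ (n k : ℕ) (A : (Matrix (Fin n) (Fin n) R)ˣ),
        x = FreeAbelianGroup.of ⟨n + k, stabGL R n k A⟩ - FreeAbelianGroup.of ⟨n, A⟩})

/-- `K₁(R) = GL(R)^{ab} = colim_n GL_n(R)^{ab}`. -/
def K1 (R : Type u) [Ring R] : Type u :=
  FreeAbelianGroup (Σ n : ℕ, (Matrix (Fin n) (Fin n) R)ˣ) ⧸ K1Rel R

instance (R : Type u) [Ring R] : AddCommGroup (K1 R) :=
  inferInstanceAs (AddCommGroup (_ ⧸ K1Rel R))

/-- The class `[A] ∈ K₁(R)` of an invertible matrix. -/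
def K1.cls {R : Type u} [Ring R] {n : ℕ} (A : (Matrix (Fin n) (Fin n) R)ˣ) : K1 R :=
  QuotientAddGroup.mk (FreeAbelianGroup.of ⟨n, A⟩)

theorem K1.cls_mul {R : Type u} [Ring R] {n : ℕ} (A B : (Matrix (Fin n) (Fin n) R)ˣ) :
    K1.cls (A * B) = K1.cls A + K1.cls B := by
  refine (QuotientAddGroup.eq_iff_sub_mem).2 (AddSubgroup.subset_closure (Or.inl ⟨n, A, B, rfl⟩))

theorem K1.cls_stab {R : Type u} [Ring R] {n : ℕ} (k : ℕ) (A : (Matrix (Fin n) (Fin n) R)ˣ) :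
    K1.cls (stabGL R n k A) = K1.cls A := by
  refine (QuotientAddGroup.eq_iff_sub_mem).2
    (AddSubgroup.subset_closure (Or.inr ⟨n, k, A, rfl⟩))

/-- A homomorphism out of `K₁(R)`. -/
def K1.lift {R : Type u} [Ring R] {G : Type v} [AddCommGroup G]
    (F : ∀ n : ℕ, (Matrix (Fin n) (Fin n) R)ˣ → G)
    (hmul : ∀ n (A B : (Matrix (Fin n) (Fin n) R)ˣ), F n (A * B) = F n A + F n B)
    (hstab : ∀ n k (A : (Matrix (Fin n) (Fin n) R)ˣ), F (n + k) (stabGL R n k A) = F n A) :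
    K1 R →+ G :=
  QuotientAddGroup.lift (K1Rel R) (FreeAbelianGroup.lift fun x => F x.1 x.2) <| by
    refine (AddSubgroup.closure_le _).2 ?_
    rintro x (⟨n, A, B, rfl⟩ | ⟨n, k, A, rfl⟩)
    · simp [hmul]
    · simp [hstab]

/-- Functoriality of `K₁`: `[A] ↦ [f(A)]`. -/
def K1.map {R : Type u} {S : Type v} [Ring R] [Ring S] (f : R →+* S) : K1 R →+ K1 S :=
  K1.lift (fun _ A => K1.cls (Units.map f.mapMatrix.toMonoidHom A))
    (fun n A B => by rw [map_mul, K1.cls_mul])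
    (fun n k A => by
      refine Eq.trans ?_ (K1.cls_stab k _)
      refine congrArg (K1.cls (R := S)) (Units.ext (Matrix.ext fun i j => ?_))
      simp only [stabGL, Units.coe_map, MonoidHom.coe_mk, OneHom.coe_mk, RingHom.toMonoidHom_eq_coe,
        MonoidHom.coe_coe, RingHom.mapMatrix_apply, Matrix.map_apply, Matrix.submatrix_apply]
      rcases finSumFinEquiv.symm i with i | i <;> rcases finSumFinEquiv.symm j with j | j <;>
        simp [Matrix.one_apply, apply_ite f])

/-- The conjugate transpose `[A] ↦ [A*]` on `K₁`. -/
def K1.conj {R : Type u} [Ring R] [StarRing R] : K1 R →+ K1 R :=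
  K1.lift (fun _ A => K1.cls (star A))
    (fun n A B => by rw [star_mul, K1.cls_mul, add_comm])
    (fun n k A => by
      refine Eq.trans ?_ (K1.cls_stab k _)
      refine congrArg (K1.cls (R := R)) (Units.ext (Matrix.ext fun i j => ?_))
      simp only [stabGL, Units.coe_map, MonoidHom.coe_mk, OneHom.coe_mk, Units.coe_star,
        Matrix.star_apply, Matrix.submatrix_apply]
      rcases finSumFinEquiv.symm i with i | i <;> rcases finSumFinEquiv.symm j with j | j <;>
        simp [Matrix.one_apply, apply_ite star, eq_comm])

theorem K1.map_cls {R : Type u} {S : Type v} [Ring R] [Ring S] (f : R →+* S) {n : ℕ}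
    (A : (Matrix (Fin n) (Fin n) R)ˣ) :
    K1.map f (K1.cls A) = K1.cls (Units.map f.mapMatrix.toMonoidHom A) := by
  exact FreeAbelianGroup.lift_apply_of _ _

theorem K1.conj_cls {R : Type u} [Ring R] [StarRing R] {n : ℕ}
    (A : (Matrix (Fin n) (Fin n) R)ˣ) : K1.conj (K1.cls A) = K1.cls (star A) := by
  exact FreeAbelianGroup.lift_apply_of _ _

theorem K1.induction {R : Type u} [Ring R] {p : K1 R → Prop}
    (h0 : p 0) (h : ∀ (n : ℕ) (A : (Matrix (Fin n) (Fin n) R)ˣ), p (K1.cls A))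
    (hneg : ∀ x, p x → p (-x)) (hadd : ∀ x y, p x → p y → p (x + y)) (x : K1 R) : p x := by
  obtain ⟨x, rfl⟩ := QuotientAddGroup.mk_surjective x
  induction x using FreeAbelianGroup.induction_on with
  | zero => exact h0
  | of x => exact h x.1 x.2
  | neg x hx => exact hneg _ hx
  | add x y hx hy => exact hadd _ _ hx hy

theorem K1.conj_map {R : Type u} [Ring R] [StarRing R] (x : K1 ℤ) :
    K1.conj (K1.map (Int.castRingHom R) x) = K1.map (Int.castRingHom R) (K1.conj x) := by
  induction x using K1.induction with
  | h0 => simp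
  | h n A =>
    rw [K1.map_cls, K1.conj_cls, K1.conj_cls, K1.map_cls]
    congr 1
    ext i j
    simp
  | hneg x hx => simp [hx]
  | hadd x y hx hy => simp [hx, hy]

/-- The reduced group `K̃₁(Λ) = coker(K₁(ℤ) → K₁(Λ))`. -/
def RedK1 (Λ : Type u) [Ring Λ] : Type u :=
  K1 Λ ⧸ (K1.map (Int.castRingHom Λ)).range

instance (Λ : Type u) [Ring Λ] : AddCommGroup (RedK1 Λ) :=
  inferInstanceAs (AddCommGroup (_ ⧸ (K1.map (Int.castRingHom Λ)).range))

/-- The class `[A] ∈ K̃₁(Λ)` of an invertible matrix. -/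
def RedK1.cls {Λ : Type u} [Ring Λ] {n : ℕ} (A : (Matrix (Fin n) (Fin n) Λ)ˣ) : RedK1 Λ :=
  QuotientAddGroup.mk (K1.cls A)

/-- The `*`-operation `[A] ↦ [A*]` on `K̃₁(Λ)`. -/
def RedK1.conj {Λ : Type u} [Ring Λ] [StarRing Λ] : RedK1 Λ →+ RedK1 Λ :=
  QuotientAddGroup.map _ _ K1.conj <| by
    rintro _ ⟨x, rfl⟩
    exact ⟨K1.conj x, (K1.conj_map x).symm⟩

theorem RedK1.conj_cls {Λ : Type u} [Ring Λ] [StarRing Λ] {n : ℕ}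
    (A : (Matrix (Fin n) (Fin n) Λ)ˣ) : RedK1.conj (RedK1.cls A) = RedK1.cls (star A) := by
  rw [RedK1.cls, RedK1.cls, ← K1.conj_cls]; rfl

variable {Λ : Type u} [Ring Λ]

theorem RedK1.cls_mul {n : ℕ} (A B : (Matrix (Fin n) (Fin n) Λ)ˣ) :
    RedK1.cls (A * B) = RedK1.cls A + RedK1.cls B := by
  rw [RedK1.cls, K1.cls_mul]; rfl

theorem RedK1.cls_stab {n : ℕ} (k : ℕ) (A : (Matrix (Fin n) (Fin n) Λ)ˣ) :
    RedK1.cls (stabGL Λ n k A) = RedK1.cls A := by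
  rw [RedK1.cls, K1.cls_stab]; rfl

theorem RedK1.cls_int {n : ℕ} (A : (Matrix (Fin n) (Fin n) ℤ)ˣ) :
    RedK1.cls (Units.map (Int.castRingHom Λ).mapMatrix.toMonoidHom A) = 0 := by
  rw [RedK1.cls, ← K1.map_cls]
  exact (QuotientAddGroup.eq_zero_iff _).2 ⟨_, rfl⟩

theorem RedK1.cls_one {n : ℕ} : RedK1.cls (1 : (Matrix (Fin n) (Fin n) Λ)ˣ) = 0 := by
  have := RedK1.cls_mul (1 : (Matrix (Fin n) (Fin n) Λ)ˣ) 1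
  simpa using this

variable {M N P M' N' : Type u} [AddCommGroup M] [Module Λ M] [AddCommGroup N] [Module Λ N]
  [AddCommGroup P] [Module Λ P] [AddCommGroup M'] [Module Λ M'] [AddCommGroup N'] [Module Λ N']

/-- The matrix of an isomorphism of free modules in respect to bases. -/
def isoMatrix {n : ℕ} (b : Basis (Fin n) Λ M) (c : Basis (Fin n) Λ N) (f : M ≃ₗ[Λ] N) :
    (Matrix (Fin n) (Fin n) Λ)ˣ where
  val := Matrix.of fun i j => c.repr (f (b i)) j
  inv := Matrix.of fun i j => b.repr (f.symm (c i)) j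
  val_inv := by
    ext i k
    have h := congrArg (fun x => b.repr (f.symm x) k) (c.sum_repr (f (b i)))
    simp only [map_sum, map_smul, Finsupp.coe_finsetSum, Finset.sum_apply, Finsupp.smul_apply,
      smul_eq_mul, LinearEquiv.symm_apply_apply, Basis.repr_self] at h
    simp only [Matrix.mul_apply, Matrix.of_apply, h, Matrix.one_apply, Finsupp.single_apply]
  inv_val := by
    ext i k
    have h := congrArg (fun x => c.repr (f x) k) (b.sum_repr (f.symm (c i)))
    simp only [map_sum, map_smul, Finsupp.coe_finsetSum, Finset.sum_apply, Finsupp.smul_apply,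
      smul_eq_mul, LinearEquiv.apply_symm_apply, Basis.repr_self] at h
    simp only [Matrix.mul_apply, Matrix.of_apply, h, Matrix.one_apply, Finsupp.single_apply]

/-- The torsion in `K̃₁(Λ)` of an isomorphism of free modules in respect to bases. -/
def torsion {n : ℕ} (b : Basis (Fin n) Λ M) (c : Basis (Fin n) Λ N) (f : M ≃ₗ[Λ] N) : RedK1 Λ :=
  RedK1.cls (isoMatrix b c f)

theorem torsion_trans {n : ℕ} (b : Basis (Fin n) Λ M) (c : Basis (Fin n) Λ N)
    (d : Basis (Fin n) Λ P) (f : M ≃ₗ[Λ] N) (g : N ≃ₗ[Λ] P) :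
    torsion b d (f.trans g) = torsion b c f + torsion c d g := by
  rw [torsion, torsion, torsion, ← RedK1.cls_mul]
  congr 1
  ext i k
  have h := congrArg (fun x => d.repr (g x) k) (c.sum_repr (f (b i)))
  simp only [map_sum, map_smul, Finsupp.coe_finsetSum, Finset.sum_apply, Finsupp.smul_apply,
    smul_eq_mul] at h
  simp only [isoMatrix, Units.val_mul, Matrix.mul_apply, Matrix.of_apply, h, LinearEquiv.trans_apply]

theorem torsion_eq_zero {n : ℕ} (b : Basis (Fin n) Λ M) (c : Basis (Fin n) Λ N)
    (f : M ≃ₗ[Λ] N) (h : ∀ i, f (b i) = c i) : torsion b c f = 0 := by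
  rw [torsion, ← RedK1.cls_one (n := n)]
  congr 1
  ext i j
  simp [isoMatrix, h, Finsupp.single_apply, Matrix.one_apply]

/-- Isomorphisms with integral matrices have torsion zero. -/
theorem torsion_int {n : ℕ} (b : Basis (Fin n) Λ M) (c : Basis (Fin n) Λ N)
    (f : M ≃ₗ[Λ] N) (A : (Matrix (Fin n) (Fin n) ℤ)ˣ)
    (h : ∀ i, f (b i) = ∑ j, (A.1 i j) • c j) : torsion b c f = 0 := by
  rw [torsion, ← RedK1.cls_int A]
  congr 1
  ext i j
  simp [isoMatrix, h, Finsupp.single_apply]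

theorem torsion_reindex {n : ℕ} (b : Basis (Fin n) Λ M) (e : Fin n ≃ Fin n) :
    torsion b (b.reindex e) (LinearEquiv.refl Λ M) = 0 := by
  refine torsion_int _ _ _ ⟨e.toPEquiv.toMatrix, e.symm.toPEquiv.toMatrix, ?_, ?_⟩ ?_
  · rw [← PEquiv.toMatrix_trans, ← Equiv.toPEquiv_trans]; simp
  · rw [← PEquiv.toMatrix_trans, ← Equiv.toPEquiv_trans]; simp
  · intro i
    simp [PEquiv.toMatrix_apply, Equiv.toPEquiv_apply, eq_comm]

theorem torsion_refl {n : ℕ} (b : Basis (Fin n) Λ M) :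
    torsion b b (LinearEquiv.refl Λ M) = 0 := torsion_eq_zero _ _ _ fun _ => rfl

theorem torsion_symm {n : ℕ} (b : Basis (Fin n) Λ M) (c : Basis (Fin n) Λ N)
    (f : M ≃ₗ[Λ] N) : torsion c b f.symm = - torsion b c f := by
  have h := torsion_trans b c b f f.symm
  rw [LinearEquiv.self_trans_symm, torsion_refl] at h
  exact eq_neg_of_add_eq_zero_right h.symm

theorem torsion_prod_refl {n k : ℕ} (b : Basis (Fin n) Λ M) (c : Basis (Fin n) Λ N)
    (d : Basis (Fin k) Λ P) (f : M ≃ₗ[Λ] N) :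
    torsion ((b.prod d).reindex finSumFinEquiv) ((c.prod d).reindex finSumFinEquiv)
      (f.prodCongr (LinearEquiv.refl Λ P)) = torsion b c f := by
  rw [torsion, torsion]
  refine Eq.trans ?_ (RedK1.cls_stab k _)
  refine congrArg (RedK1.cls (Λ := Λ)) (Units.ext (Matrix.ext fun i j => ?_))
  simp only [isoMatrix, stabGL, Units.coe_map, MonoidHom.coe_mk, OneHom.coe_mk, Matrix.of_apply,
    Basis.reindex_apply, Basis.repr_reindex_apply, Matrix.submatrix_apply]
  rcases finSumFinEquiv.symm i with i | i <;> rcases finSumFinEquiv.symm j with j | j <;>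
    simp [Matrix.one_apply, Finsupp.single_apply]


/-- An isomorphism of f.g. free modules with bases is `Z`-simple if its torsion, computed for
any numbering of the bases, lies in `Z`. -/
def IsSimpleFor {ι κ : Type} (Z : AddSubgroup (RedK1 Λ)) (b : Basis ι Λ M) (c : Basis κ Λ N)
    (f : M ≃ₗ[Λ] N) : Prop :=
  ∃ (n : ℕ) (e : ι ≃ Fin n) (e' : κ ≃ Fin n), torsion (b.reindex e) (c.reindex e') f ∈ Z

namespace IsSimpleFor

variable {Z : AddSubgroup (RedK1 Λ)} {ι κ μ ι' κ' : Type}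

theorem mem {b : Basis ι Λ M} {c : Basis κ Λ N} {f : M ≃ₗ[Λ] N} (h : IsSimpleFor Z b c f)
    {n : ℕ} (e : ι ≃ Fin n) (e' : κ ≃ Fin n) : torsion (b.reindex e) (c.reindex e') f ∈ Z := by
  obtain ⟨m, d, d', h⟩ := h
  obtain rfl : m = n := by simpa using Fintype.card_congr (d.symm.trans e)
  have h1 : b.reindex e = (b.reindex d).reindex (d.symm.trans e) := by ext; simp
  have h2 : c.reindex e' = (c.reindex d').reindex (d'.symm.trans e') := by ext; simp
  have h3 := torsion_trans (b.reindex e) (b.reindex d) (c.reindex e')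
    (LinearEquiv.refl Λ M) f
  have h4 := torsion_trans (b.reindex d) (c.reindex d') (c.reindex e') f (LinearEquiv.refl Λ N)
  have h5 := torsion_symm (b.reindex d) (b.reindex e) (LinearEquiv.refl Λ M)
  rw [LinearEquiv.refl_symm] at h5
  rw [LinearEquiv.refl_trans] at h3
  rw [LinearEquiv.trans_refl] at h4
  rw [h3, h4, h5, h1, torsion_reindex, h2, torsion_reindex]
  simpa using h

theorem trans {b : Basis ι Λ M} {c : Basis κ Λ N} {d : Basis μ Λ P} {f : M ≃ₗ[Λ] N}
    {g : N ≃ₗ[Λ] P} (h : IsSimpleFor Z b c f) (h' : IsSimpleFor Z c d g) :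
    IsSimpleFor Z b d (f.trans g) := by
  obtain ⟨n, e, e', h⟩ := h
  obtain ⟨m, e1, e2, h'⟩ := h'
  obtain rfl : m = n := by simpa using Fintype.card_congr (e1.symm.trans e')
  have h' := mem ⟨m, e1, e2, h'⟩ e' e2
  exact ⟨m, e, e2, by rw [torsion_trans _ (c.reindex e')]; exact Z.add_mem h h'⟩

theorem symm {b : Basis ι Λ M} {c : Basis κ Λ N} {f : M ≃ₗ[Λ] N} (h : IsSimpleFor Z b c f) :
    IsSimpleFor Z c b f.symm := by
  obtain ⟨n, e, e', h⟩ := h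
  exact ⟨n, e', e, by rw [torsion_symm]; exact Z.neg_mem h⟩

theorem of_smul [Finite ι] {b : Basis ι Λ M} {c : Basis κ Λ N} {f : M ≃ₗ[Λ] N} (σ : ι ≃ κ)
    (ε : ι → ℤˣ) (h : ∀ i, f (b i) = (ε i : ℤ) • c (σ i)) : IsSimpleFor Z b c f := by
  have := Fintype.ofFinite ι
  refine ⟨_, Fintype.equivFin ι, σ.symm.trans (Fintype.equivFin ι), ?_⟩
  rw [torsion_int _ _ _ ⟨Matrix.diagonal fun i => (ε ((Fintype.equivFin ι).symm i) : ℤ),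
    Matrix.diagonal fun i => (ε ((Fintype.equivFin ι).symm i) : ℤ), ?_, ?_⟩]
  · exact Z.zero_mem
  · intro i
    simp [h, Matrix.diagonal_apply]
  · simp [Matrix.diagonal_mul_diagonal, ← Units.val_mul]
  · simp [Matrix.diagonal_mul_diagonal, ← Units.val_mul]

theorem of_perm [Finite ι] {b : Basis ι Λ M} {c : Basis κ Λ N} {f : M ≃ₗ[Λ] N} (σ : ι ≃ κ)
    (h : ∀ i, f (b i) = c (σ i)) : IsSimpleFor Z b c f :=
  of_smul σ (fun _ => 1) (by simpa using h)

theorem prod_refl [Finite μ] {b : Basis ι Λ M} {c : Basis κ Λ N} (d : Basis μ Λ P)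
    {f : M ≃ₗ[Λ] N} (h : IsSimpleFor Z b c f) :
    IsSimpleFor Z (b.prod d) (c.prod d) (f.prodCongr (LinearEquiv.refl Λ P)) := by
  obtain ⟨n, e, e', h⟩ := h
  have := Fintype.ofFinite μ
  let t := Fintype.equivFin μ
  refine ⟨_, (Equiv.sumCongr e t).trans finSumFinEquiv, (Equiv.sumCongr e' t).trans finSumFinEquiv,
    ?_⟩
  rw [← torsion_prod_refl _ _ (d.reindex t)] at h
  convert h using 2
  all_goals
    ext i
    all_goals
      simp only [Basis.reindex_apply, Equiv.symm_trans_apply, Equiv.sumCongr_symm]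
      rcases finSumFinEquiv.symm i with i | i <;> simp

theorem cancel [Finite ι] [Finite κ] [Finite μ] {b : Basis ι Λ M} {c : Basis κ Λ N}
    {d : Basis μ Λ P} {f : M ≃ₗ[Λ] N}
    (h : IsSimpleFor Z (b.prod d) (c.prod d) (f.prodCongr (LinearEquiv.refl Λ P))) :
    IsSimpleFor Z b c f := by
  have := Fintype.ofFinite μ
  have := Fintype.ofFinite ι
  have := Fintype.ofFinite κ
  have hc : Fintype.card ι = Fintype.card κ := by
    obtain ⟨n, e, e', -⟩ := h
    simpa using Fintype.card_congr (e.trans e'.symm)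
  let t := Fintype.equivFin μ
  let e := Fintype.equivFin ι
  let e' : κ ≃ Fin (Fintype.card ι) := (Fintype.equivFin κ).trans (finCongr hc.symm)
  refine ⟨_, e, e', ?_⟩
  rw [← torsion_prod_refl _ _ (d.reindex t)]
  convert h.mem ((Equiv.sumCongr e t).trans finSumFinEquiv)
    ((Equiv.sumCongr e' t).trans finSumFinEquiv) using 2
  all_goals
    ext i
    all_goals
      simp only [Basis.reindex_apply, Equiv.symm_trans_apply, Equiv.sumCongr_symm]
      rcases finSumFinEquiv.symm i with i | i <;> simp

theorem finite_left {b : Basis ι Λ M} {c : Basis κ Λ N} {f : M ≃ₗ[Λ] N}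
    (h : IsSimpleFor Z b c f) : Finite ι := by
  obtain ⟨n, e, -⟩ := h
  exact Finite.of_equiv _ e.symm

theorem prod {b : Basis ι Λ M} {c : Basis κ Λ N} {b' : Basis ι' Λ M'} {c' : Basis κ' Λ N'}
    {f : M ≃ₗ[Λ] N} {g : M' ≃ₗ[Λ] N'} (h : IsSimpleFor Z b c f) (h' : IsSimpleFor Z b' c' g) :
    IsSimpleFor Z (b.prod b') (c.prod c') (f.prodCongr g) := by
  have := h.finite_left
  have := h'.finite_left
  have := h.symm.finite_left
  have := h'.symm.finite_left
  have h1 := h.prod_refl b'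
  have h2 := h'.prod_refl c
  have s1 : IsSimpleFor Z (c.prod b') (b'.prod c) (LinearEquiv.prodComm Λ N M') :=
    of_perm (Equiv.sumComm _ _) (by rintro (i | i) <;> simp)
  have s2 : IsSimpleFor Z (c'.prod c) (c.prod c') (LinearEquiv.prodComm Λ N' N) :=
    of_perm (Equiv.sumComm _ _) (by rintro (i | i) <;> simp)
  have h3 := ((h1.trans s1).trans h2).trans s2
  convert h3 using 1
  exact LinearEquiv.ext fun _ => rfl

theorem congr {b : Basis ι Λ M} {c : Basis κ Λ N} {f g : M ≃ₗ[Λ] N} (h : IsSimpleFor Z b c f)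
    (hfg : ∀ x, f x = g x) : IsSimpleFor Z b c g :=
  LinearEquiv.ext hfg ▸ h

theorem of_map [Finite ι] (b : Basis ι Λ M) (e : ι ≃ κ) (g : M ≃ₗ[Λ] N) :
    IsSimpleFor Z b ((b.reindex e).map g) g :=
  of_perm e fun i => by simp

/-- Torsion is invariant under conjugation. -/
theorem conj {b : Basis ι Λ M} {c : Basis ι Λ N} {f : M ≃ₗ[Λ] M} (g : M ≃ₗ[Λ] N)
    [Finite ι] (h : IsSimpleFor Z b b f) :
    IsSimpleFor Z c c ((g.symm.trans f).trans g) := by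
  have := Fintype.ofFinite ι
  let e := Fintype.equivFin ι
  refine ⟨_, e, e, ?_⟩
  have h := h.mem e e
  rw [torsion_trans _ (b.reindex e), torsion_trans _ (b.reindex e), torsion_symm]
  simpa using h

end IsSimpleFor

end Torsion

section Based

/-- A based module: a module `M` together with an `s`-basis, that is a basis of `M ⊕ Λ^m`.
Only the class of the `s`-basis matters below: two `s`-bases of `M` are `Z`-equivalent if and
only if the identity of `M` is `Z`-simple (`BasedModule.IsSimple`) in respect to them. -/
structure BasedModule (Λ : Type u) [Ring Λ] where
  carrier : Type u
  [addCommGroup : AddCommGroup carrier]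
  [module : Module Λ carrier]
  m : ℕ
  n : ℕ
  basis : Basis (Fin n) Λ (carrier × (Fin m → Λ))

attribute [instance] BasedModule.addCommGroup BasedModule.module

instance (Λ : Type u) [Ring Λ] : CoeSort (BasedModule Λ) (Type u) := ⟨BasedModule.carrier⟩

namespace BasedModule

variable {Λ : Type u} [Ring Λ]

/-- The rank `n - m` of a stably free module with `M ⊕ Λ^m ≅ Λ^n`. -/
def rank (X : BasedModule Λ) : ℤ := (X.n : ℤ) - X.m

/-- `f ⊕ id` on `X ⊕ Λ^m ⊕ Λ^{m'}`, where the two free summands of the target are written in the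
order in which the stabilised `s`-basis of the target needs them. -/
def stabIso (X Y : BasedModule Λ) (f : X ≃ₗ[Λ] Y) :
    ((X × (Fin X.m → Λ)) × (Fin Y.m → Λ)) ≃ₗ[Λ] ((Y × (Fin Y.m → Λ)) × (Fin X.m → Λ)) where
  toFun p := ((f p.1.1, p.2), p.1.2)
  invFun p := ((f.symm p.1.1, p.2), p.1.2)
  map_add' _ _ := by simp
  map_smul' _ _ := by simp
  left_inv _ := by simp
  right_inv _ := by simp

/-- `f : X ≅ Y` is (`Z`-)simple: the torsion of `f ⊕ id` in respect to the `s`-bases of `X` and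
`Y`, stabilised by standard bases, lies in `Z`. -/
def IsSimple (Z : AddSubgroup (RedK1 Λ)) (X Y : BasedModule Λ) (f : X ≃ₗ[Λ] Y) : Prop :=
  IsSimpleFor Z (X.basis.prod (Pi.basisFun Λ (Fin Y.m))) (Y.basis.prod (Pi.basisFun Λ (Fin X.m)))
    (stabIso X Y f)

/-- `(Λ^a) ⊕ (Λ^b) ≅ Λ^{a+b}`, standard basis to standard basis. -/
def finAdd (Λ : Type u) [Ring Λ] (a b : ℕ) :
    ((Fin a → Λ) × (Fin b → Λ)) ≃ₗ[Λ] (Fin (a + b) → Λ) :=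
  ((Pi.basisFun Λ (Fin a)).prod (Pi.basisFun Λ (Fin b))).equiv (Pi.basisFun Λ (Fin (a + b)))
    finSumFinEquiv

/-- The direct sum of based modules. -/
abbrev prod (X Y : BasedModule Λ) : BasedModule Λ where
  carrier := X × Y
  m := X.m + Y.m
  n := X.n + Y.n
  basis := ((X.basis.prod Y.basis).reindex finSumFinEquiv).map
    ((LinearEquiv.prodProdProdComm Λ X (Fin X.m → Λ) Y (Fin Y.m → Λ)).trans
      ((LinearEquiv.refl Λ (X × Y)).prodCongr (finAdd Λ X.m Y.m)))

/-- The zero module. -/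
abbrev zero (Λ : Type u) [Ring Λ] : BasedModule Λ where
  carrier := PUnit.{u + 1}
  m := 0
  n := 0
  basis := Basis.empty _

/-- The free module `Λ^r` with its standard basis. -/
abbrev free (Λ : Type u) [Ring Λ] (r : ℕ) : BasedModule Λ where
  carrier := Fin r → Λ
  m := 0
  n := r
  basis := (Pi.basisFun Λ (Fin r)).map LinearEquiv.prodUnique.symm

variable {Z : AddSubgroup (RedK1 Λ)}

theorem ghost {ι μ : Type} [Finite ι] [Finite μ] {A F : Type u} [AddCommGroup A] [Module Λ A]
    [AddCommGroup F] [Module Λ F] (B : Basis ι Λ (A × F)) (d : Basis μ Λ F) {D : F ≃ₗ[Λ] F}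
    (hD : IsSimpleFor Z d d D) :
    IsSimpleFor Z B B ((LinearEquiv.refl Λ A).prodCongr D) := by
  have h1 : IsSimpleFor Z (B.prod d) (B.prod d)
      ((LinearEquiv.refl Λ (A × F)).prodCongr D) :=
    (IsSimpleFor.of_perm (Equiv.refl _) fun _ => rfl).prod hD
  let g : ((A × F) × F) ≃ₗ[Λ] ((A × F) × F) :=
    { toFun := fun p => ((p.1.1, p.2), p.1.2)
      invFun := fun p => ((p.1.1, p.2), p.1.2)
      map_add' := fun _ _ => rfl
      map_smul' := fun _ _ => rfl
      left_inv := fun _ => rfl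
      right_inv := fun _ => rfl }
  have h2 := h1.conj (c := B.prod d) g
  refine IsSimpleFor.cancel (d := d) ?_
  convert h2 using 1
  exact LinearEquiv.ext fun _ => rfl

theorem IsSimple.of_direct {X Y : BasedModule Λ} {f : X ≃ₗ[Λ] Y}
    (σ : (Fin X.m → Λ) ≃ₗ[Λ] (Fin Y.m → Λ))
    (hσ : IsSimpleFor Z (Pi.basisFun Λ (Fin X.m)) (Pi.basisFun Λ (Fin Y.m)) σ)
    (h : IsSimpleFor Z X.basis Y.basis (f.prodCongr σ)) : IsSimple Z X Y f := by
  have h1 := h.prod hσ.symm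
  let d := (Pi.basisFun Λ (Fin X.m)).prod (Pi.basisFun Λ (Fin Y.m))
  let D : ((Fin X.m → Λ) × (Fin Y.m → Λ)) ≃ₗ[Λ] ((Fin X.m → Λ) × (Fin Y.m → Λ)) :=
    { toFun := fun p => (σ.symm p.2, σ p.1)
      invFun := fun p => (σ.symm p.2, σ p.1)
      map_add' := fun _ _ => by simp
      map_smul' := fun _ _ => by simp
      left_inv := fun _ => by simp
      right_inv := fun _ => by simp }
  have hD : IsSimpleFor Z d d D := by
    have s : IsSimpleFor Z ((Pi.basisFun Λ (Fin Y.m)).prod (Pi.basisFun Λ (Fin X.m))) d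
        (LinearEquiv.prodComm Λ _ _) :=
      IsSimpleFor.of_perm (Equiv.sumComm _ _) (by rintro (i | i) <;> simp [d])
    have h2 := (hσ.prod hσ.symm).trans s
    convert h2 using 1
    exact LinearEquiv.ext fun _ => rfl
  have a1 : IsSimpleFor Z (X.basis.prod (Pi.basisFun Λ (Fin Y.m)))
      ((X.basis.prod (Pi.basisFun Λ (Fin Y.m))).map (LinearEquiv.prodAssoc Λ _ _ _))
      (LinearEquiv.prodAssoc Λ _ _ _) :=
    IsSimpleFor.of_perm (Equiv.refl _) fun _ => rfl
  have h3 := ((a1.trans (ghost _ d hD)).trans a1.symm).trans h1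
  refine h3.congr fun p => ?_
  change ((f p.1.1, σ (σ.symm p.2)), σ.symm (σ p.1.2)) = ((f p.1.1, p.2), p.1.2)
  simp

theorem IsSimple.refl (X : BasedModule Λ) : IsSimple Z X X (LinearEquiv.refl Λ X) :=
  .of_direct (LinearEquiv.refl _ _) (IsSimpleFor.of_perm (Equiv.refl _) fun _ => rfl)
    (IsSimpleFor.of_perm (Equiv.refl _) fun _ => rfl)

theorem IsSimple.symm {X Y : BasedModule Λ} {f : X ≃ₗ[Λ] Y} (h : IsSimple Z X Y f) :
    IsSimple Z Y X f.symm := by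
  unfold IsSimple at h
  exact h.symm.congr fun _ => rfl

theorem IsSimple.trans {X Y W : BasedModule Λ} {f : X ≃ₗ[Λ] Y} {g : Y ≃ₗ[Λ] W}
    (hf : IsSimple Z X Y f) (hg : IsSimple Z Y W g) : IsSimple Z X W (f.trans g) := by
  have h1 := IsSimpleFor.prod_refl (Pi.basisFun Λ (Fin W.m)) hf
  have h2 := IsSimpleFor.prod_refl (Pi.basisFun Λ (Fin X.m)) hg
  unfold IsSimple
  refine IsSimpleFor.cancel (d := Pi.basisFun Λ (Fin Y.m)) ?_
  have sw (U : BasedModule Λ) (a b : ℕ) :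
      ∃ s : (((U × (Fin U.m → Λ)) × (Fin a → Λ)) × (Fin b → Λ)) ≃ₗ[Λ]
        (((U × (Fin U.m → Λ)) × (Fin b → Λ)) × (Fin a → Λ)),
      (∀ p, s p = ((p.1.1, p.2), p.1.2)) ∧
      IsSimpleFor Z ((U.basis.prod (Pi.basisFun Λ (Fin a))).prod (Pi.basisFun Λ (Fin b)))
        ((U.basis.prod (Pi.basisFun Λ (Fin b))).prod (Pi.basisFun Λ (Fin a))) s := by
    refine ⟨{ toFun := fun p => ((p.1.1, p.2), p.1.2)
              invFun := fun p => ((p.1.1, p.2), p.1.2)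
              map_add' := fun _ _ => rfl
              map_smul' := fun _ _ => rfl
              left_inv := fun _ => rfl
              right_inv := fun _ => rfl }, fun _ => rfl, ?_⟩
    refine IsSimpleFor.of_perm ⟨
      Sum.elim (Sum.elim (fun i => .inl (.inl i)) (fun i => .inr i)) (fun i => .inl (.inr i)),
      Sum.elim (Sum.elim (fun i => .inl (.inl i)) (fun i => .inr i)) (fun i => .inl (.inr i)),
      ?_, ?_⟩ ?_
    · rintro ((i | i) | i) <;> rfl
    · rintro ((i | i) | i) <;> rfl
    · rintro ((i | i) | i) <;> simp
  obtain ⟨s1, e1, p1⟩ := sw X W.m Y.m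
  obtain ⟨s2, e2, p2⟩ := sw Y X.m W.m
  obtain ⟨s3, e3, p3⟩ := sw W Y.m X.m
  have h3 := (((p1.trans h1).trans p2).trans h2).trans p3
  refine h3.congr fun p => ?_
  simp only [LinearEquiv.trans_apply, LinearEquiv.prodCongr_apply, LinearEquiv.refl_apply, e1, e2,
    e3, stabIso, LinearEquiv.coe_mk, LinearMap.coe_mk, AddHom.coe_mk]

theorem finAdd_simple (a b : ℕ) :
    IsSimpleFor Z ((Pi.basisFun Λ (Fin a)).prod (Pi.basisFun Λ (Fin b)))
      (Pi.basisFun Λ (Fin (a + b))) (finAdd Λ a b) :=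
  IsSimpleFor.of_perm finSumFinEquiv fun i => by simp only [finAdd, Basis.equiv_apply]

theorem prod_simple (X Y : BasedModule Λ) :
    IsSimpleFor Z (X.basis.prod Y.basis) (prod X Y).basis
      ((LinearEquiv.prodProdProdComm Λ X (Fin X.m → Λ) Y (Fin Y.m → Λ)).trans
      ((LinearEquiv.refl Λ (X × Y)).prodCongr (finAdd Λ X.m Y.m))) :=
  IsSimpleFor.of_map _ _ _

theorem IsSimple.prod {X Y X' Y' : BasedModule Λ} {f : X ≃ₗ[Λ] Y} {f' : X' ≃ₗ[Λ] Y'}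
    (h : IsSimple Z X Y f) (h' : IsSimple Z X' Y' f') :
    IsSimple Z (X.prod X') (Y.prod Y') (f.prodCongr f') := by
  have key (U U' : BasedModule Λ) (a a' : ℕ) :
      ∃ s : (((U × (Fin U.m → Λ)) × (Fin a → Λ)) × ((U' × (Fin U'.m → Λ)) × (Fin a' → Λ))) ≃ₗ[Λ]
        (((U.prod U') × (Fin (U.prod U').m → Λ)) × (Fin (a + a') → Λ)),
      (∀ p, s p = (((p.1.1.1, p.2.1.1), finAdd Λ _ _ (p.1.1.2, p.2.1.2)),
        finAdd Λ _ _ (p.1.2, p.2.2))) ∧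
      IsSimpleFor Z ((U.basis.prod (Pi.basisFun Λ (Fin a))).prod
        (U'.basis.prod (Pi.basisFun Λ (Fin a'))))
        ((U.prod U').basis.prod (Pi.basisFun Λ (Fin (a + a')))) s := by
    have h1 : IsSimpleFor Z ((U.basis.prod (Pi.basisFun Λ (Fin a))).prod
        (U'.basis.prod (Pi.basisFun Λ (Fin a'))))
        ((U.basis.prod U'.basis).prod ((Pi.basisFun Λ (Fin a)).prod (Pi.basisFun Λ (Fin a'))))
        (LinearEquiv.prodProdProdComm Λ _ _ _ _) :=
      IsSimpleFor.of_perm (Equiv.sumSumSumComm _ _ _ _)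
        (by rintro ((i | i) | (i | i)) <;> simp)
    exact ⟨_, fun _ => rfl, h1.trans ((prod_simple U U').prod (finAdd_simple a a'))⟩
  obtain ⟨s1, e1, p1⟩ := key X X' Y.m Y'.m
  obtain ⟨s2, e2, p2⟩ := key Y Y' X.m X'.m
  have h3 := (p1.symm.trans (IsSimpleFor.prod h h')).trans p2
  refine h3.congr fun p => ?_
  obtain ⟨p, rfl⟩ := s1.surjective p
  change s2 ((stabIso X Y f).prodCongr (stabIso X' Y' f') (s1.symm (s1 p))) = _
  rw [LinearEquiv.symm_apply_apply, e1, e2]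
  rfl

theorem IsSimple.congr {X Y : BasedModule Λ} {f g : X ≃ₗ[Λ] Y} (h : IsSimple Z X Y f)
    (hfg : ∀ x, f x = g x) : IsSimple Z X Y g :=
  LinearEquiv.ext hfg ▸ h

theorem IsSimple.prodComm (X Y : BasedModule Λ) :
    IsSimple Z (X.prod Y) (Y.prod X) (LinearEquiv.prodComm Λ X Y) := by
  refine .of_direct (((finAdd Λ X.m Y.m).symm.trans (LinearEquiv.prodComm Λ _ _)).trans
    (finAdd Λ Y.m X.m)) ?_ ?_
  · exact ((finAdd_simple _ _).symm.trans (IsSimpleFor.of_perm (Equiv.sumComm _ _)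
      (by rintro (i | i) <;> simp))).trans (finAdd_simple _ _)
  · have s : IsSimpleFor Z (X.basis.prod Y.basis) (Y.basis.prod X.basis)
        (LinearEquiv.prodComm Λ _ _) :=
      IsSimpleFor.of_perm (Equiv.sumComm _ _) (by rintro (i | i) <;> simp)
    exact (((prod_simple X Y).symm.trans s).trans (prod_simple Y X)).congr fun _ => rfl

theorem IsSimple.prodAssoc (X Y W : BasedModule Λ) :
    IsSimple Z ((X.prod Y).prod W) (X.prod (Y.prod W)) (LinearEquiv.prodAssoc Λ X Y W) := by
  have f1 : IsSimpleFor Z (((Pi.basisFun Λ (Fin X.m)).prod (Pi.basisFun Λ (Fin Y.m))).prod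
      (Pi.basisFun Λ (Fin W.m))) (Pi.basisFun Λ (Fin (X.m + Y.m + W.m))) _ :=
    ((finAdd_simple _ _).prod_refl _).trans (finAdd_simple _ _)
  have f2 : IsSimpleFor Z ((Pi.basisFun Λ (Fin X.m)).prod ((Pi.basisFun Λ (Fin Y.m)).prod
      (Pi.basisFun Λ (Fin W.m)))) (Pi.basisFun Λ (Fin (X.m + (Y.m + W.m)))) _ :=
    ((IsSimpleFor.of_perm (f := LinearEquiv.refl _ _) (Equiv.refl _) fun _ => rfl).prod
      (finAdd_simple _ _)).trans (finAdd_simple _ _)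
  have f3 : IsSimpleFor Z (((Pi.basisFun Λ (Fin X.m)).prod (Pi.basisFun Λ (Fin Y.m))).prod
      (Pi.basisFun Λ (Fin W.m))) ((Pi.basisFun Λ (Fin X.m)).prod ((Pi.basisFun Λ (Fin Y.m)).prod
      (Pi.basisFun Λ (Fin W.m)))) (LinearEquiv.prodAssoc Λ _ _ _) :=
    IsSimpleFor.of_perm (Equiv.sumAssoc _ _ _) (by rintro ((i | i) | i) <;> simp)
  refine .of_direct _ ((f1.symm.trans f3).trans f2) ?_
  have g1 := ((prod_simple (Z := Z) X Y).prod_refl W.basis).trans (prod_simple (X.prod Y) W)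
  have g2 := ((IsSimpleFor.of_perm (Z := Z) (b := X.basis) (c := X.basis)
    (f := LinearEquiv.refl _ _) (Equiv.refl _) fun _ => rfl).prod
      (prod_simple Y W)).trans (prod_simple X (Y.prod W))
  have g3 : IsSimpleFor Z ((X.basis.prod Y.basis).prod W.basis)
      (X.basis.prod (Y.basis.prod W.basis)) (LinearEquiv.prodAssoc Λ _ _ _) :=
    IsSimpleFor.of_perm (Equiv.sumAssoc _ _ _) (by rintro ((i | i) | i) <;> simp)
  refine ((g1.symm.trans g3).trans g2).congr fun p => ?_
  rfl

/-- `0 ⊕ M ≅ M`. -/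
def sndEquiv (A M : Type u) [AddCommGroup A] [Module Λ A] [Subsingleton A] [AddCommGroup M]
    [Module Λ M] : (A × M) ≃ₗ[Λ] M where
  toFun := Prod.snd
  invFun x := (0, x)
  map_add' _ _ := rfl
  map_smul' _ _ := rfl
  left_inv _ := Prod.ext (Subsingleton.elim _ _) rfl
  right_inv _ := rfl

theorem IsSimple.zeroProd (X : BasedModule Λ) :
    IsSimple Z ((zero Λ).prod X) X (sndEquiv PUnit.{u + 1} X) := by
  have f0 : IsSimpleFor Z ((Pi.basisFun Λ (Fin 0)).prod (Pi.basisFun Λ (Fin X.m)))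
      (Pi.basisFun Λ (Fin X.m)) (sndEquiv _ _) :=
    IsSimpleFor.of_perm (Equiv.emptySum _ _) (by
      rintro (i | i)
      · exact i.elim0
      · simp [sndEquiv])
  have g0 : IsSimpleFor Z ((zero Λ).basis.prod X.basis) X.basis
      (sndEquiv (PUnit.{u + 1} × (Fin 0 → Λ)) _) :=
    IsSimpleFor.of_perm (Equiv.emptySum (Fin 0) _) (by
      rintro (i | i)
      · exact i.elim0
      · rw [Basis.prod_apply]
        rfl)
  refine .of_direct _ ((finAdd_simple 0 X.m).symm.trans f0) ?_
  exact ((prod_simple (zero Λ) X).symm.trans g0).congr fun p => rfl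

/-- Multiplication by `±1`. -/
def signEquiv (ε : ℤˣ) (M : Type u) [AddCommGroup M] [Module Λ M] : M ≃ₗ[Λ] M where
  toFun x := (ε : ℤ) • x
  invFun x := (ε : ℤ) • x
  map_add' := smul_add _
  map_smul' a x := smul_comm _ a x
  left_inv x := by beta_reduce; rw [smul_smul, Int.units_coe_mul_self, one_smul]
  right_inv x := by beta_reduce; rw [smul_smul, Int.units_coe_mul_self, one_smul]

theorem IsSimple.sign (ε : ℤˣ) (X : BasedModule Λ) : IsSimple Z X X (signEquiv ε X) :=
  .of_direct (signEquiv ε _) (IsSimpleFor.of_smul (Equiv.refl _) (fun _ => ε) fun _ => rfl)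
    (IsSimpleFor.of_smul (Equiv.refl _) (fun _ => ε) fun _ => rfl)

end BasedModule
end Based
section Dual


variable {Λ : Type u} [Ring Λ] [StarRing Λ]

/-- The dual `M* = Hom_Λ(M, Λ)`, a left module through the involution: `(a f)(x) = f(x) ā`. -/
def SDual (Λ : Type u) [Ring Λ] (M : Type u) [AddCommGroup M] [Module Λ M] : Type u := M →ₗ[Λ] Λ

section

variable {M N P : Type u} [AddCommGroup M] [Module Λ M] [AddCommGroup N] [Module Λ N]
  [AddCommGroup P] [Module Λ P]

instance : AddCommGroup (SDual Λ M) := inferInstanceAs (AddCommGroup (M →ₗ[Λ] Λ))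

instance : FunLike (SDual Λ M) M Λ := inferInstanceAs (FunLike (M →ₗ[Λ] Λ) M Λ)

instance : LinearMapClass (SDual Λ M) Λ M Λ :=
  inferInstanceAs (LinearMapClass (M →ₗ[Λ] Λ) Λ M Λ)

namespace SDual

@[ext] theorem ext {f g : SDual Λ M} (h : ∀ x, f x = g x) : f = g := LinearMap.ext h

@[simp] theorem add_apply (f g : SDual Λ M) (x : M) : (f + g) x = f x + g x := rfl
@[simp] theorem zero_apply (x : M) : (0 : SDual Λ M) x = 0 := rfl
@[simp] theorem neg_apply (f : SDual Λ M) (x : M) : (-f) x = - f x := rfl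
@[simp] theorem sub_apply (f g : SDual Λ M) (x : M) : (f - g) x = f x - g x := rfl

instance : Module Λ (SDual Λ M) where
  smul a f :=
    { toFun := fun x => f x * star a
      map_add' := fun x y => by rw [map_add, add_mul]
      map_smul' := fun r x => by simp [mul_assoc] }
  one_smul f := ext fun x => show f x * star 1 = f x by simp
  mul_smul a b f := ext fun x => show f x * star (a * b) = f x * star b * star a by
    simp [mul_assoc]
  smul_zero a := ext fun x => zero_mul _
  smul_add a f g := ext fun x => add_mul _ _ _
  add_smul a b f := ext fun x => show f x * star (a + b) = f x * star a + f x * star b by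
    simp [mul_add]
  zero_smul f := ext fun x => show f x * star 0 = 0 by simp

@[simp] theorem smul_apply (a : Λ) (f : SDual Λ M) (x : M) : (a • f) x = f x * star a := rfl

@[simp] theorem zsmul_apply (a : ℤ) (f : SDual Λ M) (x : M) : (a • f) x = a • f x :=
  map_zsmul (AddMonoidHom.mk' (fun g : SDual Λ M => g x) fun _ _ => rfl) a f

@[simp] theorem sum_apply {ι : Type*} (s : Finset ι) (f : ι → SDual Λ M) (x : M) :
    (∑ i ∈ s, f i) x = ∑ i ∈ s, f i x :=
  map_sum (AddMonoidHom.mk' (fun g : SDual Λ M => g x) fun _ _ => rfl) f s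

/-- The dual `f* : N* → M*` of `f : M → N`. -/
def map (f : M →ₗ[Λ] N) : SDual Λ N →ₗ[Λ] SDual Λ M where
  toFun g := LinearMap.comp (g : N →ₗ[Λ] Λ) f
  map_add' _ _ := rfl
  map_smul' _ _ := rfl

@[simp] theorem map_apply (f : M →ₗ[Λ] N) (g : SDual Λ N) (x : M) : map f g x = g (f x) := rfl

/-- The isomorphism `(M ⊕ N)* ≅ M* ⊕ N*`. -/
def prodEquiv (M N : Type u) [AddCommGroup M] [Module Λ M] [AddCommGroup N] [Module Λ N] :
    SDual Λ (M × N) ≃ₗ[Λ] SDual Λ M × SDual Λ N where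
  toFun f := (map (LinearMap.inl Λ M N) f, map (LinearMap.inr Λ M N) f)
  invFun p := map (LinearMap.fst Λ M N) p.1 + map (LinearMap.snd Λ M N) p.2
  map_add' _ _ := rfl
  map_smul' _ _ := rfl
  left_inv f := ext fun x => by
    obtain ⟨x, y⟩ := x
    change f (x, 0) + f (0, y) = f (x, y)
    rw [← map_add]; simp
  right_inv p := by
    refine Prod.ext (ext fun x => ?_) (ext fun x => ?_)
    · change p.1 x + p.2 0 = p.1 x
      simp
    · change p.1 0 + p.2 x = p.2 x
      simp

/-- Coordinates on the dual of a free module: `f ↦ (conj f(b_i))_i`. -/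
def coordEquiv {ι : Type} [Fintype ι] (b : Basis ι Λ M) : SDual Λ M ≃ₗ[Λ] (ι → Λ) where
  toFun f i := star (f (b i))
  invFun c := b.constr ℤ fun i => star (c i)
  map_add' _ _ := by ext; simp
  map_smul' _ _ := by ext; simp
  left_inv f := by
    change b.constr ℤ _ = (f : M →ₗ[Λ] Λ)
    exact b.ext fun i => (b.constr_basis ℤ _ i).trans (star_star _)
  right_inv c := by
    ext i
    change star (b.constr ℤ (fun i => star (c i)) (b i)) = c i
    rw [b.constr_basis, star_star]

/-- The dual basis. -/
def dualBasis {ι : Type} [Fintype ι] (b : Basis ι Λ M) : Basis ι Λ (SDual Λ M) :=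
  Basis.ofEquivFun (coordEquiv b)

theorem dualBasis_apply {ι : Type} [Fintype ι] [DecidableEq ι] (b : Basis ι Λ M) (i j : ι) :
    dualBasis b i (b j) = if i = j then 1 else 0 := by
  have h : coordEquiv b (dualBasis b i) = Pi.single i 1 := by
    simp [dualBasis, Basis.coe_ofEquivFun]
  have h' := congrFun h j
  change star _ = _ at h'
  rw [← star_star (dualBasis b i (b j)), h', Pi.single_apply]
  by_cases hij : i = j
  · simp [hij]
  · simp [hij, Ne.symm hij]

theorem dualBasis_eq {ι : Type} [Fintype ι] [DecidableEq ι] (b : Basis ι Λ M) (i : ι)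
    (f : SDual Λ M) (h : ∀ j, f (b j) = if i = j then 1 else 0) : dualBasis b i = f := by
  refine b.ext (f₁ := (dualBasis b i : M →ₗ[Λ] Λ)) (f₂ := (f : M →ₗ[Λ] Λ)) fun j => ?_
  exact (dualBasis_apply b i j).trans (h j).symm

/-- The evaluation `M → M**`. -/
def eval (M : Type u) [AddCommGroup M] [Module Λ M] : M →ₗ[Λ] SDual Λ (SDual Λ M) where
  toFun x :=
    { toFun := fun f => star (f x)
      map_add' := fun f g => by simp
      map_smul' := fun a f => by simp }
  map_add' x y := ext fun f => show star (f (x + y)) = star (f x) + star (f y) by simp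
  map_smul' a x := ext fun f => show star (f (a • x)) = star (f x) * star a by simp

@[simp] theorem eval_apply (x : M) (f : SDual Λ M) : eval M x f = star (f x) := rfl

end SDual

end

/-- The dual of a based module, with the dual `s`-basis. -/
abbrev BasedModule.dual (X : BasedModule Λ) : BasedModule Λ where
  carrier := SDual Λ X
  m := X.m
  n := X.n
  basis := (SDual.dualBasis X.basis).map ((SDual.prodEquiv X (Fin X.m → Λ)).trans
    ((LinearEquiv.refl Λ _).prodCongr (SDual.coordEquiv (Pi.basisFun Λ (Fin X.m)))))

namespace SDual

variable {M N P : Type u} [AddCommGroup M] [Module Λ M] [AddCommGroup N] [Module Λ N]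
  {Z : AddSubgroup (RedK1 Λ)} {ι κ : Type} [Fintype ι] [Fintype κ]

/-- The isomorphism `(f⁻¹)* : M* ≅ N*` for `f : M ≅ N`. -/
def congr (f : M ≃ₗ[Λ] N) : SDual Λ M ≃ₗ[Λ] SDual Λ N where
  toFun := map f.symm.toLinearMap
  invFun := map f.toLinearMap
  map_add' := map_add _
  map_smul' := map_smul _
  left_inv g := ext fun x => by simp
  right_inv g := ext fun x => by simp

theorem congr_simple {b : Basis ι Λ M} {c : Basis κ Λ N} {f : M ≃ₗ[Λ] N} (σ : ι ≃ κ)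
    (h : ∀ i, f (b i) = c (σ i)) : IsSimpleFor Z (dualBasis b) (dualBasis c) (congr f) := by
  classical
  refine .of_perm σ fun i => (dualBasis_eq _ _ _ fun j => ?_).symm
  obtain ⟨j, rfl⟩ := σ.surjective j
  rw [← h]
  change dualBasis b i (f.symm (f (b j))) = _
  simp [dualBasis_apply]

theorem prodEquiv_simple (b : Basis ι Λ M) (c : Basis κ Λ N) :
    IsSimpleFor Z (dualBasis (b.prod c)) ((dualBasis b).prod (dualBasis c)) (prodEquiv M N) := by
  classical
  have h : IsSimpleFor Z ((dualBasis b).prod (dualBasis c)) (dualBasis (b.prod c))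
      (prodEquiv M N).symm := by
    refine IsSimpleFor.of_perm (Equiv.refl _) fun i => (dualBasis_eq _ _ _ fun j => ?_).symm
    change (((dualBasis b).prod (dualBasis c)) i).1 (b.prod c j).1 +
      (((dualBasis b).prod (dualBasis c)) i).2 (b.prod c j).2 = _
    rcases i with i | i <;> rcases j with j | j <;> simp [dualBasis_apply]
  exact h.symm.congr fun _ => rfl

theorem coordEquiv_simple (b : Basis ι Λ M) :
    IsSimpleFor Z (dualBasis b) (Pi.basisFun Λ ι) (coordEquiv b) := by
  classical
  refine IsSimpleFor.of_perm (Equiv.refl ι) fun i => ?_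
  rw [dualBasis, Basis.coe_ofEquivFun, LinearEquiv.apply_symm_apply, Pi.basisFun_apply]
  rfl

theorem eval_basis (b : Basis ι Λ M) (i : ι) :
    eval M (b i) = dualBasis (dualBasis b) i := by
  classical
  refine (dualBasis_eq _ _ _ fun j => ?_).symm
  rw [eval_apply, dualBasis_apply]
  by_cases h : i = j
  · simp [h]
  · simp [h, Ne.symm h]

end SDual

namespace BasedModule

variable {Z : AddSubgroup (RedK1 Λ)}

theorem dual_simple (X : BasedModule Λ) :
    IsSimpleFor Z (SDual.dualBasis X.basis) X.dual.basis
      ((SDual.prodEquiv X (Fin X.m → Λ)).trans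
    ((LinearEquiv.refl Λ _).prodCongr (SDual.coordEquiv (Pi.basisFun Λ (Fin X.m))))) :=
  .of_perm (Equiv.refl _) fun _ => by simp

theorem IsSimple.dualProd (X Y : BasedModule Λ) :
    IsSimple Z (X.prod Y).dual (X.dual.prod Y.dual) (SDual.prodEquiv X Y) := by
  have f0 := SDual.coordEquiv_simple (Z := Z) (Pi.basisFun Λ (Fin (X.m + Y.m)))
  have f1 : IsSimpleFor Z (SDual.dualBasis (Pi.basisFun Λ (Fin (X.m + Y.m)))) _ _ :=
    SDual.congr_simple (f := (finAdd Λ X.m Y.m).symm) (Z := Z) finSumFinEquiv.symm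
      (c := (Pi.basisFun Λ (Fin X.m)).prod (Pi.basisFun Λ (Fin Y.m))) fun i => by
        rw [LinearEquiv.symm_apply_eq, finAdd, Basis.equiv_apply, Equiv.apply_symm_apply]
  have f2 := f1.trans (SDual.prodEquiv_simple _ _)
  have f3 := f2.trans ((SDual.coordEquiv_simple _).prod (SDual.coordEquiv_simple _))
  have f4 := (f0.symm.trans f3).trans (finAdd_simple _ _)
  refine .of_direct _ f4 ?_
  let t := (LinearEquiv.prodProdProdComm Λ X (Fin X.m → Λ) Y (Fin Y.m → Λ)).trans
      ((LinearEquiv.refl Λ (X × Y)).prodCongr (finAdd Λ X.m Y.m))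
  have g1 : IsSimpleFor Z (SDual.dualBasis (X.prod Y).basis) _ _ :=
    SDual.congr_simple (f := t.symm) (Z := Z) finSumFinEquiv.symm (c := X.basis.prod Y.basis)
      fun i => by
        rw [LinearEquiv.symm_apply_eq]
        simp only [Basis.map_apply, Basis.reindex_apply]
        rfl
  have g2 := (g1.trans (SDual.prodEquiv_simple _ _)).trans ((dual_simple X).prod (dual_simple Y))
  have g3 := ((dual_simple (X.prod Y)).symm.trans g2).trans (prod_simple X.dual Y.dual)
  refine g3.congr fun p => ?_
  obtain ⟨f, u⟩ := p
  let k := (SDual.coordEquiv (Pi.basisFun Λ (Fin (X.m + Y.m)))).symm u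
  refine Prod.ext (Prod.ext (SDual.ext fun x => ?_) (SDual.ext fun y => ?_)) ?_
  · change f (x, 0) + k (finAdd Λ _ _ (0, 0)) = f (x, 0)
    have h : k (finAdd Λ X.m Y.m (0, 0)) = 0 :=
      (congrArg k (map_zero (finAdd Λ X.m Y.m))).trans (map_zero k)
    rw [h, add_zero]
  · change f (0, y) + k (finAdd Λ _ _ (0, 0)) = f (0, y)
    have h : k (finAdd Λ X.m Y.m (0, 0)) = 0 :=
      (congrArg k (map_zero (finAdd Λ X.m Y.m))).trans (map_zero k)
    rw [h, add_zero]
  · have h : f (0, 0) = 0 := map_zero f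
    refine congrArg (finAdd Λ X.m Y.m) (Prod.ext (funext fun i => ?_) (funext fun i => ?_))
    · change star (f (0, 0) + k _) = star (k _)
      rw [h, zero_add]
      rfl
    · change star (f (0, 0) + k _) = star (k _)
      rw [h, zero_add]
      rfl

/-- The evaluation isomorphism `M ≅ M**` of a free module. -/
def evalFree {M : Type u} [AddCommGroup M] [Module Λ M] {n : ℕ} (b : Basis (Fin n) Λ M) :
    M ≃ₗ[Λ] SDual Λ (SDual Λ M) :=
  LinearEquiv.ofBijective (SDual.eval M) <| by
    have h : (b.equiv (SDual.dualBasis (SDual.dualBasis b)) (Equiv.refl _)).toLinearMap =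
        SDual.eval _ := b.ext fun i => by
      rw [SDual.eval_basis]
      simp
    rw [← h]
    exact LinearEquiv.bijective _

/-- The evaluation isomorphism `X ≅ X**` of a based module. -/
def evalEquiv (X : BasedModule Λ) : X ≃ₗ[Λ] SDual Λ (SDual Λ X) :=
  LinearEquiv.ofBijective (SDual.eval X) <| by
    constructor
    · rw [injective_iff_map_eq_zero]
      intro x hx
      have h : evalFree X.basis (x, 0) = 0 :=
        SDual.ext fun f => congrArg (fun Θ => Θ (SDual.map (LinearMap.inl Λ X _) f)) hx
      simpa using h
    · intro Θ
      obtain ⟨p, hp⟩ :=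
        (evalFree X.basis).surjective (SDual.map (SDual.map (LinearMap.inl Λ X _)) Θ)
      refine ⟨p.1, SDual.ext fun g => ?_⟩
      exact congrArg (fun Θ => Θ (SDual.map (LinearMap.fst Λ X _) g)) hp

@[simp] theorem evalEquiv_apply (X : BasedModule Λ) (x : X) (f : SDual Λ X) :
    evalEquiv X x f = star (f x) := rfl

theorem IsSimple.eval (X : BasedModule Λ) : IsSimple Z X X.dual.dual (evalEquiv X) := by
  refine .of_direct (LinearEquiv.refl _ _) (.of_perm (Equiv.refl _) fun _ => rfl) ?_
  have g1 : IsSimpleFor Z X.basis (SDual.dualBasis (SDual.dualBasis X.basis)) (evalFree X.basis) :=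
    .of_perm (Equiv.refl _) fun i => SDual.eval_basis X.basis i
  have g2 : IsSimpleFor Z (SDual.dualBasis (SDual.dualBasis X.basis))
      (SDual.dualBasis X.dual.basis) _ :=
    SDual.congr_simple (Z := Z) (f := ((SDual.prodEquiv X (Fin X.m → Λ)).trans
      ((LinearEquiv.refl Λ _).prodCongr (SDual.coordEquiv (Pi.basisFun Λ (Fin X.m))))))
      (Equiv.refl _) fun i => by simp
  have g3 := (g1.trans g2).trans (dual_simple X.dual)
  refine g3.congr fun p => ?_
  obtain ⟨x, u⟩ := p
  refine Prod.ext (SDual.ext fun f => ?_) (funext fun i => ?_)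
  · change star (f x + (SDual.coordEquiv (Pi.basisFun Λ (Fin X.m))).symm 0 u) = star (f x)
    rw [map_zero, SDual.zero_apply, add_zero]
  · change star (star ((0 : SDual Λ X) x +
      (SDual.coordEquiv (Pi.basisFun Λ (Fin X.m))).symm (Pi.basisFun Λ _ i) u)) = u i
    rw [star_star, SDual.zero_apply, zero_add]
    change (Pi.basisFun Λ (Fin X.m)).constr ℤ _ u = u i
    simp [Basis.constr_apply_fintype, Pi.single_apply, apply_ite star]

end BasedModule

end Dual
section Forms


variable {Λ : Type u} [Ring Λ] [StarRing Λ]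

section

variable {M N P M' N' : Type u} [AddCommGroup M] [Module Λ M] [AddCommGroup N] [Module Λ N]
  [AddCommGroup P] [Module Λ P] [AddCommGroup M'] [Module Λ M'] [AddCommGroup N'] [Module Λ N']

/-- The `ε`-duality involution `(T_ε φ)(x)(y) = ε conj(φ(y)(x))` on `Hom_Λ(M, M*)`. -/
def dualityInvolution (ε : ℤˣ) (M : Type u) [AddCommGroup M] [Module Λ M] :
    (M →ₗ[Λ] SDual Λ M) →+ (M →ₗ[Λ] SDual Λ M) where
  toFun φ :=
    { toFun := fun x =>
        { toFun := fun y => (ε : ℤ) • star (φ y x)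
          map_add' := fun y z => by simp
          map_smul' := fun a y => by simp [-zsmul_eq_mul] }
      map_add' := fun x y => SDual.ext fun z =>
        show (ε : ℤ) • star (φ z (x + y)) = (ε : ℤ) • star (φ z x) + (ε : ℤ) • star (φ z y) by simp
      map_smul' := fun a x => SDual.ext fun z =>
        show (ε : ℤ) • star (φ z (a • x)) = ((ε : ℤ) • star (φ z x)) * star a by
          simp [-zsmul_eq_mul] }
  map_zero' := LinearMap.ext fun x => SDual.ext fun y =>
    show (ε : ℤ) • star (0 : Λ) = 0 by simp
  map_add' φ ψ := LinearMap.ext fun x => SDual.ext fun y =>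
    show (ε : ℤ) • star (φ y x + ψ y x) = (ε : ℤ) • star (φ y x) + (ε : ℤ) • star (ψ y x) by
      simp

@[simp] theorem dualityInvolution_apply (ε : ℤˣ) (φ : M →ₗ[Λ] SDual Λ M) (x y : M) :
    dualityInvolution ε M φ x y = (ε : ℤ) • star (φ y x) := rfl

theorem dualityInvolution_self (ε : ℤˣ) (φ : M →ₗ[Λ] SDual Λ M) :
    dualityInvolution ε M (dualityInvolution ε M φ) = φ := by
  refine LinearMap.ext fun x => SDual.ext fun y => ?_
  simp [-zsmul_eq_mul, smul_smul]

/-- `Q_ε(M) = coker(1 - T_ε)`. -/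
def QEps (ε : ℤˣ) (M : Type u) [AddCommGroup M] [Module Λ M] : Type u :=
  (M →ₗ[Λ] SDual Λ M) ⧸ (AddMonoidHom.id (M →ₗ[Λ] SDual Λ M) - dualityInvolution ε M).range

instance (ε : ℤˣ) : AddCommGroup (QEps (Λ := Λ) ε M) :=
  inferInstanceAs (AddCommGroup (_ ⧸
    (AddMonoidHom.id (M →ₗ[Λ] SDual Λ M) - dualityInvolution ε M).range))

namespace QEps

/-- The class in `Q_ε(M)` of a sesquilinear form. -/
def mk (ε : ℤˣ) : (M →ₗ[Λ] SDual Λ M) →+ QEps (Λ := Λ) ε M := QuotientAddGroup.mk' _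

theorem mk_surjective (ε : ℤˣ) : Function.Surjective (mk (Λ := Λ) (M := M) ε) :=
  QuotientAddGroup.mk'_surjective _

theorem mk_eq {ε : ℤˣ} {φ ψ χ : M →ₗ[Λ] SDual Λ M}
    (h : ∀ x y, φ x y - ψ x y = χ x y - (ε : ℤ) • star (χ y x)) : mk ε φ = mk ε ψ := by
  rw [← sub_eq_zero, ← map_sub]
  refine (QuotientAddGroup.eq_zero_iff _).2 ⟨χ, ?_⟩
  exact LinearMap.ext fun x => SDual.ext fun y => (h x y).symm

/-- The symmetrisation `1 + T_ε : Q_ε(M) → Q^ε(M) ⊆ Hom_Λ(M, M*)`. -/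
def sym (ε : ℤˣ) : QEps (Λ := Λ) ε M →+ (M →ₗ[Λ] SDual Λ M) :=
  QuotientAddGroup.lift _ (AddMonoidHom.id _ + dualityInvolution ε M) <| by
    rintro _ ⟨φ, rfl⟩
    simp [AddMonoidHom.mem_ker, dualityInvolution_self]

@[simp] theorem sym_mk {ε : ℤˣ} (φ : M →ₗ[Λ] SDual Λ M) (x y : M) :
    sym ε (mk ε φ) x y = φ x y + (ε : ℤ) • star (φ y x) := rfl

/-- The form `f* φ f` on `M`, for `f : M → N`. -/
def pullHom (f : M →ₗ[Λ] N) : (N →ₗ[Λ] SDual Λ N) →+ (M →ₗ[Λ] SDual Λ M) where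
  toFun φ := (SDual.map f).comp (φ.comp f)
  map_zero' := rfl
  map_add' _ _ := rfl

@[simp] theorem pullHom_apply (f : M →ₗ[Λ] N) (φ : N →ₗ[Λ] SDual Λ N) (x y : M) :
    pullHom f φ x y = φ (f x) (f y) := rfl

/-- The map `ψ ↦ f* ψ f` from `Q_ε(N)` to `Q_ε(M)`, for `f : M → N`. -/
def pull {ε : ℤˣ} (f : M →ₗ[Λ] N) : QEps (Λ := Λ) ε N →+ QEps (Λ := Λ) ε M :=
  QuotientAddGroup.map _ _ (pullHom f) <| by
    rintro _ ⟨φ, rfl⟩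
    exact ⟨pullHom f φ, rfl⟩

@[simp] theorem pull_mk {ε : ℤˣ} (f : M →ₗ[Λ] N) (φ : N →ₗ[Λ] SDual Λ N) :
    pull f (mk ε φ) = mk ε (pullHom f φ) := rfl

theorem pull_pull {ε : ℤˣ} (f : M →ₗ[Λ] N) (g : N →ₗ[Λ] P) (ψ : QEps (Λ := Λ) ε P) :
    pull f (pull g ψ) = pull (g.comp f) ψ := by
  obtain ⟨φ, rfl⟩ := mk_surjective ε ψ
  rfl

theorem pull_id {ε : ℤˣ} (ψ : QEps (Λ := Λ) ε M) : pull LinearMap.id ψ = ψ := by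
  obtain ⟨φ, rfl⟩ := mk_surjective ε ψ
  rfl

theorem pull_zero {ε : ℤˣ} (ψ : QEps (Λ := Λ) ε N) : pull (0 : M →ₗ[Λ] N) ψ = 0 := by
  obtain ⟨φ, rfl⟩ := mk_surjective ε ψ
  have h : pullHom (0 : M →ₗ[Λ] N) φ = 0 := by
    refine LinearMap.ext fun x => SDual.ext fun y => ?_
    simp
  rw [pull_mk, h, map_zero]

theorem sym_pull {ε : ℤˣ} (f : M →ₗ[Λ] N) (ψ : QEps (Λ := Λ) ε N) (x y : M) :
    sym ε (pull f ψ) x y = sym ε ψ (f x) (f y) := by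
  obtain ⟨φ, rfl⟩ := mk_surjective ε ψ
  rfl

/-- The orthogonal sum. -/
def prod {ε : ℤˣ} (ψ : QEps (Λ := Λ) ε M) (ψ' : QEps (Λ := Λ) ε N) : QEps (Λ := Λ) ε (M × N) :=
  pull (LinearMap.fst Λ M N) ψ + pull (LinearMap.snd Λ M N) ψ'

theorem pull_prod {ε : ℤˣ} (f : P →ₗ[Λ] M × N) (ψ : QEps (Λ := Λ) ε M)
    (ψ' : QEps (Λ := Λ) ε N) : pull f (prod ψ ψ') =
      pull ((LinearMap.fst Λ M N).comp f) ψ + pull ((LinearMap.snd Λ M N).comp f) ψ' := by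
  rw [prod, map_add, pull_pull, pull_pull]

theorem pull_prodCongr {ε : ℤˣ} (f : M →ₗ[Λ] M') (g : N →ₗ[Λ] N') (ψ : QEps (Λ := Λ) ε M')
    (ψ' : QEps (Λ := Λ) ε N') :
    pull (f.prodMap g) (prod ψ ψ') = prod (pull f ψ) (pull g ψ') := by
  rw [pull_prod, prod, pull_pull, pull_pull]; rfl

theorem pull_prodComm {ε : ℤˣ} (ψ : QEps (Λ := Λ) ε M) (ψ' : QEps (Λ := Λ) ε N) :
    pull (LinearEquiv.prodComm Λ M N).toLinearMap (prod ψ' ψ) = prod ψ ψ' := by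
  rw [pull_prod, prod, add_comm]; rfl

theorem pull_prodAssoc {ε : ℤˣ} (ψ : QEps (Λ := Λ) ε M) (ψ' : QEps (Λ := Λ) ε N)
    (ψ'' : QEps (Λ := Λ) ε P) :
    pull (LinearEquiv.prodAssoc Λ M N P).toLinearMap (prod ψ (prod ψ' ψ'')) =
      prod (prod ψ ψ') ψ'' := by
  rw [pull_prod, pull_prod, prod, prod, map_add, pull_pull, pull_pull, ← add_assoc]; rfl

theorem prod_zero_zero {ε : ℤˣ} :
    prod (0 : QEps (Λ := Λ) ε M) (0 : QEps (Λ := Λ) ε N) = 0 := by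
  rw [prod, map_zero, map_zero, add_zero]

theorem pull_sndEquiv {ε : ℤˣ} [Subsingleton M] (ψ : QEps (Λ := Λ) ε N) :
    pull (BasedModule.sndEquiv M N).toLinearMap ψ = prod 0 ψ := by
  rw [prod, map_zero, zero_add]; rfl

theorem sym_prod {ε : ℤˣ} (ψ : QEps (Λ := Λ) ε M) (ψ' : QEps (Λ := Λ) ε N) (p r : M × N) :
    sym ε (prod ψ ψ') p r = sym ε ψ p.1 r.1 + sym ε ψ' p.2 r.2 := by
  rw [prod, map_add, LinearMap.add_apply, SDual.add_apply, sym_pull, sym_pull]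
  rfl

end QEps

end

/-- An `ε`-quadratic form `(X, ψ)` on a based module `X`. -/
structure QForm (Λ : Type u) [Ring Λ] [StarRing Λ] (ε : ℤˣ) where
  X : BasedModule Λ
  ψ : QEps (Λ := Λ) ε X

namespace QForm

variable {ε : ℤˣ}

/-- The symmetrisation `φ = (1 + T_ε)ψ`. -/
def sym (v : QForm Λ ε) : v.X →ₗ[Λ] SDual Λ v.X := QEps.sym ε v.ψ

/-- `(X, ψ)` is simple if its symmetrisation is a simple isomorphism `X ≅ X*`. -/
def IsSimple (Z : AddSubgroup (RedK1 Λ)) (v : QForm Λ ε) : Prop :=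
  ∃ e : v.X ≃ₗ[Λ] SDual Λ v.X, (∀ x, e x = v.sym x) ∧ BasedModule.IsSimple Z v.X v.X.dual e

/-- `v` and `w` are related by a simple isometry. -/
def Isometric (Z : AddSubgroup (RedK1 Λ)) (v w : QForm Λ ε) : Prop :=
  ∃ e : v.X ≃ₗ[Λ] w.X, BasedModule.IsSimple Z v.X w.X e ∧ QEps.pull e.toLinearMap w.ψ = v.ψ

/-- The direct sum of quadratic forms. -/
abbrev prod (v w : QForm Λ ε) : QForm Λ ε := ⟨v.X.prod w.X, QEps.prod v.ψ w.ψ⟩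

/-- The zero form `(P, 0)`. -/
abbrev zeroForm (ε : ℤˣ) (P : BasedModule Λ) : QForm Λ ε := ⟨P, 0⟩

/-- The sesquilinear form `((x, f), (y, g)) ↦ f(y)` on `L ⊕ L*`. -/
def hypHom (L : Type u) [AddCommGroup L] [Module Λ L] :
    (L × SDual Λ L) →ₗ[Λ] SDual Λ (L × SDual Λ L) :=
  (SDual.map (LinearMap.fst Λ L (SDual Λ L))).comp (LinearMap.snd Λ L (SDual Λ L))

/-- The hyperbolic form `H_ε(L)` on `L ⊕ L*`. -/
abbrev hyp (ε : ℤˣ) (L : BasedModule Λ) : QForm Λ ε := ⟨L.prod L.dual, QEps.mk ε (hypHom L)⟩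

variable {Z : AddSubgroup (RedK1 Λ)}

theorem Isometric.refl (v : QForm Λ ε) : Isometric Z v v :=
  ⟨LinearEquiv.refl Λ _, .refl _, QEps.pull_id _⟩

theorem Isometric.symm {v w : QForm Λ ε} (h : Isometric Z v w) : Isometric Z w v := by
  obtain ⟨e, he, h⟩ := h
  refine ⟨e.symm, he.symm, ?_⟩
  rw [← h, QEps.pull_pull]
  convert QEps.pull_id w.ψ using 2
  ext; simp

theorem Isometric.trans {u v w : QForm Λ ε} (h : Isometric Z u v) (h' : Isometric Z v w) :
    Isometric Z u w := by
  obtain ⟨e, he, h⟩ := h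
  obtain ⟨e', he', h'⟩ := h'
  exact ⟨e.trans e', he.trans he', by rw [← h, ← h', QEps.pull_pull]; rfl⟩

theorem Isometric.prod {v w v' w' : QForm Λ ε} (h : Isometric Z v w) (h' : Isometric Z v' w') :
    Isometric Z (v.prod v') (w.prod w') := by
  obtain ⟨e, he, h⟩ := h
  obtain ⟨e', he', h'⟩ := h'
  exact ⟨e.prodCongr e', he.prod he', (QEps.pull_prodCongr e.toLinearMap e'.toLinearMap _ _).trans
    (congrArg₂ QEps.prod h h')⟩

theorem Isometric.prodComm (v w : QForm Λ ε) : Isometric Z (v.prod w) (w.prod v) :=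
  ⟨LinearEquiv.prodComm Λ _ _, .prodComm _ _, QEps.pull_prodComm _ _⟩

theorem Isometric.prodAssoc (u v w : QForm Λ ε) :
    Isometric Z ((u.prod v).prod w) (u.prod (v.prod w)) :=
  ⟨LinearEquiv.prodAssoc Λ _ _ _, .prodAssoc _ _ _, QEps.pull_prodAssoc _ _ _⟩

theorem Isometric.zeroProd (v : QForm Λ ε) :
    Isometric Z ((zeroForm ε (BasedModule.zero Λ)).prod v) v :=
  ⟨_, .zeroProd _, QEps.pull_sndEquiv _⟩

theorem Isometric.zeroForm_prod (P Q : BasedModule Λ) :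
    Isometric Z ((zeroForm ε P).prod (zeroForm ε Q)) (zeroForm ε (P.prod Q)) :=
  ⟨LinearEquiv.refl Λ _, .refl _, (map_zero _).trans QEps.prod_zero_zero.symm⟩

theorem Isometric.prodProdProdComm (u v w x : QForm Λ ε) :
    Isometric Z ((u.prod v).prod (w.prod x)) ((u.prod w).prod (v.prod x)) :=
  (Isometric.prodAssoc _ _ _).trans <| .trans (.prod (.refl _) <|
    (Isometric.prodAssoc _ _ _).symm.trans <| (Isometric.prodComm v w).prod (.refl x) |>.trans <|
      .prodAssoc _ _ _) (Isometric.prodAssoc _ _ _).symm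

/-- Two forms define the same `0`-stabilised form if they become isometric, by a simple isometry,
after addition of zero forms. -/
def ZeroStabEquiv (Z : AddSubgroup (RedK1 Λ)) (v w : QForm Λ ε) : Prop :=
  ∃ P Q : BasedModule Λ, Isometric Z (v.prod (zeroForm ε P)) (w.prod (zeroForm ε Q))

theorem ZeroStabEquiv.of_isometric {v w : QForm Λ ε} (h : Isometric Z v w) :
    ZeroStabEquiv Z v w :=
  ⟨BasedModule.zero Λ, BasedModule.zero Λ, h.prod (.refl _)⟩

theorem ZeroStabEquiv.symm {v w : QForm Λ ε} (h : ZeroStabEquiv Z v w) : ZeroStabEquiv Z w v :=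
  let ⟨P, Q, h⟩ := h
  ⟨Q, P, h.symm⟩

theorem ZeroStabEquiv.trans {u v w : QForm Λ ε} (h : ZeroStabEquiv Z u v)
    (h' : ZeroStabEquiv Z v w) : ZeroStabEquiv Z u w := by
  obtain ⟨P, Q, h⟩ := h
  obtain ⟨P', Q', h'⟩ := h'
  refine ⟨P.prod P', Q'.prod Q, ?_⟩
  have a (x : QForm Λ ε) (A B : BasedModule Λ) : Isometric Z
      (x.prod (zeroForm ε (A.prod B))) ((x.prod (zeroForm ε A)).prod (zeroForm ε B)) :=
    (Isometric.prod (.refl x) (Isometric.zeroForm_prod A B).symm).trans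
      (Isometric.prodAssoc _ _ _).symm
  have sw : Isometric Z ((v.prod (zeroForm ε Q)).prod (zeroForm ε P'))
      ((v.prod (zeroForm ε P')).prod (zeroForm ε Q)) :=
    (Isometric.prodAssoc _ _ _).trans
      ((Isometric.prod (.refl v) (.prodComm _ _)).trans (Isometric.prodAssoc _ _ _).symm)
  exact ((a u P P').trans (h.prod (.refl _))).trans
    (sw.trans ((h'.prod (.refl _)).trans (a w Q' Q).symm))

theorem ZeroStabEquiv.prod {v w v' w' : QForm Λ ε} (h : ZeroStabEquiv Z v w)
    (h' : ZeroStabEquiv Z v' w') : ZeroStabEquiv Z (v.prod v') (w.prod w') := by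
  obtain ⟨P, Q, h⟩ := h
  obtain ⟨P', Q', h'⟩ := h'
  have a (x y : QForm Λ ε) (A B : BasedModule Λ) : Isometric Z
      ((x.prod y).prod (zeroForm ε (A.prod B)))
      ((x.prod (zeroForm ε A)).prod (y.prod (zeroForm ε B))) :=
    (Isometric.prod (.refl _) (Isometric.zeroForm_prod A B).symm).trans (.prodProdProdComm _ _ _ _)
  exact ⟨P.prod P', Q.prod Q', (a _ _ _ _).trans ((h.prod h').trans (a _ _ _ _).symm)⟩

/-- `ZeroStabEquiv` as a setoid. -/
def zeroStabSetoid (Z : AddSubgroup (RedK1 Λ)) (ε : ℤˣ) : Setoid (QForm Λ ε) where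
  r := ZeroStabEquiv Z
  iseqv := ⟨fun v => .of_isometric (.refl v), .symm, .trans⟩

end QForm

/-- The monoid `F^zs(Λ)` of `0`-stabilised `ε`-quadratic forms. -/
def ZeroStabForms (Z : AddSubgroup (RedK1 Λ)) (ε : ℤˣ) : Type (u + 1) :=
  Quotient (QForm.zeroStabSetoid Z ε)

namespace ZeroStabForms

variable {ε : ℤˣ}

/-- The `0`-stabilised form `[v]`. -/
def mk (Z : AddSubgroup (RedK1 Λ)) (v : QForm Λ ε) : ZeroStabForms Z ε := Quotient.mk _ v

instance (Z : AddSubgroup (RedK1 Λ)) : Add (ZeroStabForms Z ε) :=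
  ⟨Quotient.map₂ QForm.prod fun _ _ h _ _ h' => QForm.ZeroStabEquiv.prod h h'⟩

instance (Z : AddSubgroup (RedK1 Λ)) : Zero (ZeroStabForms Z ε) :=
  ⟨mk Z (QForm.zeroForm ε (BasedModule.zero Λ))⟩

/-- Addition is induced by the direct sum of forms, and the unit is `[0, 0] = [P, 0]`. -/
instance (Z : AddSubgroup (RedK1 Λ)) : AddCommMonoid (ZeroStabForms Z ε) where
  add_assoc := by
    rintro ⟨u⟩ ⟨v⟩ ⟨w⟩
    exact Quotient.sound (.of_isometric (.prodAssoc u v w))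
  zero_add := by
    rintro ⟨v⟩
    exact Quotient.sound (.of_isometric (.zeroProd v))
  add_zero := by
    rintro ⟨v⟩
    exact Quotient.sound (.of_isometric ((QForm.Isometric.prodComm _ _).trans (.zeroProd v)))
  add_comm := by
    rintro ⟨v⟩ ⟨w⟩
    exact Quotient.sound (.of_isometric (.prodComm v w))
  nsmul := nsmulRec

end ZeroStabForms

end Forms
section QuasiFormations


variable {Λ : Type u} [Ring Λ] [StarRing Λ] {ε : ℤˣ}

/-- A sequence `0 → A → B → C → 0` of based modules is a based exact sequence if some
(equivalently any) splitting `A ⊕ C ≅ B` of it is simple. -/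
def BasedExact (Z : AddSubgroup (RedK1 Λ)) (A B C : BasedModule Λ) (i : A →ₗ[Λ] B)
    (p : B →ₗ[Λ] C) : Prop :=
  ∃ e : (A × C) ≃ₗ[Λ] B, BasedModule.IsSimple Z (A.prod C) B e ∧ (∀ a, e (a, 0) = i a) ∧
    ∀ a c, p (e (a, c)) = c

namespace QForm

/-- The map `j*φ : M → V*`, where `φ` is the symmetrisation of `v = (M, ψ)` and `j : V → M`. -/
def restr (v : QForm Λ ε) {V : Type u} [AddCommGroup V] [Module Λ V] (j : V →ₗ[Λ] v.X) :
    v.X →ₗ[Λ] SDual Λ V :=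
  (SDual.map j).comp v.sym

@[simp] theorem restr_apply (v : QForm Λ ε) {V : Type u} [AddCommGroup V] [Module Λ V]
    (j : V →ₗ[Λ] v.X) (x : v.X) (y : V) : v.restr j x y = v.sym x (j y) := rfl

/-- The annihilator `V^⊥ = Ker(j*φ : M → V*)` of `j : V → M`. -/
def perp (v : QForm Λ ε) {V : Type u} [AddCommGroup V] [Module Λ V] (j : V →ₗ[Λ] v.X) :
    Submodule Λ v.X :=
  LinearMap.ker (v.restr j)

/-- `i` is the inclusion of a direct summand. -/
def IsSummand {M N : Type u} [AddCommGroup M] [Module Λ M] [AddCommGroup N] [Module Λ N]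
    (i : M →ₗ[Λ] N) : Prop :=
  ∃ r : N →ₗ[Λ] M, ∀ x, r (i x) = x

/-- The based module `L`, embedded by `i`, is a Lagrangian of `v = (M, ψ)`: a direct summand with
`L = L^⊥` (as unbased modules) and `i*ψi = 0`. -/
def IsLagrangian (v : QForm Λ ε) (L : BasedModule Λ) (i : L →ₗ[Λ] v.X) : Prop :=
  IsSummand i ∧ LinearMap.range i = v.perp i ∧ QEps.pull i v.ψ = 0

/-- A Lagrangian `L` is simple if `0 → L → M → L* → 0` is a based exact sequence. -/
def IsSimpleLagrangian (Z : AddSubgroup (RedK1 Λ)) (v : QForm Λ ε) (L : BasedModule Λ)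
    (i : L →ₗ[Λ] v.X) : Prop :=
  v.IsLagrangian L i ∧ BasedExact Z L v.X L.dual i (v.restr i)

end QForm

/-- An `ε`-quadratic quasi-formation `(M, ψ; L, V)`: a simple form `(M, ψ)`, a simple Lagrangian
`L` and a based direct summand `V` of half rank. The submodules `L` and `V` are given by based
modules together with their inclusions `i` and `j` into `M`. -/
structure QuasiFormation (Z : AddSubgroup (RedK1 Λ)) (ε : ℤˣ) where
  form : QForm Λ ε
  simple : form.IsSimple Z
  L : BasedModule Λ
  i : L →ₗ[Λ] form.X
  lag : form.IsSimpleLagrangian Z L i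
  V : BasedModule Λ
  j : V →ₗ[Λ] form.X
  summand : QForm.IsSummand j
  half : form.X.rank = 2 * V.rank

theorem BasedExact.prod {Z : AddSubgroup (RedK1 Λ)} {A B C A' B' C' : BasedModule Λ}
    {i : A →ₗ[Λ] B} {p : B →ₗ[Λ] C} {i' : A' →ₗ[Λ] B'} {p' : B' →ₗ[Λ] C'}
    (h : BasedExact Z A B C i p) (h' : BasedExact Z A' B' C' i' p') :
    BasedExact Z (A.prod A') (B.prod B') (C.prod C') (i.prodMap i') (p.prodMap p') := by
  obtain ⟨e, he, h1, h2⟩ := h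
  obtain ⟨e', he', h1', h2'⟩ := h'
  refine ⟨(LinearEquiv.prodProdProdComm Λ A A' C C').trans (e.prodCongr e'), ?_, ?_, ?_⟩
  · have s : BasedModule.IsSimple Z ((A.prod A').prod (C.prod C')) ((A.prod C).prod (A'.prod C'))
        (LinearEquiv.prodProdProdComm Λ A A' C C') := by
      have a1 := BasedModule.IsSimple.prodAssoc (Z := Z) A A' (C.prod C')
      have a2 := BasedModule.IsSimple.prodAssoc (Z := Z) A' C C'
      have a3 := BasedModule.IsSimple.prodAssoc (Z := Z) C A' C'
      have a4 := BasedModule.IsSimple.prodAssoc (Z := Z) A C (A'.prod C')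
      have a5 := BasedModule.IsSimple.prodComm (Z := Z) A' C
      have a6 := (a2.symm.trans (a5.prod (.refl C'))).trans a3
      exact ((a1.trans ((BasedModule.IsSimple.refl A).prod a6)).trans a4.symm).congr fun _ => rfl
    exact s.trans (he.prod he')
  · exact fun a => Prod.ext (h1 a.1) (h1' a.2)
  · exact fun a c => Prod.ext (h2 a.1 c.1) (h2' a.2 c.2)

/-- Replacing the quotient in a based exact sequence. -/
theorem BasedExact.congr_right {Z : AddSubgroup (RedK1 Λ)} {A B C C' : BasedModule Λ}
    {i : A →ₗ[Λ] B} {p : B →ₗ[Λ] C} (h : BasedExact Z A B C i p) (g : C ≃ₗ[Λ] C')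
    (hg : BasedModule.IsSimple Z C C' g) {p' : B →ₗ[Λ] C'} (hp : ∀ x, p' x = g (p x)) :
    BasedExact Z A B C' i p' := by
  obtain ⟨e, he, h1, h2⟩ := h
  refine ⟨((LinearEquiv.refl Λ A).prodCongr g.symm).trans e,
    ((BasedModule.IsSimple.refl A).prod hg.symm).trans he, fun a => ?_, fun a c => ?_⟩
  · rw [← h1]
    change e (a, g.symm 0) = _
    rw [map_zero]
  · rw [hp]
    change g (p (e (a, g.symm c))) = c
    rw [h2, LinearEquiv.apply_symm_apply]

namespace QForm

variable {Z : AddSubgroup (RedK1 Λ)}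

theorem prod_sym (v w : QForm Λ ε) (p r : v.X × w.X) :
    (v.prod w).sym p r = v.sym p.1 r.1 + w.sym p.2 r.2 := QEps.sym_prod _ _ _ _

theorem prod_restr (v w : QForm Λ ε) {V W : Type u} [AddCommGroup V] [Module Λ V]
    [AddCommGroup W] [Module Λ W] (j : V →ₗ[Λ] v.X) (k : W →ₗ[Λ] w.X) (p : v.X × w.X) :
    (v.prod w).restr (j.prodMap k) p = (SDual.prodEquiv V W).symm (v.restr j p.1, w.restr k p.2) :=
  SDual.ext fun r => prod_sym v w p (j r.1, k r.2)

theorem IsSimple.prod {v w : QForm Λ ε} (h : v.IsSimple Z) (h' : w.IsSimple Z) :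
    (v.prod w).IsSimple Z := by
  obtain ⟨e, h1, h2⟩ := h
  obtain ⟨e', h1', h2'⟩ := h'
  refine ⟨(e.prodCongr e').trans (SDual.prodEquiv _ _).symm, fun p => SDual.ext fun r => ?_,
    (h2.prod h2').trans (BasedModule.IsSimple.dualProd _ _).symm⟩
  rw [prod_sym, ← h1, ← h1']
  rfl

theorem IsSummand.prod {M N M' N' : Type u} [AddCommGroup M] [Module Λ M] [AddCommGroup N]
    [Module Λ N] [AddCommGroup M'] [Module Λ M'] [AddCommGroup N'] [Module Λ N']
    {i : M →ₗ[Λ] N} {i' : M' →ₗ[Λ] N'} (h : IsSummand i) (h' : IsSummand i') :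
    IsSummand (i.prodMap i') := by
  obtain ⟨r, h⟩ := h
  obtain ⟨r', h'⟩ := h'
  exact ⟨r.prodMap r', fun x => Prod.ext (h x.1) (h' x.2)⟩

theorem mem_perp_prod {v w : QForm Λ ε} {V W : Type u} [AddCommGroup V] [Module Λ V]
    [AddCommGroup W] [Module Λ W] {j : V →ₗ[Λ] v.X} {k : W →ₗ[Λ] w.X} (p : v.X × w.X) :
    p ∈ (v.prod w).perp (j.prodMap k) ↔ p.1 ∈ v.perp j ∧ p.2 ∈ w.perp k := by
  rw [perp, perp, perp, LinearMap.mem_ker, LinearMap.mem_ker, LinearMap.mem_ker]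
  rw [show (v.prod w).restr (j.prodMap k) p = _ from prod_restr v w j k p,
    LinearEquiv.map_eq_zero_iff, Prod.mk_eq_zero]

theorem IsLagrangian.prod {v w : QForm Λ ε} {L K : BasedModule Λ} {i : L →ₗ[Λ] v.X}
    {k : K →ₗ[Λ] w.X} (h : v.IsLagrangian L i) (h' : w.IsLagrangian K k) :
    (v.prod w).IsLagrangian (L.prod K) (i.prodMap k) := by
  refine ⟨h.1.prod h'.1, ?_, ?_⟩
  · refine Submodule.ext fun p => (Iff.trans ?_ (mem_perp_prod p).symm)
    rw [← h.2.1, ← h'.2.1]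
    constructor
    · rintro ⟨r, rfl⟩
      exact ⟨⟨r.1, rfl⟩, ⟨r.2, rfl⟩⟩
    · rintro ⟨⟨a, ha⟩, ⟨b, hb⟩⟩
      exact ⟨(a, b), Prod.ext ha hb⟩
  · refine (QEps.pull_prodCongr i k v.ψ w.ψ).trans ?_
    rw [h.2.2, h'.2.2]
    exact QEps.prod_zero_zero

theorem IsSimpleLagrangian.prod {v w : QForm Λ ε} {L K : BasedModule Λ} {i : L →ₗ[Λ] v.X}
    {k : K →ₗ[Λ] w.X} (h : v.IsSimpleLagrangian Z L i) (h' : w.IsSimpleLagrangian Z K k) :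
    (v.prod w).IsSimpleLagrangian Z (L.prod K) (i.prodMap k) := by
  refine ⟨h.1.prod h'.1, ?_⟩
  have h1 := h.2.prod h'.2
  exact BasedExact.congr_right (C' := (L.prod K).dual) h1 (SDual.prodEquiv L K).symm
    (BasedModule.IsSimple.dualProd L K).symm fun p => prod_restr v w i k p

theorem hyp_sym (K : BasedModule Λ) (p r : K × SDual Λ K) :
    (hyp ε K).sym p r = p.2 r.1 + (ε : ℤ) • star (r.2 p.1) := rfl

theorem hyp_simple (K : BasedModule Λ) : (hyp ε K).IsSimple Z := by
  refine ⟨((LinearEquiv.prodComm Λ K (SDual Λ K)).trans ((LinearEquiv.refl Λ _).prodCongr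
    ((BasedModule.evalEquiv K).trans (BasedModule.signEquiv ε _)))).trans
      (SDual.prodEquiv _ _).symm, fun p => SDual.ext fun r => ?_, ?_⟩
  · rw [hyp_sym]
    change p.2 r.1 + ((ε : ℤ) • SDual.eval K p.1) r.2 = _
    rw [SDual.zsmul_apply, SDual.eval_apply]
  · exact ((BasedModule.IsSimple.prodComm K K.dual).trans
      ((BasedModule.IsSimple.refl K.dual).prod
        ((BasedModule.IsSimple.eval K).trans (.sign ε K.dual.dual)))).trans
      (BasedModule.IsSimple.dualProd K K.dual).symm

theorem hyp_restr (K : BasedModule Λ) (p : K × SDual Λ K) :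
    (hyp ε K).restr (LinearMap.inl Λ K (SDual Λ K)) p = p.2 :=
  SDual.ext fun r => by
    rw [restr_apply, hyp_sym]
    simp

/-- The summand `K` is a simple Lagrangian of `H_ε(K)`. -/
theorem hyp_lagrangian (K : BasedModule Λ) :
    (hyp ε K).IsSimpleLagrangian Z K (LinearMap.inl Λ K (SDual Λ K)) := by
  refine ⟨⟨⟨LinearMap.fst Λ K (SDual Λ K), fun _ => rfl⟩, ?_, ?_⟩,
    ⟨LinearEquiv.refl Λ _, .refl _, fun _ => rfl, fun a c => hyp_restr K (a, c)⟩⟩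
  · refine Submodule.ext fun p => ?_
    rw [perp, LinearMap.mem_ker, hyp_restr]
    constructor
    · rintro ⟨a, rfl⟩
      rfl
    · intro h
      exact ⟨p.1, Prod.ext rfl h.symm⟩
  · exact (QEps.mk_eq (ψ := 0) (χ := 0) fun x y => by simp [hypHom]).trans (map_zero _)

end QForm

namespace BasedModule

theorem rank_prod (X Y : BasedModule Λ) : (X.prod Y).rank = X.rank + Y.rank := by
  simp only [rank]; push_cast; ring

theorem rank_dual (X : BasedModule Λ) : X.dual.rank = X.rank := rfl

end BasedModule

namespace QuasiFormation

variable {Z : AddSubgroup (RedK1 Λ)}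

/-- The direct sum of quasi-formations. -/
def prod (x y : QuasiFormation Z ε) : QuasiFormation Z ε where
  form := x.form.prod y.form
  simple := x.simple.prod y.simple
  L := x.L.prod y.L
  i := x.i.prodMap y.i
  lag := x.lag.prod y.lag
  V := x.V.prod y.V
  j := x.j.prodMap y.j
  summand := x.summand.prod y.summand
  half := by
    rw [BasedModule.rank_prod, BasedModule.rank_prod, x.half, y.half]; ring

/-- The trivial formation `(H_ε(P); P, P*)`. -/
def trivial (Z : AddSubgroup (RedK1 Λ)) (ε : ℤˣ) (P : BasedModule Λ) : QuasiFormation Z ε where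
  form := QForm.hyp ε P
  simple := QForm.hyp_simple P
  L := P
  i := LinearMap.inl Λ P (SDual Λ P)
  lag := QForm.hyp_lagrangian P
  V := P.dual
  j := LinearMap.inr Λ P (SDual Λ P)
  summand := ⟨LinearMap.snd Λ P (SDual Λ P), fun _ => rfl⟩
  half := by rw [BasedModule.rank_prod, BasedModule.rank_dual]; ring

/-- The boundary `δ(K, ρ) = (H_ε(K); K, {(x, ρx)})` of an asymmetric form `ρ : K → K*`. -/
def boundary (Z : AddSubgroup (RedK1 Λ)) (ε : ℤˣ) (K : BasedModule Λ) (ρ : K →ₗ[Λ] SDual Λ K) :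
    QuasiFormation Z ε where
  form := QForm.hyp ε K
  simple := QForm.hyp_simple K
  L := K
  i := LinearMap.inl Λ K (SDual Λ K)
  lag := QForm.hyp_lagrangian K
  V := K
  j := LinearMap.prod LinearMap.id ρ
  summand := ⟨LinearMap.fst Λ K (SDual Λ K), fun _ => rfl⟩
  half := by rw [BasedModule.rank_prod, BasedModule.rank_dual]; ring

/-- Isomorphism of quasi-formations: a simple isometry `f` with `f(L) = L'` and `f(V) = V'` such
that the induced isomorphisms `L ≅ L'` and `V ≅ V'` are simple. -/
def Iso (x y : QuasiFormation Z ε) : Prop :=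
  ∃ f : x.form.X ≃ₗ[Λ] y.form.X, BasedModule.IsSimple Z x.form.X y.form.X f ∧
    QEps.pull f.toLinearMap y.form.ψ = x.form.ψ ∧
    (∃ g : x.L ≃ₗ[Λ] y.L, BasedModule.IsSimple Z x.L y.L g ∧ ∀ a, f (x.i a) = y.i (g a)) ∧
    (∃ h : x.V ≃ₗ[Λ] y.V, BasedModule.IsSimple Z x.V y.V h ∧ ∀ a, f (x.j a) = y.j (h a))

/-- `x` is an `ε`-quadratic formation: `V` is a (not necessarily simple) Lagrangian. -/
def IsFormation (x : QuasiFormation Z ε) : Prop := x.form.IsLagrangian x.V x.j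

/-- The quasi-formation `(M, ψ; K, V)` for another simple Lagrangian `K` of `(M, ψ)`. -/
def replaceLagrangian (x : QuasiFormation Z ε) (K : BasedModule Λ) (k : K →ₗ[Λ] x.form.X)
    (hk : x.form.IsSimpleLagrangian Z K k) : QuasiFormation Z ε :=
  { x with L := K, i := k, lag := hk }

end QuasiFormation

end QuasiFormations
section LMonoid


variable {Λ : Type u} [Ring Λ] [StarRing Λ] {ε : ℤˣ} {Z : AddSubgroup (RedK1 Λ)}

theorem BasedModule.IsSimple.rank_eq {X Y : BasedModule Λ} {f : X ≃ₗ[Λ] Y}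
    (h : BasedModule.IsSimple Z X Y f) : X.rank = Y.rank := by
  obtain ⟨_, σ, τ, -⟩ := h
  have := Fintype.card_congr (σ.trans τ.symm)
  simp only [Fintype.card_sum, Fintype.card_fin] at this
  simp only [BasedModule.rank]
  omega

theorem QForm.IsSimpleLagrangian.rank_eq {v : QForm Λ ε} {L : BasedModule Λ} {i : L →ₗ[Λ] v.X}
    (h : v.IsSimpleLagrangian Z L i) : v.X.rank = 2 * L.rank := by
  obtain ⟨-, e, he, -⟩ := h
  rw [← he.rank_eq, BasedModule.rank_prod, BasedModule.rank_dual]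
  ring

namespace QuasiFormation

/-- The simple formation `(M, ψ; K, L)`, where `x = (M, ψ; L, V)` and `K` is a simple
Lagrangian. -/
def ofLagrangian (x : QuasiFormation Z ε) (K : BasedModule Λ) (k : K →ₗ[Λ] x.form.X)
    (hk : x.form.IsSimpleLagrangian Z K k) : QuasiFormation Z ε where
  form := x.form
  simple := x.simple
  L := K
  i := k
  lag := hk
  V := x.L
  j := x.i
  summand := x.lag.1.1
  half := x.lag.rank_eq

theorem Iso.refl (x : QuasiFormation Z ε) : x.Iso x :=
  ⟨LinearEquiv.refl Λ _, .refl _, QEps.pull_id _, ⟨LinearEquiv.refl Λ _, .refl _, fun _ => rfl⟩,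
    ⟨LinearEquiv.refl Λ _, .refl _, fun _ => rfl⟩⟩

theorem Iso.prodComm (x y : QuasiFormation Z ε) : (x.prod y).Iso (y.prod x) :=
  ⟨LinearEquiv.prodComm Λ _ _, .prodComm _ _, QEps.pull_prodComm _ _,
    ⟨LinearEquiv.prodComm Λ _ _, .prodComm _ _, fun _ => rfl⟩,
    ⟨LinearEquiv.prodComm Λ _ _, .prodComm _ _, fun _ => rfl⟩⟩

theorem Iso.prodAssoc (x y z : QuasiFormation Z ε) :
    ((x.prod y).prod z).Iso (x.prod (y.prod z)) :=
  ⟨LinearEquiv.prodAssoc Λ _ _ _, .prodAssoc _ _ _, QEps.pull_prodAssoc _ _ _,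
    ⟨LinearEquiv.prodAssoc Λ _ _ _, .prodAssoc _ _ _, fun _ => rfl⟩,
    ⟨LinearEquiv.prodAssoc Λ _ _ _, .prodAssoc _ _ _, fun _ => rfl⟩⟩

/-- The equivalence relation that defines the `l`-monoid: the smallest one, compatible with direct
sums, that identifies isomorphic quasi-formations, makes trivial formations zero and contains
`(M, ψ; K, L) ⊕ (M, ψ; L, V) ~ (M, ψ; K, V)` for all simple Lagrangians `K` and `L`. -/
inductive Rel : QuasiFormation Z ε → QuasiFormation Z ε → Prop
  | iso {x y : QuasiFormation Z ε} : x.Iso y → Rel x y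
  | stab (x : QuasiFormation Z ε) (P : BasedModule Λ) : Rel (x.prod (trivial Z ε P)) x
  | shift (x : QuasiFormation Z ε) (K : BasedModule Λ) (k : K →ₗ[Λ] x.form.X)
      (hk : x.form.IsSimpleLagrangian Z K k) :
      Rel ((x.ofLagrangian K k hk).prod x) (x.replaceLagrangian K k hk)
  | add {x y x' y' : QuasiFormation Z ε} : Rel x y → Rel x' y' → Rel (x.prod x') (y.prod y')
  | symm {x y : QuasiFormation Z ε} : Rel x y → Rel y x
  | trans {x y z : QuasiFormation Z ε} : Rel x y → Rel y z → Rel x z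

/-- `Rel` as a setoid. -/
def setoid (Z : AddSubgroup (RedK1 Λ)) (ε : ℤˣ) : Setoid (QuasiFormation Z ε) where
  r := Rel
  iseqv := ⟨fun x => .iso (.refl x), .symm, .trans⟩

/-- The identification `H_ε(K) ⊕ H_ε(K') ≅ H_ε(K ⊕ K')`. -/
def hypProd (K K' : BasedModule Λ) :
    ((K × SDual Λ K) × (K' × SDual Λ K')) ≃ₗ[Λ] ((K × K') × SDual Λ (K × K')) :=
  (LinearEquiv.prodProdProdComm Λ K (SDual Λ K) K' (SDual Λ K')).trans
    ((LinearEquiv.refl Λ (K × K')).prodCongr (SDual.prodEquiv K K').symm)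

theorem _root_.SurgeryMonoid.BasedModule.IsSimple.prodProdProdComm (A B C D : BasedModule Λ) :
    BasedModule.IsSimple Z ((A.prod B).prod (C.prod D)) ((A.prod C).prod (B.prod D))
      (LinearEquiv.prodProdProdComm Λ A B C D) := by
  have a1 := BasedModule.IsSimple.prodAssoc (Z := Z) A B (C.prod D)
  have a2 := BasedModule.IsSimple.prodAssoc (Z := Z) B C D
  have a3 := BasedModule.IsSimple.prodAssoc (Z := Z) C B D
  have a4 := BasedModule.IsSimple.prodAssoc (Z := Z) A C (B.prod D)
  have a5 := BasedModule.IsSimple.prodComm (Z := Z) B C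
  have a6 := (a2.symm.trans (a5.prod (.refl D))).trans a3
  exact ((a1.trans ((BasedModule.IsSimple.refl A).prod a6)).trans a4.symm).congr fun _ => rfl

theorem hypProd_simple (K K' : BasedModule Λ) :
    BasedModule.IsSimple Z ((K.prod K.dual).prod (K'.prod K'.dual))
      ((K.prod K').prod (K.prod K').dual) (hypProd K K') :=
  (BasedModule.IsSimple.prodProdProdComm K K.dual K' K'.dual).trans
    ((BasedModule.IsSimple.refl (K.prod K')).prod (BasedModule.IsSimple.dualProd K K').symm)

theorem pull_hypProd (K K' : BasedModule Λ) :
    QEps.pull (hypProd K K').toLinearMap (QForm.hyp ε (K.prod K')).ψ =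
      ((QForm.hyp ε K).prod (QForm.hyp ε K')).ψ := rfl

/-- The boundary of a direct sum of asymmetric forms. -/
theorem boundary_prod (K K' : BasedModule Λ) (ρ : K →ₗ[Λ] SDual Λ K) (ρ' : K' →ₗ[Λ] SDual Λ K') :
    ((boundary Z ε K ρ).prod (boundary Z ε K' ρ')).Iso (boundary Z ε (K.prod K')
      ((SDual.prodEquiv K K').symm.toLinearMap.comp (ρ.prodMap ρ'))) :=
  ⟨hypProd K K', hypProd_simple K K', pull_hypProd K K',
    ⟨LinearEquiv.refl Λ _, .refl _, fun _ => Prod.ext rfl (map_zero (SDual.prodEquiv K K').symm)⟩,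
    ⟨LinearEquiv.refl Λ _, .refl _, fun _ => rfl⟩⟩

theorem zero_iso_boundary :
    (trivial Z ε (BasedModule.zero Λ)).Iso (boundary Z ε (BasedModule.zero Λ) 0) := by
  have hs : Subsingleton (SDual Λ (BasedModule.zero Λ)) :=
    ⟨fun f g => SDual.ext fun x => by
      rw [Subsingleton.elim (α := PUnit) x 0]; exact (map_zero f).trans (map_zero g).symm⟩
  let h : SDual Λ (BasedModule.zero Λ) ≃ₗ[Λ] (BasedModule.zero Λ : BasedModule Λ) :=
    { toFun := fun _ => 0
      invFun := fun _ => 0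
      map_add' := fun _ _ => rfl
      map_smul' := fun _ _ => rfl
      left_inv := fun _ => Subsingleton.elim _ _
      right_inv := fun _ => rfl }
  refine ⟨LinearEquiv.refl Λ _, .refl _, QEps.pull_id _,
    ⟨LinearEquiv.refl Λ _, .refl _, fun _ => rfl⟩, ⟨h, ?_, fun _ => Prod.ext rfl ?_⟩⟩
  · exact .of_direct (LinearEquiv.refl Λ _) (.of_perm (Equiv.refl _) fun _ => rfl)
      (.of_perm (Equiv.refl _) fun i => i.elim0)
  · exact Subsingleton.elim (α := SDual Λ (BasedModule.zero Λ)) _ _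

end QuasiFormation

/-- The monoid `l_{2q+1}(Λ)`, where `ε = (-1)^q`. -/
def LMonoid (Z : AddSubgroup (RedK1 Λ)) (ε : ℤˣ) : Type (u + 1) :=
  Quotient (QuasiFormation.setoid Z ε)

namespace LMonoid

/-- The class `[x] = [M, ψ; L, V]`. -/
def mk (x : QuasiFormation Z ε) : LMonoid Z ε := Quotient.mk _ x

instance : Add (LMonoid Z ε) :=
  ⟨Quotient.map₂ QuasiFormation.prod fun _ _ h _ _ h' => QuasiFormation.Rel.add h h'⟩

instance : Zero (LMonoid Z ε) := ⟨mk (QuasiFormation.trivial Z ε (BasedModule.zero Λ))⟩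

/-- Addition is induced by the direct sum, and the unit is the class of the trivial formations. -/
instance : AddCommMonoid (LMonoid Z ε) where
  add_assoc := by
    rintro ⟨x⟩ ⟨y⟩ ⟨z⟩
    exact Quotient.sound (.iso (.prodAssoc x y z))
  zero_add := by
    rintro ⟨x⟩
    exact Quotient.sound (.trans (.iso (.prodComm _ _)) (.stab x _))
  add_zero := by
    rintro ⟨x⟩
    exact Quotient.sound (.stab x _)
  add_comm := by
    rintro ⟨x⟩ ⟨y⟩
    exact Quotient.sound (.iso (.prodComm x y))
  nsmul := nsmulRec

/-- The submonoid of elementary elements, i.e. of the classes of the boundaries `δ(K, ρ)`. -/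
def elementary (Z : AddSubgroup (RedK1 Λ)) (ε : ℤˣ) : AddSubmonoid (LMonoid Z ε) where
  carrier := {X | ∃ (K : BasedModule Λ) (ρ : K →ₗ[Λ] SDual Λ K),
    X = mk (QuasiFormation.boundary Z ε K ρ)}
  zero_mem' := ⟨BasedModule.zero Λ, 0, Quotient.sound (.iso QuasiFormation.zero_iso_boundary)⟩
  add_mem' := by
    rintro _ _ ⟨K, ρ, rfl⟩ ⟨K', ρ', rfl⟩
    exact ⟨K.prod K', _, Quotient.sound (.iso (QuasiFormation.boundary_prod K K' ρ ρ'))⟩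

/-- `L_{2q+1}(Λ)`, the set of the classes of `ε`-quadratic formations. -/
def LGroup (Z : AddSubgroup (RedK1 Λ)) (ε : ℤˣ) : Set (LMonoid Z ε) :=
  {X | ∃ x : QuasiFormation Z ε, x.IsFormation ∧ X = mk x}

end LMonoid

namespace QuasiFormation

/-- The form `(V, θ)` of `x = (M, ψ; L, V)`, where `θ = j*ψj`. -/
def formV (x : QuasiFormation Z ε) : QForm Λ ε := ⟨x.V, QEps.pull x.j x.form.ψ⟩

/-- The based module `W` with `k : W → M` is the annihilator `V^⊥` of `V` with its preferred
`s`-basis: `0 → W → M → V* → 0` is a based exact sequence. In particular `k` is injective with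
image `V^⊥`. -/
def IsPerp (x : QuasiFormation Z ε) (W : BasedModule Λ) (k : W →ₗ[Λ] x.form.X) : Prop :=
  BasedExact Z W x.form.X x.V.dual k (x.form.restr x.j)

theorem IsPerp.range_eq {x : QuasiFormation Z ε} {W : BasedModule Λ} {k : W →ₗ[Λ] x.form.X}
    (h : x.IsPerp W k) : Function.Injective k ∧ LinearMap.range k = x.form.perp x.j := by
  obtain ⟨e, -, h1, h2⟩ := h
  refine ⟨fun a b hab => ?_, Submodule.ext fun m => ⟨?_, fun hm => ?_⟩⟩
  · rw [← h1, ← h1] at hab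
    exact congrArg Prod.fst (e.injective hab)
  · rintro ⟨a, rfl⟩
    exact LinearMap.mem_ker.2 ((congrArg _ (h1 a).symm).trans (h2 a 0))
  · obtain ⟨⟨a, c⟩, rfl⟩ := e.surjective m
    have hc : c = 0 := (h2 a c).symm.trans (LinearMap.mem_ker.1 hm)
    exact ⟨a, by rw [hc, h1]⟩

/-- The form `(V^⊥, -θ^⊥)`, where `θ^⊥` is the restriction of `ψ` to `V^⊥ = k(W)`. -/
def formPerp (x : QuasiFormation Z ε) (W : BasedModule Λ) (k : W →ₗ[Λ] x.form.X) : QForm Λ ε :=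
  ⟨W, -QEps.pull k x.form.ψ⟩

end QuasiFormation

/-- The diagonal `Δ(F) = {(w, w)}` of `F × F`. -/
def diagonal (F : Type v) [AddCommMonoid F] : AddSubmonoid (F × F) where
  carrier := {p | p.1 = p.2}
  zero_mem' := rfl
  add_mem' h h' := congrArg₂ (· + ·) h h'

end LMonoid

end

end SurgeryMonoid

open SurgeryMonoid

/-!
The torsion of a shear of `M ⊕ N` vanishes, because after adding a further copy of `N` the shear
is a commutator. Hence the kernel of a split epimorphism of based modules carries an `s`-basis
which is unique up to simple isomorphism; this bases `V^⊥` and makes `b` well defined.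

For the image of `b`, the graph of `V ↪ M` is an isotropic summand of `(M, ψ) ⊕ (V, -θ)` whose
annihilator is the graph plus `V^⊥`, and splitting off such a summand gives
`H_ε(V) ⊕ (V^⊥, θ^⊥) ≅ (M, ψ) ⊕ (V, -θ)`. As `(M, ψ) ≅ H_ε(L)` with `rk L = rk V`, the two
components of `b` agree after adding a hyperbolic form. Conversely an isometry
`v ⊕ H ≅ (K, ρ) ⊕ H` embeds `v ⊕ H` into `H_ε(K) ⊕ H` through the graph of `ρ`; the image of `v`
plus a Lagrangian `R` of `H` is then a summand restricting the form to `v ⊕ 0`, with annihilator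
the graph of `-T_ε ρ` plus the image of `R`, where the form is `-ρ ⊕ 0`.

On elementary elements `b` sends `δ(K, ρ)` to `([K, ρ], [K, ρ])`. It is injective there because
the shift relation with `P*` as Lagrangian identifies `δ(P, ρ)` with `(H_ε(P); P*, graph(ρ))`,
whose class depends only on `[ρ] ∈ Q_ε(P)`.
-/

namespace SurgeryMonoid

universe u

noncomputable section

open Module

/-! ### Torsion -/

section Torsion

open scoped commutatorElement

variable {Λ : Type u} [Ring Λ] {Z : AddSubgroup (RedK1 Λ)}
  {M N M' N' : Type u} [AddCommGroup M] [Module Λ M] [AddCommGroup N] [Module Λ N]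
  [AddCommGroup M'] [Module Λ M'] [AddCommGroup N'] [Module Λ N']
  {ι κ ι' κ' : Type}

namespace IsSimpleFor

theorem refl [Finite ι] (b : Basis ι Λ M) : IsSimpleFor Z b b (LinearEquiv.refl Λ M) :=
  of_perm (Equiv.refl ι) fun _ => rfl

theorem map [Finite ι] (b : Basis ι Λ M) (g : M ≃ₗ[Λ] N) : IsSimpleFor Z b (b.map g) g :=
  of_perm (Equiv.refl ι) fun _ => rfl

theorem reindex [Finite ι] (b : Basis ι Λ M) (e : ι ≃ κ) :
    IsSimpleFor Z b (b.reindex e) (LinearEquiv.refl Λ M) :=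
  of_perm e fun _ => by simp

theorem prodUnique_symm [Finite ι] [IsEmpty κ] [Unique N] (b : Basis ι Λ M) (c : Basis κ Λ N) :
    IsSimpleFor Z b (b.prod c) (LinearEquiv.prodUnique (M₂ := N)).symm :=
  of_perm (Equiv.sumEmpty ι κ).symm fun i => by
    rw [Equiv.sumEmpty_symm_apply, Basis.prod_apply]
    exact Prod.ext rfl (Subsingleton.elim _ _)

theorem iff_of_comm_square {b : Basis ι Λ M} {b' : Basis ι' Λ M'} {c : Basis κ Λ N}
    {c' : Basis κ' Λ N'} {s : M ≃ₗ[Λ] M'} {t : N ≃ₗ[Λ] N'} {f : M ≃ₗ[Λ] N} {f' : M' ≃ₗ[Λ] N'}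
    (hs : IsSimpleFor Z b b' s) (ht : IsSimpleFor Z c c' t) (comm : ∀ x, f' (s x) = t (f x)) :
    IsSimpleFor Z b c f ↔ IsSimpleFor Z b' c' f' := by
  constructor <;> intro h
  · refine ((hs.symm.trans h).trans ht).congr fun x => ?_
    obtain ⟨x, rfl⟩ := s.surjective x
    simp [comm]
  · refine ((hs.trans h).trans ht.symm).congr fun x => ?_
    simp [comm]

theorem commutator [Finite ι] (b : Basis ι Λ M) (α β : M ≃ₗ[Λ] M) : IsSimpleFor Z b b ⁅α, β⁆ := by
  have := Fintype.ofFinite ι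
  let e := Fintype.equivFin ι
  refine ⟨_, e, e, ?_⟩
  have torsion_commutator : torsion (b.reindex e) (b.reindex e) ⁅α, β⁆ = 0 := by
    change torsion _ _ (((β.symm.trans α.symm).trans β).trans α) = 0
    rw [torsion_trans _ (b.reindex e), torsion_trans _ (b.reindex e),
      torsion_trans _ (b.reindex e), torsion_symm, torsion_symm]
    abel
  exact torsion_commutator ▸ Z.zero_mem

end IsSimpleFor

/-- The shear `(x, y) ↦ (x + g y, y)` of `M ⊕ N`. -/
def shear (g : N →ₗ[Λ] M) : (M × N) ≃ₗ[Λ] (M × N) where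
  toFun p := (p.1 + g p.2, p.2)
  invFun p := (p.1 - g p.2, p.2)
  map_add' p q := by ext <;> simp; abel
  map_smul' a p := by simp
  left_inv p := by simp
  right_inv p := by simp

/-- After adding a further copy of `N` the shear by `g` is the commutator of two elementary
automorphisms, `E₁₂(g) = [E₁₃(g), E₃₂(1)]`. -/
theorem IsSimpleFor.shear [Finite ι] [Finite κ] (b : Basis ι Λ M) (c : Basis κ Λ N)
    (g : N →ₗ[Λ] M) : IsSimpleFor Z (b.prod c) (b.prod c) (shear g) := by
  let E₁₃ : ((M × N) × N) ≃ₗ[Λ] ((M × N) × N) :=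
    SurgeryMonoid.shear ((LinearMap.inl Λ M N).comp g)
  let E₃₂ : ((M × N) × N) ≃ₗ[Λ] ((M × N) × N) :=
    ((LinearEquiv.prodComm Λ _ _).trans (SurgeryMonoid.shear (LinearMap.snd Λ M N))).trans
      (LinearEquiv.prodComm Λ _ _)
  refine cancel (d := c) ((commutator ((b.prod c).prod c) E₁₃ E₃₂).congr fun p => ?_)
  change ((p.1.1 - g (p.2 - p.1.2) + g (p.2 - p.1.2 + (p.1.2 - 0)), p.1.2 - 0 + 0),
    p.2 - p.1.2 + (p.1.2 - 0)) = ((p.1.1 + g p.1.2, p.1.2), p.2)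
  simp only [map_sub, sub_zero, add_zero, sub_add_cancel]
  congr 2
  abel

end Torsion

section DualTorsion

variable {Λ : Type u} [Ring Λ] [StarRing Λ] {M N : Type u} [AddCommGroup M] [Module Λ M]
  [AddCommGroup N] [Module Λ N] {ι κ : Type} [Fintype ι] [Fintype κ]

theorem SDual.dualBasis_apply_eq_repr (b : Basis ι Λ M) (i : ι) (x : M) :
    dualBasis b i x = b.repr x i := by
  classical
  have dualBasis_eq_coord : dualBasis b i = (b.coord i : M →ₗ[Λ] Λ) :=
    dualBasis_eq b i _ fun j => by
      change b.coord i (b j) = _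
      simp [Finsupp.single_apply, eq_comm]
  rw [dualBasis_eq_coord]
  rfl

theorem SDual.dualBasis_reindex (b : Basis ι Λ M) (e : ι ≃ κ) :
    dualBasis (b.reindex e) = (dualBasis b).reindex e :=
  Basis.eq_of_apply_eq fun i => SDual.ext fun x => by
    simp [SDual.dualBasis_apply_eq_repr]

theorem torsion_dual {n : ℕ} (b : Basis (Fin n) Λ M) (c : Basis (Fin n) Λ N) (f : M ≃ₗ[Λ] N) :
    torsion (SDual.dualBasis b) (SDual.dualBasis c) (SDual.congr f) =
      -RedK1.conj (torsion b c f) := by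
  rw [← map_neg, ← torsion_symm, torsion, torsion, RedK1.conj_cls]
  refine congrArg RedK1.cls (Units.ext (Matrix.ext fun i j => ?_))
  change star (SDual.dualBasis b i (f.symm (c j))) = star (b.repr (f.symm (c j)) i)
  rw [SDual.dualBasis_apply_eq_repr]

theorem IsSimpleFor.dual {Z : AddSubgroup (RedK1 Λ)} (hZ : ∀ z ∈ Z, RedK1.conj z ∈ Z)
    {b : Basis ι Λ M} {c : Basis κ Λ N} {f : M ≃ₗ[Λ] N} (h : IsSimpleFor Z b c f) :
    IsSimpleFor Z (SDual.dualBasis b) (SDual.dualBasis c) (SDual.congr f) := by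
  obtain ⟨n, e, e', h⟩ := h
  refine ⟨n, e, e', ?_⟩
  rw [← SDual.dualBasis_reindex, ← SDual.dualBasis_reindex, torsion_dual]
  exact Z.neg_mem (hZ _ h)

end DualTorsion

/-! ### Based modules and based exact sequences -/

namespace BasedModule

section Ring

variable {Λ : Type u} [Ring Λ] {Z : AddSubgroup (RedK1 Λ)}

theorem IsSimple.shear (X Y : BasedModule Λ) (g : Y →ₗ[Λ] X) :
    IsSimple Z (X.prod Y) (X.prod Y) (shear g) := by
  have shear_stab := IsSimpleFor.shear (Z := Z) X.basis Y.basis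
    ((LinearMap.inl Λ X (Fin X.m → Λ)).comp (g.comp (LinearMap.fst Λ Y (Fin Y.m → Λ))))
  refine .of_direct (LinearEquiv.refl _ _) (.refl _)
    ((IsSimpleFor.iff_of_comm_square (prod_simple X Y) (prod_simple X Y) fun p => ?_).1 shear_stab)
  exact Prod.ext rfl (congrArg (finAdd Λ X.m Y.m) (Prod.ext (add_zero p.1.2).symm rfl))

/-- A free module with a finite basis, as a based module. -/
abbrev ofBasis {n : ℕ} {M : Type u} [AddCommGroup M] [Module Λ M] (b : Basis (Fin n) Λ M) :
    BasedModule Λ where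
  carrier := M
  m := 0
  n := n
  basis := b.map LinearEquiv.prodUnique.symm

section OfBasis

variable {M N : Type u} [AddCommGroup M] [Module Λ M] [AddCommGroup N] [Module Λ N] {m n : ℕ}

theorem IsSimple.ofBasis {b : Basis (Fin m) Λ M} {c : Basis (Fin n) Λ N} {f : M ≃ₗ[Λ] N}
    (h : IsSimpleFor Z b c f) :
    IsSimple Z (BasedModule.ofBasis b) (BasedModule.ofBasis c) f :=
  .of_direct (LinearEquiv.refl _ _) (.refl _)
    ((IsSimpleFor.iff_of_comm_square (.map b _) (.map c _) fun _ => rfl).1 h)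

theorem IsSimple.ofBasis_prod (b : Basis (Fin m) Λ M) (c : Basis (Fin n) Λ N) :
    IsSimple Z ((BasedModule.ofBasis b).prod (BasedModule.ofBasis c))
      (BasedModule.ofBasis ((b.prod c).reindex finSumFinEquiv)) (LinearEquiv.refl Λ _) := by
  have source := ((IsSimpleFor.map (Z := Z) b _).prod (IsSimpleFor.map c _)).trans
    (prod_simple (BasedModule.ofBasis b) (BasedModule.ofBasis c))
  have target := IsSimpleFor.map (Z := Z) ((b.prod c).reindex finSumFinEquiv)
    (LinearEquiv.prodUnique (M₂ := Fin 0 → Λ)).symm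
  refine .of_direct (LinearEquiv.refl Λ (Fin 0 → Λ)) (.refl _)
    ((IsSimpleFor.iff_of_comm_square source target fun p => ?_).1
      (IsSimpleFor.reindex (b.prod c) finSumFinEquiv))
  exact Prod.ext rfl (Subsingleton.elim _ _)

end OfBasis

theorem IsSimple.free_add (a b : ℕ) :
    IsSimple Z ((free Λ a).prod (free Λ b)) (free Λ (a + b)) (finAdd Λ a b) := by
  have finAdd_reindex := (IsSimpleFor.reindex (Z := Z)
    ((Pi.basisFun Λ (Fin a)).prod (Pi.basisFun Λ (Fin b))) finSumFinEquiv).symm.trans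
      (finAdd_simple a b)
  exact ((IsSimple.ofBasis_prod (Pi.basisFun Λ (Fin a)) (Pi.basisFun Λ (Fin b))).trans
    (IsSimple.ofBasis finAdd_reindex)).congr fun _ => rfl

theorem IsSimple.prod_free (X : BasedModule Λ) :
    IsSimple Z (X.prod (free Λ X.m)) (BasedModule.ofBasis X.basis) (LinearEquiv.refl Λ _) := by
  let std := Pi.basisFun Λ (Fin X.m)
  let nil := Pi.basisFun Λ (Fin 0)
  have source : IsSimpleFor Z (X.basis.prod std) ((X.prod (free Λ X.m)).basis.prod nil) _ :=
    (((IsSimpleFor.refl X.basis).prod (IsSimpleFor.map std _)).trans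
      (prod_simple X (free Λ X.m))).trans (.prodUnique_symm _ nil)
  have target : IsSimpleFor Z (X.basis.prod std)
      ((BasedModule.ofBasis X.basis).basis.prod (Pi.basisFun Λ (Fin (X.m + 0)))) _ :=
    (IsSimpleFor.map X.basis _).prod
      ((IsSimpleFor.prodUnique_symm std nil).trans (finAdd_simple X.m 0))
  refine (IsSimpleFor.iff_of_comm_square source target fun p => ?_).1 (IsSimple.refl X)
  exact Prod.ext (Prod.ext rfl (Subsingleton.elim _ _)) rfl

theorem IsSimple.prod_free_equivFun (X : BasedModule Λ) :
    IsSimple Z (X.prod (free Λ X.m)) (free Λ X.n) X.basis.equivFun := by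
  have equivFun_simple : IsSimpleFor Z X.basis (Pi.basisFun Λ (Fin X.n)) X.basis.equivFun :=
    .of_perm (Equiv.refl _) fun i => by
      ext j
      simp [Pi.single_apply, eq_comm]
  exact ((IsSimple.prod_free X).trans (IsSimple.ofBasis equivFun_simple)).congr fun _ => rfl

theorem exists_prod_free_simple (X : BasedModule Λ) (k : ℕ) :
    ∃ f : (X × (Fin (X.m + k) → Λ)) ≃ₗ[Λ] (Fin (X.n + k) → Λ),
      IsSimple Z (X.prod (free Λ (X.m + k))) (free Λ (X.n + k)) f :=
  ⟨_, ((((IsSimple.refl X).prod (IsSimple.free_add X.m k).symm).trans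
    (IsSimple.prodAssoc X (free Λ X.m) (free Λ k)).symm).trans
      ((IsSimple.prod_free_equivFun X).prod (.refl _))).trans (IsSimple.free_add X.n k)⟩

/-- The rearrangement `(X ⊕ Λ^m ⊕ Λ^a) ⊕ (Y ⊕ Λ^{m'} ⊕ Λ^b) ≅ (X ⊕ Y) ⊕ Λ^{m+m'} ⊕ Λ^{a+b}`,
which compares the stabilised `s`-bases of two summands with that of their sum. -/
def prodStabEquiv (X Y : BasedModule Λ) (a b : ℕ) :
    (((X × (Fin X.m → Λ)) × (Fin a → Λ)) × ((Y × (Fin Y.m → Λ)) × (Fin b → Λ))) ≃ₗ[Λ]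
      (((X.prod Y) × (Fin (X.prod Y).m → Λ)) × (Fin (a + b) → Λ)) :=
  (LinearEquiv.prodProdProdComm Λ _ _ _ _).trans
    (((LinearEquiv.prodProdProdComm Λ X (Fin X.m → Λ) Y (Fin Y.m → Λ)).trans
      ((LinearEquiv.refl Λ (X × Y)).prodCongr (finAdd Λ X.m Y.m))).prodCongr (finAdd Λ a b))

theorem prodStabEquiv_simple (X Y : BasedModule Λ) (a b : ℕ) :
    IsSimpleFor Z ((X.basis.prod (Pi.basisFun Λ (Fin a))).prod
      (Y.basis.prod (Pi.basisFun Λ (Fin b))))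
      ((X.prod Y).basis.prod (Pi.basisFun Λ (Fin (a + b)))) (prodStabEquiv X Y a b) :=
  (IsSimpleFor.of_perm (Equiv.sumSumSumComm _ _ _ _)
    (by rintro ((i | i) | (i | i)) <;> simp)).trans ((prod_simple X Y).prod (finAdd_simple a b))

theorem IsSimple.cancel {X X' Y : BasedModule Λ} {f : X ≃ₗ[Λ] X'}
    (h : IsSimple Z (X.prod Y) (X'.prod Y) (f.prodCongr (LinearEquiv.refl Λ Y))) :
    IsSimple Z X X' f := by
  have sum_simple : IsSimpleFor Z _ _
      ((stabIso X X' f).prodCongr (stabIso Y Y (LinearEquiv.refl Λ Y))) :=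
    (IsSimpleFor.iff_of_comm_square (prodStabEquiv_simple X Y X'.m Y.m)
      (prodStabEquiv_simple X' Y X.m Y.m) fun _ => rfl).2 h
  refine IsSimpleFor.cancel ((sum_simple.trans
    ((IsSimpleFor.refl _).prod (IsSimpleFor.symm (IsSimple.refl (Z := Z) Y)))).congr fun _ => ?_)
  rfl

section Complement

variable {A : Type u} [AddCommGroup A] [Module Λ A] {B C : BasedModule Λ}

/-- The isomorphism `A ⊕ Λ^{n(C)+m(B)} ≅ (B ⊕ Λ^{m(B)}) ⊕ Λ^{m(C)}` induced by `A ⊕ C ≅ B`,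
through which `A` inherits an `s`-basis. -/
def complementEquiv (e : (A × C) ≃ₗ[Λ] B) :
    (A × (Fin (C.n + B.m) → Λ)) ≃ₗ[Λ] ((B × (Fin B.m → Λ)) × (Fin C.m → Λ)) :=
  ((LinearEquiv.refl Λ A).prodCongr
    ((C.basis.equivFun.prodCongr (LinearEquiv.refl Λ (Fin B.m → Λ))).trans
      (finAdd Λ C.n B.m))).symm.trans
  { toFun := fun p => ((e (p.1, p.2.1.1), p.2.2), p.2.1.2)
    invFun := fun p => ((e.symm p.1.1).1, (((e.symm p.1.1).2, p.2), p.1.2))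
    map_add' := fun p q => by
      refine Prod.ext (Prod.ext ?_ rfl) rfl
      exact map_add e (p.1, p.2.1.1) (q.1, q.2.1.1)
    map_smul' := fun a p => by
      refine Prod.ext (Prod.ext ?_ rfl) rfl
      exact map_smul e a (p.1, p.2.1.1)
    left_inv := fun p => by simp
    right_inv := fun p => by simp }

/-- The based structure on `A` for which a given isomorphism `A ⊕ C ≅ B` becomes simple. -/
abbrev complement (e : (A × C) ≃ₗ[Λ] B) : BasedModule Λ where
  carrier := A
  m := C.n + B.m
  n := B.n + C.m
  basis := ((B.basis.prod (Pi.basisFun Λ (Fin C.m))).reindex finSumFinEquiv).map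
    (complementEquiv e).symm

theorem IsSimple.complementEquiv (e : (A × C) ≃ₗ[Λ] B) :
    IsSimple Z ((BasedModule.complement e).prod (free Λ (C.n + B.m)))
      ((B.prod (free Λ B.m)).prod (free Λ C.m)) (BasedModule.complementEquiv e) := by
  let b := (B.basis.prod (Pi.basisFun Λ (Fin C.m))).reindex finSumFinEquiv
  have transport : IsSimpleFor Z (BasedModule.complement e).basis b
      (BasedModule.complementEquiv e) := (IsSimpleFor.map b _).symm
  have target := (IsSimple.ofBasis_prod (Z := Z) B.basis (Pi.basisFun Λ (Fin C.m))).symm.trans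
    ((IsSimple.prod_free B).symm.prod (.refl (free Λ C.m)))
  exact ((IsSimple.prod_free (BasedModule.complement e)).trans
    ((IsSimple.ofBasis transport).trans target)).congr fun _ => rfl

theorem IsSimple.complement (e : (A × C) ≃ₗ[Λ] B) :
    IsSimple Z ((BasedModule.complement e).prod C) B e := by
  let W := BasedModule.complement e
  have source := (IsSimple.prodAssoc (Z := Z) W C ((free Λ C.m).prod (free Λ B.m))).trans
    ((IsSimple.refl W).prod ((IsSimple.prodAssoc C (free Λ C.m) (free Λ B.m)).symm.trans
      (((IsSimple.prod_free_equivFun C).prod (.refl (free Λ B.m))).trans (.free_add C.n B.m))))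
  have target := (IsSimple.prodAssoc (Z := Z) B (free Λ B.m) (free Λ C.m)).trans
    ((IsSimple.refl B).prod (.prodComm _ _))
  refine IsSimple.cancel (((source.trans (IsSimple.complementEquiv e)).trans target).congr
    fun ⟨⟨a, c⟩, u, v⟩ => ?_)
  let s := (LinearEquiv.refl Λ A).prodCongr
    ((C.basis.equivFun.prodCongr (LinearEquiv.refl Λ (Fin B.m → Λ))).trans (finAdd Λ C.n B.m))
  exact congrArg (fun p : A × ((C × (Fin C.m → Λ)) × (Fin B.m → Λ)) =>
      ((e (p.1, p.2.1.1), (p.2.1.2, p.2.2)) : B × ((Fin C.m → Λ) × (Fin B.m → Λ))))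
    (s.symm_apply_apply (a, ((c, u), v)))

end Complement

theorem IsSimple.of_triangular {A A' B C : BasedModule Λ} {e : (A × C) ≃ₗ[Λ] B}
    {e' : (A' × C) ≃ₗ[Λ] B} (he : IsSimple Z (A.prod C) B e) (he' : IsSimple Z (A'.prod C) B e')
    {f : A ≃ₗ[Λ] A'} {g : C →ₗ[Λ] A'} (h : ∀ a c, e (a, c) = e' (f a + g c, c)) :
    IsSimple Z A A' f := by
  refine IsSimple.cancel (Y := C)
    (((he.trans he'.symm).trans (IsSimple.shear A' C g).symm).congr fun ⟨a, c⟩ => ?_)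
  change (SurgeryMonoid.shear g).symm (e'.symm (e (a, c))) = (f a, c)
  rw [h, LinearEquiv.symm_apply_apply, LinearEquiv.symm_apply_eq]
  rfl

end Ring

theorem IsSimple.dual {Λ : Type u} [Ring Λ] [StarRing Λ] {Z : AddSubgroup (RedK1 Λ)}
    (hZ : ∀ z ∈ Z, RedK1.conj z ∈ Z) {X Y : BasedModule Λ} {f : X ≃ₗ[Λ] Y}
    (h : IsSimple Z X Y f) : IsSimple Z X.dual Y.dual (SDual.congr f) := by
  have dual_stab_simple (U : BasedModule Λ) (a : ℕ) :=
    (SDual.prodEquiv_simple (Z := Z) U.basis (Pi.basisFun Λ (Fin a))).trans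
      ((dual_simple U).prod (SDual.coordEquiv_simple _))
  refine (IsSimpleFor.iff_of_comm_square (dual_stab_simple X Y.m) (dual_stab_simple Y X.m)
    fun F => ?_).1 (IsSimpleFor.dual hZ h)
  have symm_zero : f.symm 0 = 0 := map_zero _
  refine Prod.ext (Prod.ext (SDual.ext fun y => rfl) (funext fun i => ?_)) (funext fun i => ?_)
  · change star (F ((0, 0), _)) = star (F ((f.symm 0, 0), _))
    rw [symm_zero]
    rfl
  · change star (F ((0, _), 0)) = star (F ((f.symm 0, _), 0))
    rw [symm_zero]
    rfl

theorem exists_predual {Λ : Type u} [Ring Λ] [StarRing Λ] {K : BasedModule Λ} {N : Type u}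
    [AddCommGroup N] [Module Λ N] (β : SDual Λ K →ₗ[Λ] SDual Λ N) :
    ∃ γ : N →ₗ[Λ] K, ∀ f n, f (γ n) = β f n := by
  refine ⟨(BasedModule.evalEquiv K).symm.toLinearMap.comp ((SDual.map β).comp (SDual.eval N)),
    fun f n => ?_⟩
  change f ((BasedModule.evalEquiv K).symm (SDual.map β (SDual.eval N n))) = _
  obtain ⟨x, hx⟩ := (BasedModule.evalEquiv K).surjective (SDual.map β (SDual.eval N n))
  rw [← hx, LinearEquiv.symm_apply_apply, ← star_star (f x)]
  have eval_eq := congrArg (fun X : SDual Λ (SDual Λ K) => star (X f)) hx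
  simpa using eval_eq

end BasedModule

section BasedExact

variable {Λ : Type u} [Ring Λ] {Z : AddSubgroup (RedK1 Λ)}

/-- The isomorphism of kernels induced by an isomorphism `A ⊕ C ≅ A' ⊕ C` over `C`. -/
def kernelEquiv {A A' C : Type u} [AddCommGroup A] [Module Λ A] [AddCommGroup A'] [Module Λ A']
    [AddCommGroup C] [Module Λ C] (E : (A × C) ≃ₗ[Λ] (A' × C)) (hE : ∀ x, (E x).2 = x.2) :
    A ≃ₗ[Λ] A' :=
  .ofLinearMap ((LinearMap.fst Λ A' C).comp (E.toLinearMap.comp (LinearMap.inl Λ A C)))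
    ((LinearMap.fst Λ A C).comp (E.symm.toLinearMap.comp (LinearMap.inl Λ A' C)))
    (LinearMap.ext fun a => by
      have symm_eq : E.symm (a, 0) = ((E.symm (a, 0)).1, 0) :=
        Prod.ext rfl ((hE _).symm.trans (by rw [E.apply_symm_apply]))
      change (E ((E.symm (a, 0)).1, 0)).1 = a
      rw [← symm_eq, E.apply_symm_apply])
    (LinearMap.ext fun a => by
      have E_eq : E (a, 0) = ((E (a, 0)).1, 0) := Prod.ext rfl (hE _)
      change (E.symm ((E (a, 0)).1, 0)).1 = a
      rw [← E_eq, E.symm_apply_apply])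

theorem BasedExact.exists_left {A B C A' B' C' : BasedModule Λ} {i : A →ₗ[Λ] B} {p : B →ₗ[Λ] C}
    {i' : A' →ₗ[Λ] B'} {p' : B' →ₗ[Λ] C'} (h : BasedExact Z A B C i p)
    (h' : BasedExact Z A' B' C' i' p') {β : B ≃ₗ[Λ] B'} (hβ : BasedModule.IsSimple Z B B' β)
    {γ : C ≃ₗ[Λ] C'} (hγ : BasedModule.IsSimple Z C C' γ) (hp : ∀ x, p' (β x) = γ (p x)) :
    ∃ α : A ≃ₗ[Λ] A', BasedModule.IsSimple Z A A' α ∧ ∀ a, i' (α a) = β (i a) := by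
  obtain ⟨e, he, e_left, p_e⟩ := h
  obtain ⟨e', he', e'_left, p'_e'⟩ := h'
  have source := ((BasedModule.IsSimple.refl A).prod hγ.symm).trans (he.trans hβ)
  let E : (A × C') ≃ₗ[Λ] (A' × C') :=
    (((LinearEquiv.refl Λ A).prodCongr γ.symm).trans (e.trans β)).trans e'.symm
  have e'_E (x) : e' (E x) = β (e (x.1, γ.symm x.2)) := e'.apply_symm_apply _
  have E_snd (x) : (E x).2 = x.2 := by
    rw [← p'_e' (E x).1 (E x).2]
    exact (congrArg p' (e'_E x)).trans (by rw [hp, p_e, LinearEquiv.apply_symm_apply])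
  have E_left (a) : E (a, 0) = (kernelEquiv E E_snd a, 0) := Prod.ext rfl (E_snd _)
  refine ⟨kernelEquiv E E_snd, .of_triangular source he'
    (g := (LinearMap.fst Λ _ _).comp (E.toLinearMap.comp (LinearMap.inr Λ _ _)))
    fun a c => ?_, fun a => ?_⟩
  · refine (e'_E (a, c)).symm.trans (congrArg e' (Prod.ext ?_ (E_snd _)))
    change (E (a, c)).1 = (E (a, 0) + E (0, c)).1
    rw [← map_add]
    simp
  · rw [← e'_left, ← E_left, e'_E, map_zero, e_left]

theorem BasedExact.exists_of_section {B C : BasedModule Λ} {p : B →ₗ[Λ] C} {σ : C →ₗ[Λ] B}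
    (hσ : ∀ c, p (σ c) = c) :
    ∃ (A : BasedModule Λ) (i : A →ₗ[Λ] B), BasedExact Z A B C i p := by
  obtain ⟨split, inl_eq, snd_eq⟩ := (LinearMap.exact_subtype_ker_map p).splitSurjectiveEquiv
    Subtype.val_injective ⟨σ, LinearMap.ext hσ⟩
  refine ⟨BasedModule.complement split.symm, (LinearMap.ker p).subtype, split.symm,
    .complement split.symm, fun a => (LinearMap.congr_fun inl_eq a).symm, fun a c => ?_⟩
  exact (LinearMap.congr_fun snd_eq _).trans (congrArg Prod.snd (split.apply_symm_apply (a, c)))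

theorem BasedExact.apply_apply_eq_zero {A B C : BasedModule Λ} {i : A →ₗ[Λ] B} {p : B →ₗ[Λ] C}
    (h : BasedExact Z A B C i p) (a : A) : p (i a) = 0 := by
  obtain ⟨e, -, e_left, p_e⟩ := h
  rw [← e_left, p_e]

theorem BasedExact.prod_equiv {A B C H H' : BasedModule Λ} {i : A →ₗ[Λ] B} {p : B →ₗ[Λ] C}
    (h : BasedExact Z A B C i p) {g : H ≃ₗ[Λ] H'} (hg : BasedModule.IsSimple Z H H' g) :
    BasedExact Z A (B.prod H) (C.prod H') ((LinearMap.inl Λ B H).comp i)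
      (p.prodMap g.toLinearMap) := by
  obtain ⟨e, he, e_left, p_e⟩ := h
  exact ⟨((LinearEquiv.prodAssoc Λ A C H').symm).trans (e.prodCongr g.symm),
    (BasedModule.IsSimple.prodAssoc A C H').symm.trans (he.prod hg.symm),
    fun a => Prod.ext (e_left a) (map_zero g.symm),
    fun a c => Prod.ext (p_e a c.1) (g.apply_symm_apply c.2)⟩

/-- The kernel of a composite of two based epimorphisms is `A ⊕ A'`, with `A'` embedded by a lift
`l` of `i'`; a shear turns `l` into the lift given by the splitting of the first sequence. -/
theorem BasedExact.comp {A B C A' D : BasedModule Λ} {i : A →ₗ[Λ] B} {p : B →ₗ[Λ] C}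
    {i' : A' →ₗ[Λ] C} {p' : C →ₗ[Λ] D} (h : BasedExact Z A B C i p)
    (h' : BasedExact Z A' C D i' p') (l : A' →ₗ[Λ] B) (hl : ∀ a, p (l a) = i' a) :
    BasedExact Z (A.prod A') B D (i.coprod l) (p'.comp p) := by
  obtain ⟨e, he, e_left, p_e⟩ := h
  obtain ⟨e', he', e'_left, p'_e'⟩ := h'
  let s : A' →ₗ[Λ] A := (LinearMap.fst Λ _ _).comp (e.symm.toLinearMap.comp l)
  have e_s (a') : e (s a', i' a') = l a' := by
    have snd_eq : i' a' = (e.symm (l a')).2 := by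
      rw [← hl, ← p_e (e.symm (l a')).1 (e.symm (l a')).2]
      exact congrArg p (e.apply_symm_apply (l a')).symm
    exact (e.eq_symm_apply).1 (Prod.ext rfl snd_eq)
  refine ⟨(((shear s).prodCongr (.refl Λ D)).trans (.prodAssoc Λ A A' D)).trans
      (((LinearEquiv.refl Λ A).prodCongr e').trans e),
    (((BasedModule.IsSimple.shear A A' s).prod (.refl D)).trans (.prodAssoc A A' D)).trans
      (((BasedModule.IsSimple.refl A).prod he').trans he), fun a => ?_, fun a d => ?_⟩
  · change e (a.1 + s a.2, e' (a.2, 0)) = i a.1 + l a.2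
    rw [e'_left, ← e_s, ← e_left, ← map_add]
    exact congrArg e (Prod.ext rfl (zero_add _).symm)
  · change p' (p (e (a.1 + s a.2, e' (a.2, d)))) = d
    rw [p_e, p'_e']

theorem BasedExact.congr {A B C B' C' : BasedModule Λ} {i : A →ₗ[Λ] B} {p : B →ₗ[Λ] C}
    (h : BasedExact Z A B C i p)
    {β : B ≃ₗ[Λ] B'} (hβ : BasedModule.IsSimple Z B B' β) {γ : C ≃ₗ[Λ] C'}
    (hγ : BasedModule.IsSimple Z C C' γ) {i' : A →ₗ[Λ] B'} {p' : B' →ₗ[Λ] C'}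
    (hi : ∀ a, i' a = β (i a)) (hp : ∀ b, p' (β b) = γ (p b)) : BasedExact Z A B' C' i' p' := by
  obtain ⟨e, he, e_left, p_e⟩ := h
  refine ⟨((LinearEquiv.refl Λ A).prodCongr γ.symm).trans (e.trans β),
    ((BasedModule.IsSimple.refl A).prod hγ.symm).trans (he.trans hβ), fun a => ?_, fun a c => ?_⟩
  · change β (e (a, γ.symm 0)) = i' a
    rw [map_zero, e_left, hi]
  · change p' (β (e (a, γ.symm c))) = c
    rw [hp, p_e, γ.apply_symm_apply]

end BasedExact

/-! ### Quadratic forms -/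

section QEpsCalculus

variable {Λ : Type u} [Ring Λ] [StarRing Λ] {M N P : Type u} [AddCommGroup M] [Module Λ M]
  [AddCommGroup N] [Module Λ N] [AddCommGroup P] [Module Λ P] {ε : ℤˣ}

namespace QEps

theorem mk_dualityInvolution (φ : M →ₗ[Λ] SDual Λ M) :
    mk ε (dualityInvolution ε M φ) = mk ε φ :=
  (mk_eq (χ := φ) fun x y => by rw [dualityInvolution_apply]).symm

theorem exists_of_mk_eq {φ φ' : M →ₗ[Λ] SDual Λ M} (h : mk ε φ = mk ε φ') :
    ∃ χ : M →ₗ[Λ] SDual Λ M, ∀ x y, φ' x y - φ x y = χ x y - (ε : ℤ) • star (χ y x) := by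
  have mem_ker : φ' - φ ∈ (QuotientAddGroup.mk'
      (AddMonoidHom.id (M →ₗ[Λ] SDual Λ M) - dualityInvolution ε M).range).ker := by
    change mk ε (φ' - φ) = 0
    rw [map_sub, h, sub_self]
  rw [QuotientAddGroup.ker_mk'] at mem_ker
  obtain ⟨χ, hχ⟩ := mem_ker
  exact ⟨χ, fun x y => congrArg (fun F : M →ₗ[Λ] SDual Λ M => F x y) hχ.symm⟩

/-- The sesquilinear pairing `(x, y) ↦ φ(f x)(g y)`, the polarisation of `f ↦ f*φf`. -/
def cross (φ : N →ₗ[Λ] SDual Λ N) (f : M →ₗ[Λ] N) (g : P →ₗ[Λ] N) : M →ₗ[Λ] SDual Λ P :=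
  (SDual.map g).comp (φ.comp f)

@[simp] theorem cross_apply (φ : N →ₗ[Λ] SDual Λ N) (f : M →ₗ[Λ] N) (g : P →ₗ[Λ] N) (x : M)
    (y : P) : cross φ f g x y = φ (f x) (g y) := rfl

theorem pull_add (f g : M →ₗ[Λ] N) (ψ : QEps (Λ := Λ) ε N) :
    pull (f + g) ψ = pull f ψ + pull g ψ + mk ε (cross (sym ε ψ) f g) := by
  obtain ⟨φ, rfl⟩ := mk_surjective ε ψ
  simp only [pull_mk, ← map_add]
  refine mk_eq (χ := cross φ g f) fun x y => ?_
  simp only [pullHom_apply, LinearMap.add_apply, SDual.add_apply, cross_apply, sym_mk, map_add]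
  abel

theorem pull_inl (ψ : QEps (Λ := Λ) ε M) (ψ' : QEps (Λ := Λ) ε N) :
    pull (LinearMap.inl Λ M N) (prod ψ ψ') = ψ := by
  rw [pull_prod, LinearMap.fst_comp_inl, LinearMap.snd_comp_inl, pull_id, pull_zero, add_zero]

theorem pull_inr (ψ : QEps (Λ := Λ) ε M) (ψ' : QEps (Λ := Λ) ε N) :
    pull (LinearMap.inr Λ M N) (prod ψ ψ') = ψ' := by
  rw [pull_prod, LinearMap.fst_comp_inr, LinearMap.snd_comp_inr, pull_id, pull_zero, zero_add]

theorem neg_prod (ψ : QEps (Λ := Λ) ε M) (ψ' : QEps (Λ := Λ) ε N) :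
    -prod ψ ψ' = prod (-ψ) (-ψ') := by
  rw [prod, prod, map_neg, map_neg, neg_add]

end QEps

end QEpsCalculus

namespace QForm

variable {Λ : Type u} [Ring Λ] [StarRing Λ] {ε : ℤˣ} {Z : AddSubgroup (RedK1 Λ)}

/-- The form `(X, -ψ)`. -/
abbrev neg (v : QForm Λ ε) : QForm Λ ε := ⟨v.X, -v.ψ⟩

theorem Isometric.neg {v w : QForm Λ ε} (h : Isometric Z v w) : Isometric Z v.neg w.neg := by
  obtain ⟨e, he, h⟩ := h
  exact ⟨e, he, by rw [map_neg, h]⟩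

theorem Isometric.of_eq {X : BasedModule Λ} {ψ ψ' : QEps (Λ := Λ) ε X} (h : ψ = ψ') :
    Isometric Z (⟨X, ψ⟩ : QForm Λ ε) ⟨X, ψ'⟩ := h ▸ .refl _

theorem Isometric.neg_prod (v w : QForm Λ ε) :
    Isometric Z (v.prod w).neg (v.neg.prod w.neg) :=
  .of_eq (QEps.neg_prod v.ψ w.ψ)

theorem pull_hyp_congr {K K' : BasedModule Λ} (f : K ≃ₗ[Λ] K') :
    QEps.pull (f.prodCongr (SDual.congr f)).toLinearMap (hyp ε K').ψ = (hyp ε K).ψ := by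
  rw [QEps.pull_mk]
  congr 1
  refine LinearMap.ext fun x => SDual.ext fun y => ?_
  change x.2 (f.symm (f y.1)) = x.2 y.1
  rw [LinearEquiv.symm_apply_apply]

theorem Isometric.hyp_congr (hZ : ∀ z ∈ Z, RedK1.conj z ∈ Z) {K K' : BasedModule Λ}
    {f : K ≃ₗ[Λ] K'} (hf : BasedModule.IsSimple Z K K' f) :
    Isometric Z (hyp ε K) (hyp ε K') :=
  ⟨f.prodCongr (SDual.congr f), hf.prod (hf.dual hZ), pull_hyp_congr f⟩

theorem Isometric.hyp_prod (K K' : BasedModule Λ) :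
    Isometric Z ((hyp ε K).prod (hyp ε K')) (hyp ε (K.prod K')) :=
  ⟨QuasiFormation.hypProd K K', QuasiFormation.hypProd_simple K K',
    QuasiFormation.pull_hypProd K K'⟩

theorem Isometric.hyp_neg (K : BasedModule Λ) : Isometric Z (hyp ε K).neg (hyp ε K) := by
  refine ⟨(LinearEquiv.refl Λ K).prodCongr (BasedModule.signEquiv (-1) _),
    (BasedModule.IsSimple.refl K).prod (BasedModule.IsSimple.sign (-1) K.dual), ?_⟩
  change _ = -QEps.mk ε (hypHom (K : Type u))
  rw [QEps.pull_mk, ← map_neg]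
  congr 1
  refine LinearMap.ext fun x => SDual.ext fun y => ?_
  change ((((-1 : ℤˣ) : ℤ) • x.2 : SDual Λ K)) y.1 = -(x.2 y.1)
  simp

section Isotropic

variable {v : QForm Λ ε} {K W : BasedModule Λ} {i : K →ₗ[Λ] v.X} {k : W →ₗ[Λ] v.X}
  {σ : SDual Λ K →ₗ[Λ] v.X}

/-- The correction `g` moves `K* ⊕ W` along the isotropic summand `K` so as to cancel both `σ*ψσ`
and the pairing of `σ` with `k`. -/
theorem exists_pull_eq_hyp_prod (hi : QEps.pull i v.ψ = 0) (hk : ∀ w, v.restr i (k w) = 0)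
    (hσ : ∀ f, v.restr i (σ f) = f) :
    ∃ g : (SDual Λ K × W) →ₗ[Λ] K, ∀ F : ((K × SDual Λ K) × W) →ₗ[Λ] v.X,
      (∀ x f w, F ((x, f), w) = i (x + g (f, w)) + σ f + k w) →
        QEps.pull F v.ψ = ((hyp ε K).prod ⟨W, QEps.pull k v.ψ⟩).ψ := by
  obtain ⟨κ, hκ⟩ := QEps.mk_surjective ε (QEps.pull σ v.ψ)
  obtain ⟨g, hg⟩ := BasedModule.exists_predual
    (-(QEps.cross κ LinearMap.id (LinearMap.fst Λ (SDual Λ K) W) +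
      QEps.cross v.sym σ (k.comp (LinearMap.snd Λ (SDual Λ K) W))))
  refine ⟨g, fun F hF => ?_⟩
  let b : ((K × SDual Λ K) × W) →ₗ[Λ] SDual Λ K :=
    (LinearMap.snd Λ K (SDual Λ K)).comp (LinearMap.fst Λ _ _)
  let c : ((K × SDual Λ K) × W) →ₗ[Λ] W := LinearMap.snd Λ _ _
  let a : ((K × SDual Λ K) × W) →ₗ[Λ] K :=
    (LinearMap.fst Λ K (SDual Λ K)).comp (LinearMap.fst Λ _ _) + g.comp (b.prod c)
  have F_eq : F = (σ.comp b + k.comp c) + i.comp a := by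
    refine LinearMap.ext fun p => (hF p.1.1 p.1.2 p.2).trans ?_
    rw [add_assoc, add_comm]
    rfl
  change _ = QEps.prod (QEps.mk ε (hypHom (K : Type u))) (QEps.pull k v.ψ)
  rw [F_eq, QEps.pull_add, QEps.pull_add, ← QEps.pull_pull a i, ← QEps.pull_pull b σ,
    ← QEps.pull_pull c k, hi, map_zero, add_zero, ← hκ, QEps.pull_mk, QEps.prod, QEps.pull_mk,
    add_right_comm (QEps.mk ε _), add_right_comm _ (QEps.pull c _), ← map_add, ← map_add]
  congr 2
  refine LinearMap.ext fun p => SDual.ext fun q => ?_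
  change κ p.1.2 q.1.2 + v.sym (σ p.1.2) (k q.2) + v.sym (σ p.1.2 + k p.2) (i (a q)) = p.1.2 q.1.1
  have sym_σ_i : v.sym (σ p.1.2) (i (a q)) = p.1.2 (a q) :=
    congrArg (fun f : SDual Λ K => f (a q)) (hσ p.1.2)
  have sym_k_i : v.sym (k p.2) (i (a q)) = 0 :=
    congrArg (fun f : SDual Λ K => f (a q)) (hk p.2)
  have apply_a : p.1.2 (a q) = p.1.2 q.1.1 - (κ p.1.2 q.1.2 + v.sym (σ p.1.2) (k q.2)) := by
    rw [sub_eq_add_neg]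
    exact (map_add p.1.2 _ _).trans (congrArg _ (hg p.1.2 (q.1.2, q.2)))
  rw [map_add, SDual.add_apply, sym_σ_i, sym_k_i, apply_a]
  abel

theorem Isometric.of_isotropic (hi : QEps.pull i v.ψ = 0) (hk : ∀ w, v.restr i (k w) = 0)
    (hσ : ∀ f, v.restr i (σ f) = f) {T : ((K × SDual Λ K) × W) ≃ₗ[Λ] v.X}
    (hT : BasedModule.IsSimple Z ((K.prod K.dual).prod W) v.X T)
    (hT' : ∀ x f w, T ((x, f), w) = i x + σ f + k w) :
    Isometric Z ((hyp ε K).prod ⟨W, QEps.pull k v.ψ⟩) v := by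
  obtain ⟨g, pull_eq⟩ := exists_pull_eq_hyp_prod hi hk hσ
  have assoc_simple := BasedModule.IsSimple.prodAssoc (Z := Z) K K.dual W
  exact ⟨_, ((assoc_simple.trans (.shear K (K.dual.prod W) g)).trans assoc_simple.symm).trans hT,
    pull_eq _ fun x f w => hT' (x + g (f, w)) f w⟩

end Isotropic

theorem IsSimpleLagrangian.isometric {v : QForm Λ ε} {L : BasedModule Λ} {i : L →ₗ[Λ] v.X}
    (h : v.IsSimpleLagrangian Z L i) : Isometric Z (hyp ε L) v := by
  obtain ⟨⟨-, -, isotropic⟩, e, he, e_left, restr_e⟩ := h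
  have drop_zero := (BasedModule.IsSimple.prodComm (Z := Z) (L.prod L.dual)
    (BasedModule.zero Λ)).trans (.zeroProd _)
  have split := Isometric.of_isotropic (W := BasedModule.zero Λ) (k := 0)
    (σ := e.toLinearMap.comp (LinearMap.inr Λ _ _)) isotropic (fun _ => map_zero _)
    (fun f => restr_e 0 f) (drop_zero.trans he) fun x f w => by
      change e (x, f) = i x + e (0, f) + 0
      rw [add_zero, ← e_left, ← map_add]
      simp
  rw [QEps.pull_zero] at split
  exact ((Isometric.zeroProd _).symm.trans (.prodComm _ _)).trans split

end QForm

variable {Λ : Type u} [Ring Λ] [StarRing Λ] {ε : ℤˣ} {Z : AddSubgroup (RedK1 Λ)}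

/-! ### The homomorphism `b` -/

namespace ZeroStabForms

theorem mk_eq {v w : QForm Λ ε} (h : QForm.Isometric Z v w) : mk Z v = mk Z w :=
  Quotient.sound (.of_isometric h)

theorem mk_prod (v w : QForm Λ ε) : mk Z (v.prod w) = mk Z v + mk Z w := rfl

theorem mk_eq_zero (P : BasedModule Λ) {ψ : QEps (Λ := Λ) ε P} (h : ψ = 0) :
    mk Z (⟨P, ψ⟩ : QForm Λ ε) = 0 := by
  subst h
  exact Quotient.sound ⟨BasedModule.zero Λ, P, .prodComm _ _⟩

theorem mk_prod_zeroForm (v : QForm Λ ε) (P : BasedModule Λ) :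
    mk Z (v.prod (QForm.zeroForm ε P)) = mk Z v := by
  rw [mk_prod, mk_eq_zero P rfl, add_zero]

end ZeroStabForms

namespace QuasiFormation

theorem exists_section (x : QuasiFormation Z ε) :
    ∃ σ : SDual Λ x.V →ₗ[Λ] x.form.X, ∀ f, x.form.restr x.j (σ f) = f := by
  obtain ⟨r, hr⟩ := x.summand
  obtain ⟨e, he, -⟩ := x.simple
  refine ⟨e.symm.toLinearMap.comp (SDual.map r), fun f => SDual.ext fun y => ?_⟩
  rw [QForm.restr_apply]
  change x.form.sym (e.symm (SDual.map r f)) (x.j y) = _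
  rw [← he, LinearEquiv.apply_symm_apply, SDual.map_apply, hr]

theorem exists_isPerp (x : QuasiFormation Z ε) : ∃ W k, x.IsPerp W k :=
  let ⟨_, hσ⟩ := x.exists_section
  BasedExact.exists_of_section (C := x.V.dual) hσ

theorem IsPerp.prod {x y : QuasiFormation Z ε} {W W' : BasedModule Λ} {k : W →ₗ[Λ] x.form.X}
    {k' : W' →ₗ[Λ] y.form.X} (h : x.IsPerp W k) (h' : y.IsPerp W' k') :
    (x.prod y).IsPerp (W.prod W') (k.prodMap k') :=
  BasedExact.congr_right (C' := (x.V.prod y.V).dual) (BasedExact.prod h h')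
    (SDual.prodEquiv x.V y.V).symm (BasedModule.IsSimple.dualProd x.V y.V).symm
    fun p => QForm.prod_restr x.form y.form x.j y.j p

theorem IsPerp.isometric {x y : QuasiFormation Z ε} {W W' : BasedModule Λ}
    {k : W →ₗ[Λ] x.form.X} {k' : W' →ₗ[Λ] y.form.X} (h : x.IsPerp W k) (h' : y.IsPerp W' k')
    {f : x.form.X ≃ₗ[Λ] y.form.X} (hf : BasedModule.IsSimple Z x.form.X y.form.X f)
    (hψ : QEps.pull f.toLinearMap y.form.ψ = x.form.ψ) {g : x.V.dual ≃ₗ[Λ] y.V.dual}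
    (hg : BasedModule.IsSimple Z x.V.dual y.V.dual g)
    (hp : ∀ m, y.form.restr y.j (f m) = g (x.form.restr x.j m)) :
    QForm.Isometric Z (x.formPerp W k) (y.formPerp W' k') := by
  obtain ⟨α, hα, hk⟩ := h.exists_left h' hf hg hp
  refine ⟨α, hα, ?_⟩
  change QEps.pull α.toLinearMap (-QEps.pull k' y.form.ψ) = -QEps.pull k x.form.ψ
  rw [map_neg, QEps.pull_pull, ← hψ, QEps.pull_pull]
  congr 3
  exact LinearMap.ext hk

/-- The pair `([V, θ], [V^⊥, -θ^⊥])` in terms of a chosen `s`-basis of `V^⊥`; by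
`IsPerp.boundaryForms_eq` the choice does not matter. -/
def boundaryForms (x : QuasiFormation Z ε) : ZeroStabForms Z ε × ZeroStabForms Z ε :=
  (ZeroStabForms.mk Z x.formV, ZeroStabForms.mk Z
    (x.formPerp x.exists_isPerp.choose x.exists_isPerp.choose_spec.choose))

theorem IsPerp.boundaryForms_eq {x : QuasiFormation Z ε} {W : BasedModule Λ}
    {k : W →ₗ[Λ] x.form.X} (h : x.IsPerp W k) :
    x.boundaryForms = (ZeroStabForms.mk Z x.formV, ZeroStabForms.mk Z (x.formPerp W k)) :=
  Prod.ext rfl (ZeroStabForms.mk_eq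
    (IsPerp.isometric (x := x) (y := x) x.exists_isPerp.choose_spec.choose_spec h (.refl _)
      (QEps.pull_id _) (.refl _) fun _ => rfl))

theorem boundaryForms_prod (x y : QuasiFormation Z ε) :
    (x.prod y).boundaryForms = x.boundaryForms + y.boundaryForms := by
  obtain ⟨W, k, hx⟩ := x.exists_isPerp
  obtain ⟨W', k', hy⟩ := y.exists_isPerp
  rw [(hx.prod hy).boundaryForms_eq, hx.boundaryForms_eq, hy.boundaryForms_eq]
  refine Prod.ext (ZeroStabForms.mk_eq (.of_eq ?_)) (ZeroStabForms.mk_eq (.of_eq ?_))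
  · exact QEps.pull_prodCongr x.j y.j x.form.ψ y.form.ψ
  · exact (congrArg Neg.neg (QEps.pull_prodCongr k k' x.form.ψ y.form.ψ)).trans
      (QEps.neg_prod _ _)

theorem IsFormation.boundaryForms_eq_zero {x : QuasiFormation Z ε} (h : x.IsFormation) :
    x.boundaryForms = 0 := by
  obtain ⟨W, k, hk⟩ := x.exists_isPerp
  obtain ⟨⟨r, hr⟩, range_eq_perp, isotropic⟩ := h
  rw [hk.boundaryForms_eq]
  refine Prod.ext (ZeroStabForms.mk_eq_zero _ isotropic) (ZeroStabForms.mk_eq_zero _ ?_)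
  have factor : k = x.j.comp (r.comp k) := LinearMap.ext fun w => by
    obtain ⟨v, hv⟩ : k w ∈ LinearMap.range x.j := by
      rw [range_eq_perp, ← hk.range_eq.2]
      exact ⟨w, rfl⟩
    change k w = x.j (r (k w))
    rw [← hv, hr]
  rw [factor, ← QEps.pull_pull, isotropic, map_zero, neg_zero]

theorem ofLagrangian_isFormation (x : QuasiFormation Z ε) (K : BasedModule Λ)
    (k : K →ₗ[Λ] x.form.X) (hk : x.form.IsSimpleLagrangian Z K k) :
    (x.ofLagrangian K k hk).IsFormation := x.lag.1

/-- The isometry `(x, f) ↦ (f, ε x)` from `H_ε(P)` to `H_ε(P*)`. -/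
def flip (ε : ℤˣ) (P : BasedModule Λ) : (P × SDual Λ P) ≃ₗ[Λ] (SDual Λ P × SDual Λ (SDual Λ P)) :=
  (LinearEquiv.prodComm Λ _ _).trans ((LinearEquiv.refl Λ _).prodCongr
    ((BasedModule.evalEquiv P).trans (BasedModule.signEquiv ε _)))

theorem flip_simple (P : BasedModule Λ) :
    BasedModule.IsSimple Z (P.prod P.dual) (P.dual.prod P.dual.dual) (flip ε P) :=
  (BasedModule.IsSimple.prodComm P P.dual).trans ((BasedModule.IsSimple.refl P.dual).prod
    ((BasedModule.IsSimple.eval P).trans (.sign ε P.dual.dual)))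

theorem pull_flip (P : BasedModule Λ) :
    QEps.pull (flip ε P).toLinearMap (QForm.hyp ε P.dual).ψ = (QForm.hyp ε P).ψ := by
  refine Eq.trans ?_ (QEps.mk_dualityInvolution _)
  refine (QEps.pull_mk _ _).trans (congrArg (QEps.mk ε) ?_)
  refine LinearMap.ext fun x => SDual.ext fun y => ?_
  change ((ε : ℤ) • SDual.eval P x.1 : SDual Λ (SDual Λ P)) y.2 = (ε : ℤ) • star (y.2 x.1)
  rw [SDual.zsmul_apply, SDual.eval_apply]

theorem restr_inr_hyp (P : BasedModule Λ) (p : P × SDual Λ P) :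
    (QForm.hyp ε P).restr (LinearMap.inr Λ P (SDual Λ P)) p = (flip ε P p).2 :=
  SDual.ext fun g => by
    rw [QForm.restr_apply, QForm.hyp_sym]
    change p.2 0 + (ε : ℤ) • star (g p.1) = ((ε : ℤ) • SDual.eval P p.1) g
    rw [map_zero, zero_add, SDual.zsmul_apply, SDual.eval_apply]

theorem dual_lagrangian (P : BasedModule Λ) :
    (QForm.hyp ε P).IsSimpleLagrangian Z P.dual (LinearMap.inr Λ P (SDual Λ P)) := by
  have flip_inr (f : SDual Λ P) : flip ε P (0, f) = (f, 0) :=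
    Prod.ext rfl (map_zero ((BasedModule.evalEquiv P).trans (BasedModule.signEquiv ε _)))
  refine ⟨⟨⟨LinearMap.snd Λ P (SDual Λ P), fun _ => rfl⟩, Submodule.ext fun p => ?_, ?_⟩,
    ⟨(flip ε P).symm, (flip_simple P).symm, fun a => ?_, fun a c => ?_⟩⟩
  · rw [QForm.perp, LinearMap.mem_ker, restr_inr_hyp]
    constructor
    · rintro ⟨f, rfl⟩
      exact congrArg Prod.snd (flip_inr f)
    · exact fun h => ⟨p.2, (flip ε P).injective ((flip_inr p.2).trans (Prod.ext rfl h.symm))⟩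
  · refine (QEps.pull_mk _ _).trans ((congrArg (QEps.mk ε) ?_).trans (map_zero _))
    exact LinearMap.ext fun f => SDual.ext fun _ => map_zero f
  · exact (LinearEquiv.symm_apply_eq _).2 (flip_inr a).symm
  · rw [restr_inr_hyp]
    exact congrArg Prod.snd ((flip ε P).apply_symm_apply (a, c))

theorem trivial_isFormation (P : BasedModule Λ) : (trivial Z ε P).IsFormation :=
  (dual_lagrangian (Z := Z) P).1

theorem boundaryForms_replaceLagrangian (x : QuasiFormation Z ε) (K : BasedModule Λ)
    (k : K →ₗ[Λ] x.form.X) (hk : x.form.IsSimpleLagrangian Z K k) :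
    (x.replaceLagrangian K k hk).boundaryForms = x.boundaryForms := rfl

theorem Iso.boundaryForms_eq (hZ : ∀ z ∈ Z, RedK1.conj z ∈ Z) {x y : QuasiFormation Z ε}
    (h : x.Iso y) : x.boundaryForms = y.boundaryForms := by
  obtain ⟨f, hf, hψ, -, h, hh, hj⟩ := h
  obtain ⟨W, k, hx⟩ := x.exists_isPerp
  obtain ⟨W', k', hy⟩ := y.exists_isPerp
  have formV_isometric : QForm.Isometric Z x.formV y.formV := by
    refine ⟨h, hh, ?_⟩
    change QEps.pull h.toLinearMap (QEps.pull y.j y.form.ψ) = QEps.pull x.j x.form.ψ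
    rw [QEps.pull_pull, ← hψ, QEps.pull_pull]
    congr 2
    exact LinearMap.ext fun a => (hj a).symm
  have restr_f (m : x.form.X) :
      y.form.restr y.j (f m) = SDual.congr h (x.form.restr x.j m) := SDual.ext fun v => by
    obtain ⟨v, rfl⟩ := h.surjective v
    rw [QForm.restr_apply, ← hj]
    change _ = x.form.restr x.j m (h.symm (h v))
    rw [LinearEquiv.symm_apply_apply, QForm.restr_apply]
    change QEps.sym ε y.form.ψ (f m) (f (x.j v)) = QEps.sym ε x.form.ψ m (x.j v)
    rw [← hψ, QEps.sym_pull]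
    rfl
  rw [hx.boundaryForms_eq, hy.boundaryForms_eq]
  exact Prod.ext (ZeroStabForms.mk_eq formV_isometric)
    (ZeroStabForms.mk_eq (hx.isometric hy hf hψ (hh.dual hZ) restr_f))

theorem Rel.boundaryForms_eq (hZ : ∀ z ∈ Z, RedK1.conj z ∈ Z) {x y : QuasiFormation Z ε}
    (h : Rel x y) : x.boundaryForms = y.boundaryForms := by
  induction h with
  | iso h => exact h.boundaryForms_eq hZ
  | stab x P =>
    rw [boundaryForms_prod, (trivial_isFormation P).boundaryForms_eq_zero, add_zero]
  | shift x K k hk =>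
    rw [boundaryForms_prod, (ofLagrangian_isFormation x K k hk).boundaryForms_eq_zero, zero_add,
      boundaryForms_replaceLagrangian]
  | add _ _ h h' => rw [boundaryForms_prod, boundaryForms_prod, h, h']
  | symm _ h => exact h.symm
  | trans _ _ h h' => exact h.trans h'

end QuasiFormation

/-- The homomorphism `b : [M, ψ; L, V] ↦ ([V, θ], [V^⊥, -θ^⊥])`. -/
def LMonoid.boundaryHom (hZ : ∀ z ∈ Z, RedK1.conj z ∈ Z) :
    LMonoid Z ε →+ ZeroStabForms Z ε × ZeroStabForms Z ε where
  toFun := Quotient.lift QuasiFormation.boundaryForms fun _ _ h =>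
    QuasiFormation.Rel.boundaryForms_eq hZ h
  map_zero' := (QuasiFormation.trivial_isFormation _).boundaryForms_eq_zero
  map_add' := by
    rintro ⟨x⟩ ⟨y⟩
    exact QuasiFormation.boundaryForms_prod x y

theorem LMonoid.boundaryHom_mk (hZ : ∀ z ∈ Z, RedK1.conj z ∈ Z) (x : QuasiFormation Z ε) :
    boundaryHom hZ (mk x) = x.boundaryForms := rfl

/-! ### The image of `b` -/

theorem ZeroStabForms.mk_hyp_add_free (hZ : ∀ z ∈ Z, RedK1.conj z ∈ Z) (K : BasedModule Λ)
    (k : ℕ) :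
    mk Z (QForm.hyp ε K) + mk Z (QForm.hyp ε (BasedModule.free Λ (K.m + k))) =
      mk Z (QForm.hyp ε (BasedModule.free Λ (K.n + k))) := by
  obtain ⟨f, hf⟩ := BasedModule.exists_prod_free_simple (Z := Z) K k
  rw [← mk_prod]
  exact mk_eq ((QForm.Isometric.hyp_prod _ _).trans (.hyp_congr hZ hf))

namespace QForm

theorem restr_prod_left (v w : QForm Λ ε) {K : BasedModule Λ} (i : K →ₗ[Λ] v.X)
    (j : K →ₗ[Λ] w.X) (m : v.X) : (v.prod w).restr (i.prod j) (m, 0) = v.restr i m :=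
  SDual.ext fun y => by
    refine (prod_sym v w (m, 0) (i y, j y)).trans ?_
    change v.sym m (i y) + w.sym 0 (j y) = v.sym m (i y)
    rw [map_zero, SDual.zero_apply, add_zero]

/-- The graph of `j` is isotropic in `v ⊕ (V, -θ)`, where `θ` is the restriction of the form, and
its annihilator is the direct sum of the graph and `W`. -/
theorem Isometric.of_basedExact {v : QForm Λ ε} {V W : BasedModule Λ} {j : V →ₗ[Λ] v.X}
    {k : W →ₗ[Λ] v.X} (h : BasedExact Z W v.X V.dual k (v.restr j)) :
    Isometric Z ((hyp ε V).prod ⟨W, QEps.pull k v.ψ⟩) (v.prod ⟨V, -QEps.pull j v.ψ⟩) := by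
  have restr_k := h.apply_apply_eq_zero
  obtain ⟨e, he, e_left, restr_e⟩ := h
  let w : QForm Λ ε := ⟨V, -QEps.pull j v.ψ⟩
  let graph : V →ₗ[Λ] (v.X × V) := j.prod LinearMap.id
  let inl : v.X →ₗ[Λ] (v.X × V) := LinearMap.inl Λ v.X V
  have isotropic : QEps.pull graph (v.prod w).ψ = 0 := by
    refine (QEps.pull_prod graph v.ψ w.ψ).trans ?_
    change QEps.pull j v.ψ + QEps.pull LinearMap.id (-QEps.pull j v.ψ) = 0
    rw [QEps.pull_id, add_neg_cancel]
  have restr_inl (m) : (v.prod w).restr graph (inl m) = v.restr j m :=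
    restr_prod_left v w j LinearMap.id m
  have pull_k : QEps.pull (inl.comp k) (v.prod w).ψ = QEps.pull k v.ψ := by
    rw [← QEps.pull_pull]
    exact congrArg (QEps.pull k) (QEps.pull_inl v.ψ w.ψ)
  let T : ((V × SDual Λ V) × W) ≃ₗ[Λ] (v.X × V) :=
    ((LinearEquiv.prodAssoc Λ V (SDual Λ V) W).trans (.prodComm Λ _ _)).trans
      ((((LinearEquiv.prodComm Λ _ _).trans e).prodCongr (.refl Λ V)).trans (shear j))
  have hT : BasedModule.IsSimple Z ((V.prod V.dual).prod W) (v.X.prod V) T :=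
    ((BasedModule.IsSimple.prodAssoc V V.dual W).trans (.prodComm _ _)).trans
      ((((BasedModule.IsSimple.prodComm V.dual W).trans he).prod (.refl V)).trans
        (.shear v.X V j))
  have e_eq (c f) : e (c, f) = k c + e (0, f) := by
    rw [← e_left, ← map_add]
    simp
  have split := of_isotropic (v := v.prod w) (k := inl.comp k)
    (σ := inl.comp (e.toLinearMap.comp (LinearMap.inr Λ W V.dual))) isotropic
    (fun c => (restr_inl _).trans (restr_k c)) (fun f => (restr_inl _).trans (restr_e 0 f)) hT
    fun y f c => by
      change (e (c, f) + j y, y) = ((j y + e (0, f)) + k c, y + 0 + 0)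
      rw [e_eq, add_zero, add_zero]
      congr 1
      abel
  rwa [pull_k] at split

end QForm

namespace QuasiFormation

theorem IsPerp.isometric_prod {x : QuasiFormation Z ε} {W : BasedModule Λ}
    {k : W →ₗ[Λ] x.form.X} (h : x.IsPerp W k) :
    QForm.Isometric Z ((QForm.hyp ε x.V).prod (x.formPerp W k))
      ((QForm.hyp ε x.L).prod x.formV) := by
  have neg_form : QForm.Isometric Z x.form.neg (QForm.hyp ε x.L) :=
    x.lag.isometric.symm.neg.trans (.hyp_neg _)
  have neg_neg_formV : QForm.Isometric Z x.formV.neg.neg x.formV := .of_eq (neg_neg _)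
  have split : QForm.Isometric Z ((QForm.hyp ε x.V).prod ⟨W, QEps.pull k x.form.ψ⟩)
      (x.form.prod x.formV.neg) := .of_basedExact h
  have neg_split := ((QForm.Isometric.neg_prod _ _).symm.trans split.neg).trans (.neg_prod _ _)
  exact ((QForm.Isometric.hyp_neg x.V).symm.prod (.refl _)).trans
    (neg_split.trans (neg_form.prod neg_neg_formV))

theorem exists_boundaryForms_add_eq (hZ : ∀ z ∈ Z, RedK1.conj z ∈ Z) (x : QuasiFormation Z ε) :
    ∃ r : ℕ, x.boundaryForms.1 + ZeroStabForms.mk Z (QForm.hyp ε (BasedModule.free Λ r)) =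
      x.boundaryForms.2 + ZeroStabForms.mk Z (QForm.hyp ε (BasedModule.free Λ r)) := by
  obtain ⟨W, k, h⟩ := x.exists_isPerp
  have rank_eq : x.L.n + x.V.m = x.V.n + x.L.m := by
    have rank_L := x.lag.rank_eq
    have rank_V := x.half
    simp only [BasedModule.rank] at rank_L rank_V
    omega
  have hyp_V := ZeroStabForms.mk_hyp_add_free (ε := ε) hZ x.V x.L.m
  have hyp_L := ZeroStabForms.mk_hyp_add_free (ε := ε) hZ x.L x.V.m
  rw [add_comm x.L.m, rank_eq] at hyp_L
  have split := ZeroStabForms.mk_eq h.isometric_prod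
  rw [ZeroStabForms.mk_prod, ZeroStabForms.mk_prod] at split
  rw [h.boundaryForms_eq]
  refine ⟨x.V.n + x.L.m, ?_⟩
  dsimp only
  nth_rewrite 1 [← hyp_L]
  rw [← hyp_V, ← add_assoc, add_comm (ZeroStabForms.mk Z x.formV), ← split]
  abel

theorem boundary_isPerp (K : BasedModule Λ) (ρ : K →ₗ[Λ] SDual Λ K) :
    (boundary Z ε K ρ).IsPerp K (LinearMap.prod LinearMap.id (-dualityInvolution ε K ρ)) := by
  let g : K →ₗ[Λ] K.dual := -dualityInvolution ε K ρ
  refine ⟨((LinearEquiv.prodComm Λ K K.dual).trans (shear g)).trans (.prodComm Λ K.dual K),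
    ((BasedModule.IsSimple.prodComm K K.dual).trans (.shear K.dual K g)).trans
      (.prodComm K.dual K),
    fun a => Prod.ext rfl (zero_add _), fun a (c : SDual Λ K) => SDual.ext fun (y : K) => ?_⟩
  change c y + -((ε : ℤ) • star (ρ y a)) + (ε : ℤ) • star (ρ y a) = c y
  exact neg_add_cancel_right _ _

theorem pull_graph_hyp (K : BasedModule Λ) (ρ : K →ₗ[Λ] SDual Λ K) :
    QEps.pull (LinearMap.prod LinearMap.id ρ) (QForm.hyp ε K).ψ = QEps.mk ε ρ :=
  QEps.pull_mk _ _

theorem boundaryForms_boundary (K : BasedModule Λ) (ρ : K →ₗ[Λ] SDual Λ K) :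
    (boundary Z ε K ρ).boundaryForms =
      (ZeroStabForms.mk Z ⟨K, QEps.mk ε ρ⟩, ZeroStabForms.mk Z ⟨K, QEps.mk ε ρ⟩) := by
  rw [(boundary_isPerp K ρ).boundaryForms_eq]
  refine Prod.ext rfl (ZeroStabForms.mk_eq (.of_eq ?_))
  change -QEps.pull (LinearMap.prod LinearMap.id (-dualityInvolution ε K ρ))
    (QForm.hyp ε K).ψ = QEps.mk ε ρ
  rw [pull_graph_hyp, map_neg, neg_neg, QEps.mk_dualityInvolution]

end QuasiFormation

theorem QEps.pull_coprod {M N P : Type u} [AddCommGroup M] [Module Λ M] [AddCommGroup N]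
    [Module Λ N] [AddCommGroup P] [Module Λ P] {f : M →ₗ[Λ] P} {g : N →ₗ[Λ] P}
    {ψ : QEps (Λ := Λ) ε P} (h : ∀ x y, sym ε ψ (f x) (g y) = 0) :
    pull (f.coprod g) ψ = prod (pull f ψ) (pull g ψ) := by
  have cross_eq_zero : cross (sym ε ψ) (f.comp (LinearMap.fst Λ M N))
      (g.comp (LinearMap.snd Λ M N)) = 0 :=
    LinearMap.ext fun p => SDual.ext fun q => h p.1 q.2
  rw [LinearMap.coprod, pull_add, cross_eq_zero, map_zero, add_zero, prod, pull_pull, pull_pull]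

theorem QForm.IsSimpleLagrangian.exact_map_prod {w : QForm Λ ε} {L : BasedModule Λ}
    {i : L →ₗ[Λ] w.X} (h : w.IsSimpleLagrangian Z L i) (hw : w.IsSimple Z) (v : QForm Λ ε) :
    BasedExact Z L (v.X.prod w.X).dual (v.X.prod L).dual
      ((v.prod w).sym.comp ((LinearMap.inr Λ v.X w.X).comp i))
      (SDual.map ((LinearMap.id : v.X →ₗ[Λ] v.X).prodMap i)) := by
  obtain ⟨g, hg, g_simple⟩ := hw
  have exact_prod : BasedExact Z L (w.X.prod v.X.dual) (L.dual.prod v.X.dual)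
      ((LinearMap.inl Λ w.X (SDual Λ v.X)).comp i)
      ((w.restr i).prodMap (LinearEquiv.refl Λ (SDual Λ v.X)).toLinearMap) :=
    h.2.prod_equiv (.refl v.X.dual)
  let β : (w.X × SDual Λ v.X) ≃ₗ[Λ] SDual Λ (v.X × w.X) :=
    ((LinearEquiv.prodComm Λ _ _).trans ((LinearEquiv.refl Λ _).prodCongr g)).trans
      (SDual.prodEquiv v.X w.X).symm
  have hβ : BasedModule.IsSimple Z (w.X.prod v.X.dual) (v.X.prod w.X).dual β :=
    ((BasedModule.IsSimple.prodComm w.X v.X.dual).trans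
      ((BasedModule.IsSimple.refl v.X.dual).prod g_simple)).trans
        (BasedModule.IsSimple.dualProd v.X w.X).symm
  let γ : (SDual Λ L × SDual Λ v.X) ≃ₗ[Λ] SDual Λ (v.X × L) :=
    (LinearEquiv.prodComm Λ _ _).trans (SDual.prodEquiv v.X L).symm
  have hγ : BasedModule.IsSimple Z (L.dual.prod v.X.dual) (v.X.prod L).dual γ :=
    (BasedModule.IsSimple.prodComm L.dual v.X.dual).trans
      (BasedModule.IsSimple.dualProd v.X L).symm
  refine exact_prod.congr (B' := (v.X.prod w.X).dual) (C' := (v.X.prod L).dual) hβ hγ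
    (fun a => SDual.ext fun z => (QForm.prod_sym v w (0, i a) z).trans ?_)
    (fun p => SDual.ext fun z => ?_)
  · change v.sym 0 z.1 + w.sym (i a) z.2 = (0 : SDual Λ v.X) z.1 + g (i a) z.2
    rw [hg, map_zero]
  · change p.2 z.1 + g p.1 (i z.2) = p.2 z.1 + w.sym p.1 (i z.2)
    rw [hg]

namespace QuasiFormation

section Graph

variable {v w : QForm Λ ε} {K R X : BasedModule Λ} (ρ : K →ₗ[Λ] SDual Λ K)

/-- The embedding `X ≅ K ⊕ w → H_ε(K) ⊕ w` given by `A` and the graph of `ρ`. -/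
def graphEmbedding (A : X ≃ₗ[Λ] (K × w.X)) : X →ₗ[Λ] ((K × SDual Λ K) × w.X) :=
  ((LinearMap.prod LinearMap.id ρ).prodMap LinearMap.id).comp A.toLinearMap

theorem pull_graphEmbedding (A : X ≃ₗ[Λ] (K × w.X)) :
    QEps.pull (graphEmbedding ρ A) ((QForm.hyp ε K).prod w).ψ =
      QEps.pull A.toLinearMap (QEps.prod (QEps.mk ε ρ) w.ψ) := by
  rw [graphEmbedding, ← QEps.pull_pull]
  refine congrArg (QEps.pull A.toLinearMap) ((QEps.pull_prodCongr _ _ _ _).trans ?_)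
  exact congrArg₂ QEps.prod (pull_graph_hyp K ρ) (QEps.pull_id _)

theorem exact_graphEmbedding (hZ : ∀ z ∈ Z, RedK1.conj z ∈ Z) (hw : w.IsSimple Z)
    {A : X ≃ₗ[Λ] (K × w.X)} (hA : BasedModule.IsSimple Z X (K.prod w.X) A) :
    BasedExact Z K ((K.prod K.dual).prod w.X) X.dual
      ((LinearMap.inl Λ (K × SDual Λ K) w.X).comp
        (LinearMap.prod LinearMap.id (-dualityInvolution ε K ρ)))
      (((QForm.hyp ε K).prod w).restr (graphEmbedding ρ A)) := by
  obtain ⟨g, hg, g_simple⟩ := hw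
  have exact_graph : BasedExact Z K (K.prod K.dual) K.dual
    (LinearMap.prod LinearMap.id (-dualityInvolution ε K ρ))
    ((QForm.hyp ε K).restr (LinearMap.prod LinearMap.id ρ)) := boundary_isPerp K ρ
  have exact_prod : BasedExact Z K ((K.prod K.dual).prod w.X) (K.dual.prod w.X.dual) _ _ :=
    exact_graph.prod_equiv g_simple
  refine exact_prod.congr_right (C' := X.dual)
    ((SDual.prodEquiv K w.X).symm.trans (SDual.congr A.symm))
    ((BasedModule.IsSimple.dualProd K w.X).symm.trans (hA.symm.dual hZ)) fun m =>
      SDual.ext fun z => (QForm.prod_sym (QForm.hyp ε K) w m _).trans ?_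
  change _ = (QForm.hyp ε K).restr (LinearMap.prod LinearMap.id ρ) m.1 (A z).1 + g m.2 (A z).2
  rw [hg]
  rfl

variable (hw : w.IsSimple Z) {i : R →ₗ[Λ] w.X} (hR : w.IsSimpleLagrangian Z R i)
  {A : (v.X × w.X) ≃ₗ[Λ] (K × w.X)} (hA : BasedModule.IsSimple Z (v.X.prod w.X) (K.prod w.X) A)

/-- The quasi-formation `(H_ε(K) ⊕ w; K ⊕ R, V)`, where `R` is a Lagrangian of `w` and `V` is the
image of `v ⊕ R` under `graphEmbedding`. -/
def ofStableIsometry : QuasiFormation Z ε where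
  form := (QForm.hyp ε K).prod w
  simple := (QForm.hyp_simple K).prod hw
  L := K.prod R
  i := (LinearMap.inl Λ K (SDual Λ K)).prodMap i
  lag := (QForm.hyp_lagrangian K).prod hR
  V := v.X.prod R
  j := (graphEmbedding (X := v.X.prod w.X) ρ A).comp (LinearMap.id.prodMap i)
  summand := by
    obtain ⟨r, hr⟩ := hR.1.1
    refine ⟨(LinearMap.id.prodMap r).comp
      (A.symm.toLinearMap.comp ((LinearMap.fst Λ _ _).prodMap LinearMap.id)), fun a => ?_⟩
    change ((A.symm (A (a.1, i a.2))).1, r (A.symm (A (a.1, i a.2))).2) = a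
    rw [A.symm_apply_apply, hr]
  half := by
    have rank_A := hA.rank_eq
    have rank_R := hR.rank_eq
    simp only [BasedModule.rank_prod, BasedModule.rank_dual] at rank_A ⊢
    linarith

theorem ofStableIsometry_isPerp (hZ : ∀ z ∈ Z, RedK1.conj z ∈ Z)
    (hψ : QEps.pull A.toLinearMap (QEps.prod (QEps.mk ε ρ) w.ψ) = (v.prod w).ψ) :
    (ofStableIsometry ρ hw hR hA).IsPerp (K.prod R)
      (((LinearMap.inl Λ (K × SDual Λ K) w.X).comp
        (LinearMap.prod LinearMap.id (-dualityInvolution ε K ρ))).coprod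
          ((graphEmbedding (X := v.X.prod w.X) ρ A).comp ((LinearMap.inr Λ v.X w.X).comp i))) := by
  refine (exact_graphEmbedding (X := v.X.prod w.X) ρ hZ hw hA).comp (hR.exact_map_prod hw v) _
    fun a => SDual.ext fun z => ?_
  refine (QEps.sym_pull (graphEmbedding (X := v.X.prod w.X) ρ A) _ (0, i a) z).symm.trans ?_
  rw [pull_graphEmbedding, hψ]
  rfl

theorem boundaryForms_ofStableIsometry (hZ : ∀ z ∈ Z, RedK1.conj z ∈ Z)
    (hψ : QEps.pull A.toLinearMap (QEps.prod (QEps.mk ε ρ) w.ψ) = (v.prod w).ψ) :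
    (ofStableIsometry ρ hw hR hA).boundaryForms =
      (ZeroStabForms.mk Z v, ZeroStabForms.mk Z ⟨K, QEps.mk ε ρ⟩) := by
  let F : (v.X × w.X) →ₗ[Λ] ((K × SDual Λ K) × w.X) := graphEmbedding (X := v.X.prod w.X) ρ A
  have pull_F : QEps.pull F ((QForm.hyp ε K).prod w).ψ = (v.prod w).ψ :=
    (pull_graphEmbedding (X := v.X.prod w.X) ρ A).trans hψ
  let k : K →ₗ[Λ] ((K × SDual Λ K) × w.X) := (LinearMap.inl Λ (K × SDual Λ K) w.X).comp
    (LinearMap.prod LinearMap.id (-dualityInvolution ε K ρ))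
  have pull_k : QEps.pull k ((QForm.hyp ε K).prod w).ψ = -QEps.mk ε ρ := by
    rw [← QEps.pull_pull]
    refine (congrArg _ (QEps.pull_inl _ _)).trans ((pull_graph_hyp K _).trans ?_)
    rw [map_neg, QEps.mk_dualityInvolution]
  let l : R →ₗ[Λ] ((K × SDual Λ K) × w.X) := F.comp ((LinearMap.inr Λ v.X w.X).comp i)
  have pull_l : QEps.pull l ((QForm.hyp ε K).prod w).ψ = 0 := by
    rw [← QEps.pull_pull, pull_F, ← QEps.pull_pull]
    exact (congrArg _ (QEps.pull_inr _ _)).trans hR.1.2.2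
  have orthogonal (x y) : ((QForm.hyp ε K).prod w).sym (k x) (l y) = 0 :=
    congrArg (fun f : SDual Λ (v.X × w.X) => f (0, i y))
      ((exact_graphEmbedding (X := v.X.prod w.X) ρ hZ hw hA).apply_apply_eq_zero x)
  rw [(ofStableIsometry_isPerp ρ hw hR hA hZ hψ).boundaryForms_eq,
    ← ZeroStabForms.mk_prod_zeroForm v R, ← ZeroStabForms.mk_prod_zeroForm ⟨K, QEps.mk ε ρ⟩ R]
  refine Prod.ext (ZeroStabForms.mk_eq (.of_eq ?_)) (ZeroStabForms.mk_eq (.of_eq ?_))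
  · change QEps.pull (F.comp (LinearMap.id.prodMap i)) ((QForm.hyp ε K).prod w).ψ =
      QEps.prod v.ψ 0
    rw [← QEps.pull_pull, pull_F]
    exact (QEps.pull_prodCongr _ _ _ _).trans
      (congrArg₂ QEps.prod (QEps.pull_id _) hR.1.2.2)
  · change -QEps.pull (k.coprod l) ((QForm.hyp ε K).prod w).ψ = QEps.prod (QEps.mk ε ρ) 0
    rw [QEps.pull_coprod orthogonal, pull_k, pull_l, QEps.neg_prod, neg_neg, neg_zero]

end Graph

theorem exists_boundaryForms_eq (hZ : ∀ z ∈ Z, RedK1.conj z ∈ Z) {v v' : QForm Λ ε}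
    {R : BasedModule Λ}
    (h : QForm.Isometric Z (v.prod (QForm.hyp ε R)) (v'.prod (QForm.hyp ε R))) :
    ∃ x : QuasiFormation Z ε, x.boundaryForms = (ZeroStabForms.mk Z v, ZeroStabForms.mk Z v') := by
  obtain ⟨K, ψ⟩ := v'
  obtain ⟨ρ, rfl⟩ := QEps.mk_surjective ε ψ
  obtain ⟨A, hA, hψ⟩ := h
  exact ⟨_, boundaryForms_ofStableIsometry ρ (QForm.hyp_simple R) (QForm.hyp_lagrangian R) hA hZ
    hψ⟩

end QuasiFormation

theorem LMonoid.range_boundaryHom (hZ : ∀ z ∈ Z, RedK1.conj z ∈ Z) :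
    Set.range (boundaryHom (ε := ε) hZ) = {p | ∃ r : ℕ,
      p.1 + ZeroStabForms.mk Z (QForm.hyp _ (BasedModule.free Λ r)) =
        p.2 + ZeroStabForms.mk Z (QForm.hyp _ (BasedModule.free Λ r))} := by
  refine Set.Subset.antisymm ?_ ?_
  · rintro _ ⟨⟨x⟩, rfl⟩
    exact x.exists_boundaryForms_add_eq hZ
  · rintro ⟨⟨v⟩, ⟨v'⟩⟩ ⟨r, h⟩
    obtain ⟨P, P', h⟩ := Quotient.exact h
    let H := QForm.hyp ε (BasedModule.free Λ r)
    have swap (w : QForm Λ ε) (Q : BasedModule Λ) : QForm.Isometric Z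
        ((w.prod (QForm.zeroForm ε Q)).prod H) ((w.prod H).prod (QForm.zeroForm ε Q)) :=
      (QForm.Isometric.prodAssoc _ _ _).trans
        ((QForm.Isometric.prod (.refl w) (.prodComm _ _)).trans
          (QForm.Isometric.prodAssoc _ _ _).symm)
    obtain ⟨x, hx⟩ := QuasiFormation.exists_boundaryForms_eq hZ
      (((swap v P).trans h).trans (swap v' P').symm)
    rw [ZeroStabForms.mk_prod_zeroForm, ZeroStabForms.mk_prod_zeroForm] at hx
    exact ⟨mk x, hx⟩

/-! ### Elementary elements and the zero fibre -/

theorem ZeroStabForms.form_eq_zero {v : QForm Λ ε} (h : mk Z v = 0) : v.ψ = 0 := by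
  obtain ⟨P, Q, e, -, he⟩ := Quotient.exact h
  have prod_eq_zero : QEps.prod v.ψ (0 : QEps (Λ := Λ) ε P) = 0 :=
    he.symm.trans ((congrArg (QEps.pull e.toLinearMap) QEps.prod_zero_zero).trans (map_zero _))
  rw [← QEps.pull_inl v.ψ (0 : QEps (Λ := Λ) ε P), prod_eq_zero, map_zero]

namespace QForm

theorem sym_eq_zero_of_pull_eq_zero {v : QForm Λ ε} {V : Type u} [AddCommGroup V] [Module Λ V]
    {j : V →ₗ[Λ] v.X} (h : QEps.pull j v.ψ = 0) (a b : V) : v.sym (j a) (j b) = 0 := by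
  refine (QEps.sym_pull j v.ψ a b).symm.trans ?_
  rw [h, map_zero]
  rfl

/-- Every functional vanishing on `V` has the form `φ(n)` with `n ∈ V^⊥`, so it also vanishes on
`m`; apply this to the functionals that factor through the projection with kernel `V`. -/
theorem IsSimple.mem_range_of_orthogonal_perp {v : QForm Λ ε} (hv : v.IsSimple Z)
    {V : BasedModule Λ} {j : V →ₗ[Λ] v.X} (hj : IsSummand j) {m : v.X}
    (hm : ∀ n ∈ v.perp j, v.sym n m = 0) : m ∈ LinearMap.range j := by
  obtain ⟨e, he, -⟩ := hv
  obtain ⟨r, hr⟩ := hj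
  let π : v.X →ₗ[Λ] v.X := LinearMap.id - j.comp r
  have π_j (y : V) : π (j y) = 0 := by
    change j y - j (r (j y)) = 0
    rw [hr, sub_self]
  have functional_π (g : SDual Λ v.X) : g (π m) = 0 := by
    have mem_perp : e.symm (SDual.map π g) ∈ v.perp j := by
      refine LinearMap.mem_ker.2 (SDual.ext fun y => ?_)
      rw [restr_apply, ← he, e.apply_symm_apply, SDual.map_apply, π_j, map_zero, SDual.zero_apply]
    have orthogonal := hm _ mem_perp
    rwa [← he, e.apply_symm_apply, SDual.map_apply] at orthogonal
  have π_m : π m = 0 := (BasedModule.evalEquiv v.X).injective (SDual.ext fun g => by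
    rw [BasedModule.evalEquiv_apply, functional_π, map_zero, SDual.zero_apply, star_zero])
  exact ⟨r m, (sub_eq_zero.1 π_m).symm⟩

end QForm

namespace QuasiFormation

theorem isFormation_of_boundaryForms_eq_zero {x : QuasiFormation Z ε}
    (h : x.boundaryForms = 0) : x.IsFormation := by
  obtain ⟨W, k, hk⟩ := x.exists_isPerp
  rw [hk.boundaryForms_eq] at h
  have pull_j : QEps.pull x.j x.form.ψ = 0 := ZeroStabForms.form_eq_zero (congrArg Prod.fst h)
  have pull_k : QEps.pull k x.form.ψ = 0 :=
    neg_eq_zero.1 (ZeroStabForms.form_eq_zero (congrArg Prod.snd h))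
  refine ⟨x.summand, le_antisymm ?_ fun m hm => ?_, pull_j⟩
  · rintro _ ⟨a, rfl⟩
    exact LinearMap.mem_ker.2 (SDual.ext (QForm.sym_eq_zero_of_pull_eq_zero pull_j a))
  · refine x.simple.mem_range_of_orthogonal_perp x.summand fun n hn => ?_
    rw [← hk.range_eq.2] at hm hn
    obtain ⟨w, rfl⟩ := hm
    obtain ⟨w', rfl⟩ := hn
    exact QForm.sym_eq_zero_of_pull_eq_zero pull_k w' w

/-- The quasi-formation `(H_ε(P); P*, graph(ρ))`; unlike that of `δ(P, ρ)`, its isomorphism type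
visibly depends only on the class of `ρ` in `Q_ε(P)`. -/
def dualBoundary (Z : AddSubgroup (RedK1 Λ)) (ε : ℤˣ) (P : BasedModule Λ)
    (ρ : P →ₗ[Λ] SDual Λ P) : QuasiFormation Z ε :=
  (boundary Z ε P ρ).replaceLagrangian P.dual (LinearMap.inr Λ P (SDual Λ P)) (dual_lagrangian P)

theorem Iso.flip (P : BasedModule Λ) : (dualBoundary Z ε P 0).Iso (trivial Z ε P.dual) :=
  ⟨QuasiFormation.flip ε P, flip_simple P, pull_flip P,
    ⟨LinearEquiv.refl Λ _, .refl _, fun _ => Prod.ext rfl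
      (map_zero ((BasedModule.evalEquiv P).trans (BasedModule.signEquiv ε _)))⟩,
    ⟨(BasedModule.evalEquiv P).trans (BasedModule.signEquiv ε _),
      (BasedModule.IsSimple.eval P).trans (.sign ε P.dual.dual), fun _ => rfl⟩⟩

/-- The isometry `(x, f) ↦ (x, f + (ρ' - ρ)x)` fixes `P*` and carries one graph to the other. -/
theorem Iso.dualBoundary {P : BasedModule Λ} {ρ ρ' : P →ₗ[Λ] SDual Λ P}
    (h : QEps.mk ε ρ = QEps.mk ε ρ') :
    (dualBoundary Z ε P ρ).Iso (dualBoundary Z ε P ρ') := by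
  obtain ⟨χ, hχ⟩ := QEps.exists_of_mk_eq h
  let g : P →ₗ[Λ] P.dual := ρ' - ρ
  refine ⟨((LinearEquiv.prodComm Λ P P.dual).trans (shear g)).trans (.prodComm Λ P.dual P),
    ((BasedModule.IsSimple.prodComm P P.dual).trans (.shear P.dual P g)).trans
      (.prodComm P.dual P), ?_, ⟨LinearEquiv.refl Λ _, .refl _, fun a => Prod.ext rfl ?_⟩,
    ⟨LinearEquiv.refl Λ _, .refl _, fun a => Prod.ext rfl ?_⟩⟩
  · refine (QEps.pull_mk _ _).trans (QEps.mk_eq (χ := QEps.pullHom (LinearMap.fst Λ _ _) χ)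
      fun p q => Eq.trans ?_ (hχ p.1 q.1))
    change p.2 q.1 + (ρ' p.1 q.1 - ρ p.1 q.1) - p.2 q.1 = _
    exact add_sub_cancel_left _ _
  · exact (congrArg (a + ·) (map_zero g)).trans (add_zero a)
  · exact add_sub_cancel (ρ a) (ρ' a)

theorem Iso.boundary (hZ : ∀ z ∈ Z, RedK1.conj z ∈ Z) {K K' : BasedModule Λ} {h : K ≃ₗ[Λ] K'}
    (hs : BasedModule.IsSimple Z K K' h) (ρ : K' →ₗ[Λ] SDual Λ K') :
    (boundary Z ε K (QEps.pullHom h.toLinearMap ρ)).Iso (boundary Z ε K' ρ) :=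
  ⟨h.prodCongr (SDual.congr h), hs.prod (hs.dual hZ), QForm.pull_hyp_congr h,
    ⟨h, hs, fun _ => Prod.ext rfl (map_zero (SDual.congr h))⟩,
    ⟨h, hs, fun a => Prod.ext rfl (SDual.ext fun y => by
      change ρ (h a) (h (h.symm y)) = ρ (h a) y
      rw [h.apply_symm_apply])⟩⟩

end QuasiFormation

namespace LMonoid

open QuasiFormation

theorem mk_eq {x y : QuasiFormation Z ε} (h : x.Iso y) : mk x = mk y := Quotient.sound (.iso h)

theorem mk_prod (x y : QuasiFormation Z ε) : mk (x.prod y) = mk x + mk y := rfl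

theorem mk_trivial (P : BasedModule Λ) : mk (trivial Z ε P) = 0 := by
  rw [← zero_add (mk (trivial Z ε P))]
  exact Quotient.sound (.stab _ P)

theorem mk_dualBoundary_zero (P : BasedModule Λ) : mk (dualBoundary Z ε P 0) = 0 :=
  (mk_eq (.flip P)).trans (mk_trivial _)

/-- `(H_ε(P); P*, P) ⊕ (H_ε(P); P, graph(ρ)) ∼ (H_ε(P); P*, graph(ρ))`, and the first summand is
isomorphic to a trivial formation. -/
theorem mk_dualBoundary (P : BasedModule Λ) (ρ : P →ₗ[Λ] SDual Λ P) :
    mk (dualBoundary Z ε P ρ) = mk (boundary Z ε P ρ) := by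
  have ofLagrangian_eq_zero : mk ((boundary Z ε P ρ).ofLagrangian P.dual
      (LinearMap.inr Λ P (SDual Λ P)) (dual_lagrangian P)) = 0 :=
    (mk_eq ⟨LinearEquiv.refl Λ _, .refl _, QEps.pull_id _,
      ⟨LinearEquiv.refl Λ _, .refl _, fun _ => rfl⟩,
      ⟨LinearEquiv.refl Λ _, .refl _, fun _ => rfl⟩⟩).trans (mk_dualBoundary_zero P)
  have shift : mk ((boundary Z ε P ρ).ofLagrangian P.dual
      (LinearMap.inr Λ P (SDual Λ P)) (dual_lagrangian P)) + mk (boundary Z ε P ρ) =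
        mk (dualBoundary Z ε P ρ) := Quotient.sound (.shift _ _ _ _)
  rw [ofLagrangian_eq_zero, zero_add] at shift
  exact shift.symm

theorem mk_boundary_zero (P : BasedModule Λ) : mk (boundary Z ε P 0) = 0 :=
  (mk_dualBoundary P 0).symm.trans (mk_dualBoundary_zero P)

theorem mk_boundary_congr {P : BasedModule Λ} {ρ ρ' : P →ₗ[Λ] SDual Λ P}
    (h : QEps.mk ε ρ = QEps.mk ε ρ') : mk (boundary Z ε P ρ) = mk (boundary Z ε P ρ') := by
  rw [← mk_dualBoundary, ← mk_dualBoundary, mk_eq (.dualBoundary h)]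

theorem mk_boundary_prod_zero {A : BasedModule Λ} (B : BasedModule Λ) (α : A →ₗ[Λ] SDual Λ A) :
    mk (boundary Z ε (A.prod B) ((SDual.prodEquiv A B).symm.toLinearMap.comp (α.prodMap 0))) =
      mk (boundary Z ε A α) := by
  rw [← mk_eq (boundary_prod A B α 0), mk_prod, mk_boundary_zero, add_zero]

theorem mk_boundary_eq (hZ : ∀ z ∈ Z, RedK1.conj z ∈ Z) {K K' : BasedModule Λ}
    {ρ : K →ₗ[Λ] SDual Λ K} {ρ' : K' →ₗ[Λ] SDual Λ K'}
    (h : ZeroStabForms.mk Z (⟨K, QEps.mk ε ρ⟩ : QForm Λ ε) =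
      ZeroStabForms.mk Z ⟨K', QEps.mk ε ρ'⟩) :
    mk (boundary Z ε K ρ) = mk (boundary Z ε K' ρ') := by
  have mk_prod_zero {A : BasedModule Λ} (B : BasedModule Λ) (α : A →ₗ[Λ] SDual Λ A) :
      QEps.mk ε ((SDual.prodEquiv A B).symm.toLinearMap.comp (α.prodMap 0)) =
        QEps.prod (QEps.mk ε α) (0 : QEps (Λ := Λ) ε B) := by
    rw [QEps.prod, map_zero, add_zero, QEps.pull_mk]
    congr 1
    exact LinearMap.ext fun p => SDual.ext fun q => add_zero _
  obtain ⟨P, P', e, he, hψ⟩ := Quotient.exact h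
  rw [← mk_boundary_prod_zero P ρ, ← mk_boundary_prod_zero P' ρ', ← mk_eq (Iso.boundary hZ he _)]
  refine mk_boundary_congr ?_
  rw [← QEps.pull_mk, mk_prod_zero, mk_prod_zero]
  exact hψ.symm

theorem boundaryHom_injOn (hZ : ∀ z ∈ Z, RedK1.conj z ∈ Z) :
    Set.InjOn (boundaryHom (ε := ε) hZ) (elementary Z ε) := by
  rintro _ ⟨K, ρ, rfl⟩ _ ⟨K', ρ', rfl⟩ h
  rw [boundaryHom_mk, boundaryHom_mk, boundaryForms_boundary, boundaryForms_boundary] at h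
  exact mk_boundary_eq hZ (congrArg Prod.fst h)

theorem exists_elementary (hZ : ∀ z ∈ Z, RedK1.conj z ∈ Z) (w : ZeroStabForms Z ε) :
    ∃ x ∈ elementary Z ε, boundaryHom hZ x = (w, w) := by
  obtain ⟨⟨K, ψ⟩⟩ := w
  obtain ⟨ρ, rfl⟩ := QEps.mk_surjective ε ψ
  exact ⟨_, ⟨K, ρ, rfl⟩, boundaryForms_boundary K ρ⟩

theorem boundaryHom_mem_diagonal (hZ : ∀ z ∈ Z, RedK1.conj z ∈ Z) {x : LMonoid Z ε}
    (hx : x ∈ elementary Z ε) : boundaryHom hZ x ∈ diagonal (ZeroStabForms Z ε) := by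
  obtain ⟨K, ρ, rfl⟩ := hx
  rw [boundaryHom_mk, boundaryForms_boundary]
  rfl

/-- The restriction of `b` to an isomorphism from the elementary submonoid to the diagonal. -/
def elementaryEquiv (hZ : ∀ z ∈ Z, RedK1.conj z ∈ Z) :
    elementary Z ε ≃+ diagonal (ZeroStabForms Z ε) :=
  AddEquiv.ofBijective
    (((boundaryHom hZ).comp (elementary Z ε).subtype).codRestrict (diagonal (ZeroStabForms Z ε))
      fun x => boundaryHom_mem_diagonal hZ x.2) <| by
    refine ⟨fun x y h => Subtype.ext (boundaryHom_injOn hZ x.2 y.2 (congrArg Subtype.val h)), ?_⟩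
    rintro ⟨⟨w, w'⟩, hw⟩
    obtain rfl : w = w' := hw
    obtain ⟨x, hx, h⟩ := exists_elementary hZ w
    exact ⟨⟨x, hx⟩, Subtype.ext h⟩

theorem existsUnique_elementary (hZ : ∀ z ∈ Z, RedK1.conj z ∈ Z) (w : ZeroStabForms Z ε) :
    ∃! x, x ∈ elementary Z ε ∧ boundaryHom hZ x = (w, w) := by
  obtain ⟨x, hx, h⟩ := exists_elementary hZ w
  exact ⟨x, ⟨hx, h⟩, fun y hy => boundaryHom_injOn hZ hy.1 hx (hy.2.trans h.symm)⟩

theorem boundaryHom_preimage_zero (hZ : ∀ z ∈ Z, RedK1.conj z ∈ Z) :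
    boundaryHom (ε := ε) hZ ⁻¹' {(0, 0)} = LGroup Z ε := by
  refine Set.Subset.antisymm ?_ ?_
  · rintro ⟨x⟩ h
    exact ⟨x, isFormation_of_boundaryForms_eq_zero h, rfl⟩
  · rintro _ ⟨x, hx, rfl⟩
    exact hx.boundaryForms_eq_zero

end LMonoid

end

end SurgeryMonoid

theorem mainTheorem6_general {Λ : Type*} [Ring Λ] [StarRing Λ] (ε : ℤˣ)
    (Z : AddSubgroup (RedK1 Λ)) (hZ : ∀ z ∈ Z, RedK1.conj z ∈ Z) :
    (∀ x : QuasiFormation Z ε, ∃ W k, x.IsPerp W k) ∧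
    ∃ b : LMonoid Z ε →+ ZeroStabForms Z ε × ZeroStabForms Z ε,
      (∀ x W k, x.IsPerp W k → b (LMonoid.mk x) =
        (ZeroStabForms.mk Z x.formV, ZeroStabForms.mk Z (x.formPerp W k))) ∧
      Set.range b = {p | ∃ r : ℕ,
        p.1 + ZeroStabForms.mk Z (QForm.hyp _ (BasedModule.free Λ r)) =
          p.2 + ZeroStabForms.mk Z (QForm.hyp _ (BasedModule.free Λ r))} ∧
      (∃ e : LMonoid.elementary Z ε ≃+ diagonal (ZeroStabForms Z ε),
        ∀ x, (e x : ZeroStabForms Z ε × ZeroStabForms Z ε) = b x) ∧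
      (∀ w : ZeroStabForms Z ε, ∃! x, x ∈ LMonoid.elementary Z ε ∧ b x = (w, w)) ∧
      b ⁻¹' {(0, 0)} = LMonoid.LGroup Z ε :=
  ⟨fun x => x.exists_isPerp, LMonoid.boundaryHom hZ, fun _ _ _ h => h.boundaryForms_eq,
    LMonoid.range_boundaryHom hZ, ⟨LMonoid.elementaryEquiv hZ, fun _ => rfl⟩,
    LMonoid.existsUnique_elementary hZ, LMonoid.boundaryHom_preimage_zero hZ⟩

theorem mainTheorem6 {Λ : Type*} [Ring Λ] [StarRing Λ] [InvariantBasisNumber Λ]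
    (q : ℕ) (hq : 0 < q) (Z : AddSubgroup (RedK1 Λ)) (hZ : ∀ z ∈ Z, RedK1.conj z ∈ Z) :
    -- every `V^⊥` has a preferred based structure
    (∀ x : QuasiFormation Z ((-1) ^ q), ∃ W k, x.IsPerp W k) ∧
    -- there is a monoid map `b` with `b [M, ψ; L, V] = ([V, θ], [V^⊥, -θ^⊥])`
    ∃ b : LMonoid Z ((-1) ^ q) →+ ZeroStabForms Z ((-1) ^ q) × ZeroStabForms Z ((-1) ^ q),
      (∀ x W k, x.IsPerp W k → b (LMonoid.mk x) =
        (ZeroStabForms.mk Z x.formV, ZeroStabForms.mk Z (x.formPerp W k))) ∧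
      -- the image of `b`
      Set.range b = {p | ∃ r : ℕ,
        p.1 + ZeroStabForms.mk Z (QForm.hyp _ (BasedModule.free Λ r)) =
          p.2 + ZeroStabForms.mk Z (QForm.hyp _ (BasedModule.free Λ r))} ∧
      -- `b` restricts to an isomorphism from the elementary submonoid to the diagonal
      (∃ e : LMonoid.elementary Z ((-1) ^ q) ≃+ diagonal (ZeroStabForms Z ((-1) ^ q)),
        ∀ x, (e x : ZeroStabForms Z ((-1) ^ q) × ZeroStabForms Z ((-1) ^ q)) = b x) ∧
      -- the elementary element `e([w])` is unique
      (∀ w : ZeroStabForms Z ((-1) ^ q), ∃! x, x ∈ LMonoid.elementary Z ((-1) ^ q) ∧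
        b x = (w, w)) ∧
      -- the fibre over `(0, 0)`
      b ⁻¹' {(0, 0)} = LMonoid.LGroup Z ((-1) ^ q) :=
  mainTheorem6_general _ Z hZ
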